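/- Let $\Gamma$ be a real Banach space and let $\{\mathcal R_s\}_{s\in\mathbb R}$ be a one-parameter group of maps $\Gamma\to\Gamma$ ($\mathcal R_0=\mathrm{id}$, $\mathcal R_{s+t}=\mathcal R_s\circ\mathcal R_t$). Write $\dot{\mathcal R}(U)=\frac{d}{ds}\mathcal R_sU|_{s=0}$, and let $\mathcal T_{s,U}$ be the Fréchet derivative of $\mathcal R_s$ at $U$. Let $U_{\rm lc}=\{U_{\rm lc}^{(s)}\mid s\in\mathbb R\}$, $U_{\rm lc}^{(s)}=\mathcal R_sU_{\rm lc}^{(0)}$, be a periodic orbit with fundamental period $\Delta>0$. Put $\mathrm{dist}(U,U_{\rm lc})=\inf_s\|U-U_{\rm lc}^{(s)}\|$ and $F_0=\dot{\mathcal R}(U_{\rm lc}^{(0)})$. Assume: (L1′) $\Gamma=E^{\rm u}\oplus E^{\rm c}\oplus E^{\rm s}$ with subspaces invariant under $\mathcal T_\Delta:=\mathcal T_{\Delta,U_{\rm lc}^{(0)}}$, where $E^{\rm c}$ is one-dimensional and spanned by $F_0$, $\mathcal T_\Delta F_0=F_0$, $\dim E^{\rm u}=N<\infty$, $\operatorname{codim}E^{\rm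 s}=N+1$, and for some $\bar\kappa>0$ one has $\|\mathcal T_\Delta F\|\ge e^{\bar\kappa\Delta}\|F\|$ for $F\in E^{\rm u}$ and $\|\mathcal T_\Delta F\|\le e^{-\bar\kappa\Delta}\|F\|$ for $F\in E^{\rm s}$. (L2′) $(s,U)\mapsto\mathcal R_sU$ is of class $C^{1,1}$ in a tubular neighbourhood of $U_{\rm lc}$: there is $\delta_0'>0$ such that for every $T>0$ there are $\delta_0>0$ and $K$ with $$\|\mathcal R_{s'}U-\mathcal R_sU-(s'-s)\dot{\mathcal R}(\mathcal R_sU)\|\le K|s'-s|^2,\qquad \|\mathcal R_sU'-\mathcal R_sU-\mathcal T_{s,U}(U'-U)\|\le K\|U'-U\|^2$$ whenever $0\le s\le T$, $|s'-s|<\delta_0$, $\|U'-U\|<\delta_0$ and $\mathrm{dist}(\mathcal R_{s''}U,U_{\rm lc})<\delta_0'$ for all $0\le s''\le s$. Let $W^{\rm s}(U_{\rm lc})$ (resp. $W^{\rm u}(U_{\rm lc})$) be the set of $U\in\Gamma$ with $\mathrm{dist}(\mathcal R_tU,U_{\rm lc})\to0$ as $t\to+\infty$ (resp. $t\to-\infty$).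 For an open set $V\supset U_{\rm lc}$ let $W^{\rm s}_V$ (resp. $W^{\rm u}_V$) be the set of those $U\in W^{\rm s}(U_{\rm lc})$ (resp. $W^{\rm u}(U_{\rm lc})$) with $\mathcal R_tU\in V$ for all $t\ge0$ (resp. $t\le0$). Put $Y^{(s)}=\mathcal T_{s,U_{\rm lc}^{(0)}}(E^{\rm u}\oplus E^{\rm s})$ and $S^{(s)}=U_{\rm lc}^{(s)}+Y^{(s)}$, $S=S^{(0)}$. Then: (a) There is $\delta>0$ such that, with $V=\{U\mid\mathrm{dist}(U,U_{\rm lc})<\delta\}$, the set $W^{\rm s}_V$ is a $C^{1,1}$ submanifold of $\Gamma$ of codimension $N$ and $W^{\rm u}_V$ is a $C^{1,1}$ submanifold of dimension $N+1$; for every $s\in\mathbb R$ their tangent spaces at $U_{\rm lc}^{(s)}$ are $\mathcal T_{s,U_{\rm lc}^{(0)}}(E^{\rm s}\oplus E^{\rm c})$ and $\mathcal T_{s,U_{\rm lc}^{(0)}}(E^{\rm u}\oplus E^{\rm c})$, respectively. (b) For every $s\in[-\Delta,\Delta]$ there are a Poincaré map $\mathcal P^{(s)}(U)=\mathcal R_{p_s(U)}U\in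 S^{(s)}$, defined near $U_{\rm lc}^{(s)}$ with $p_s$ of class $C^{1,1}$ and $p_s(U_{\rm lc}^{(s)})=\Delta$, and a transit map $\bar{\mathcal P}_s(U)=\mathcal R_{\bar p_s(U)}U\in S^{(s)}$, defined near $U_{\rm lc}^{(0)}$ with $\bar p_s$ of class $C^{1,1}$ and $\bar p_s(U_{\rm lc}^{(0)})=s$. There are local stable and unstable manifolds $W^{\rm s}(U_{\rm lc}^{(s)},S^{(s)})$ and $W^{\rm u}(U_{\rm lc}^{(s)},S^{(s)})$ of $(S^{(s)},\mathcal P^{(s)})$ at $U_{\rm lc}^{(s)}$: for suitable open neighbourhoods of $U_{\rm lc}^{(s)}$ (possibly different for the two) they are the sets of points of $S^{(s)}$ whose forward $\mathcal P^{(s)}$-orbit stays in the neighbourhood and converges to $U_{\rm lc}^{(s)}$, respectively which have a backward $\mathcal P^{(s)}$-orbit in $S^{(s)}$ that stays in the neighbourhood and converges to $U_{\rm lc}^{(s)}$. They are $C^{1,1}$ submanifolds, of codimension $N$ in $S^{(s)}$ and of dimension $N$, with tangent spaces $\mathcal T_{s,U_{\rm lc}^{(0)}}E^{\rm s}$ and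 $\mathcal T_{s,U_{\rm lc}^{(0)}}E^{\rm u}$ at $U_{\rm lc}^{(s)}$. Moreover $\bar{\mathcal P}_s$ is defined on $W^{\rm s}(U_{\rm lc}^{(0)},S)$ and $W^{\rm u}(U_{\rm lc}^{(0)},S)$, and $$W^{\rm s}(U_{\rm lc}^{(s)},S^{(s)})=\bar{\mathcal P}_sW^{\rm s}(U_{\rm lc}^{(0)},S),\qquad W^{\rm u}(U_{\rm lc}^{(s)},S^{(s)})=\bar{\mathcal P}_sW^{\rm u}(U_{\rm lc}^{(0)},S).$$ (c) $W^{\rm s}(U_{\rm lc})=\bigcup_{s\in\mathbb R}\mathcal R_sW^{\rm s}(U_{\rm lc}^{(0)},S)$ and $W^{\rm u}(U_{\rm lc})=\bigcup_{s\in\mathbb R}\mathcal R_sW^{\rm u}(U_{\rm lc}^{(0)},S)$. -/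

import Mathlib

open Set Filter Topology

namespace RG

variable {Γ : Type*} [NormedAddCommGroup Γ] [NormedSpace ℝ Γ]

/-! ### `C^{1,1}` maps and submanifolds of a Banach space -/

/-- `f` is of class `C^{1,1}` on the (open) set `O`: differentiable at every point, with a locally
Lipschitz Fréchet derivative. -/
def C11On {G : Type*} [NormedAddCommGroup G] [NormedSpace ℝ G] (f : Γ → G) (O : Set Γ) : Prop :=
  (∀ x ∈ O, DifferentiableAt ℝ f x) ∧ LocallyLipschitzOn O (fderiv ℝ f)

/-- The subspace `E` has (finite) dimension `n`. -/
def HasDim (n : ℕ) (E : Submodule ℝ Γ) : Prop :=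
  Module.Finite ℝ E ∧ Module.finrank ℝ E = n

/-- The subspace `E` has (finite) codimension `n`. -/
def HasCodim (n : ℕ) (E : Submodule ℝ Γ) : Prop :=
  Module.Finite ℝ (Γ ⧸ E) ∧ Module.finrank ℝ (Γ ⧸ E) = n

/-- `M` is an embedded `C^{1,1}` submanifold (without boundary): around each of its points a
`C^{1,1}` diffeomorphism between open subsets of `Γ` straightens `M` to a closed complemented
linear subspace `E`. The predicate `Size` prescribes the dimension or the codimension of `E`. -/
def IsC11Submanifold (Size : Submodule ℝ Γ → Prop) (M : Set Γ) : Prop :=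
  ∀ x ∈ M, ∃ E : Submodule ℝ Γ, E.ClosedComplemented ∧ Size E ∧
    ∃ φ : OpenPartialHomeomorph Γ Γ, x ∈ φ.source ∧ C11On φ φ.source ∧ C11On φ.symm φ.target ∧
      φ '' (M ∩ φ.source) = (E : Set Γ) ∩ φ.target

/-- The tangent space of `M` at `x`: velocities at time `0` of curves in `M` through `x`. -/
def tangentSet (M : Set Γ) (x : Γ) : Set Γ :=
  {v | ∃ γ : ℝ → Γ, γ 0 = x ∧ (∀ᶠ t in 𝓝 (0 : ℝ), γ t ∈ M) ∧ HasDerivAt γ v 0}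

/-! ### The flow, its generator, its tangent maps, and limit cycles -/

/-- `R` is a one-parameter group of transformations of `Γ`. -/
structure IsFlow (R : ℝ → Γ → Γ) : Prop where
  zero : ∀ U, R 0 U = U
  add : ∀ s t U, R (s + t) U = R s (R t U)

/-- The infinitesimal generator: the derivative of `s ↦ R s U` at `s = 0`. -/
noncomputable def generator (R : ℝ → Γ → Γ) (U : Γ) : Γ := deriv (fun s => R s U) 0

/-- The tangent map (Fréchet derivative) of `R s` at `U`. -/
noncomputable def flowTangent (R : ℝ → Γ → Γ) (s : ℝ) (U : Γ) : Γ →L[ℝ] Γ := fderiv ℝ (R s) U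

/-- The orbit of `U₀`. -/
def cycle (R : ℝ → Γ → Γ) (U₀ : Γ) : Set Γ := range fun s => R s U₀

/-- The orbit `s ↦ R s U₀` is a limit cycle with fundamental period `Δ > 0`. -/
structure IsLimitCycle (R : ℝ → Γ → Γ) (U₀ : Γ) (Δ : ℝ) : Prop where
  pos : 0 < Δ
  periodic : R Δ U₀ = U₀
  fundamental : ∀ t, 0 < t → t < Δ → R t U₀ ≠ U₀

/-- The orbit direction at `U₀`, spanned by the tangent vector of the cycle. -/
noncomputable def Ec (R : ℝ → Γ → Γ) (U₀ : Γ) : Submodule ℝ Γ :=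
  Submodule.span ℝ {generator R U₀}

/-- Invariant subspaces of the tangent map over one period: `Γ = Eu ⊕ Ec ⊕ Es`, where `Ec` is a
one-dimensional eigenspace of eigenvalue `1` spanned by the orbit direction, `Eu` is expanded and
has dimension `N`, and `Es` is contracted and has codimension `N + 1`. -/
structure AssumptionL1 (R : ℝ → Γ → Γ) (U₀ : Γ) (Δ : ℝ) (N : ℕ) (Eu Es : Submodule ℝ Γ) :
    Prop where
  disjoint_u_c : Disjoint Eu (Ec R U₀)
  isCompl : IsCompl (Eu ⊔ Ec R U₀) Es
  generator_ne_zero : generator R U₀ ≠ 0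
  map_generator : flowTangent R Δ U₀ (generator R U₀) = generator R U₀
  map_u : ∀ F ∈ Eu, flowTangent R Δ U₀ F ∈ Eu
  map_s : ∀ F ∈ Es, flowTangent R Δ U₀ F ∈ Es
  dim_u : HasDim N Eu
  codim_s : HasCodim (N + 1) Es
  rate : ∃ κ : ℝ, 0 < κ ∧
    (∀ F ∈ Eu, Real.exp (κ * Δ) * ‖F‖ ≤ ‖flowTangent R Δ U₀ F‖) ∧
    (∀ F ∈ Es, ‖flowTangent R Δ U₀ F‖ ≤ Real.exp (-κ * Δ) * ‖F‖)

/-- `(s, U) ↦ R s U` is of class `C^{1,1}` in a tubular neighbourhood of the cycle: first order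
expansions in `s` and in `U` with quadratic remainders, along orbit segments that stay in a tube
of radius `δ'`. The remainder constants are uniform for bounded times only. The estimates entail
that the derivatives `generator` and `flowTangent` exist where they occur. -/
def AssumptionL2 (R : ℝ → Γ → Γ) (U₀ : Γ) : Prop :=
  ∃ δ' : ℝ, 0 < δ' ∧ ∀ T : ℝ, 0 < T → ∃ δ : ℝ, 0 < δ ∧ ∃ K : ℝ,
    ∀ (s s' : ℝ) (U U' : Γ), 0 ≤ s → s ≤ T → |s' - s| < δ → ‖U' - U‖ < δ →
      (∀ s'' ∈ Icc 0 s, Metric.infDist (R s'' U) (cycle R U₀) < δ') →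
      ‖R s' U - R s U - (s' - s) • generator R (R s U)‖ ≤ K * |s' - s| ^ 2 ∧
      ‖R s U' - R s U - flowTangent R s U (U' - U)‖ ≤ K * ‖U' - U‖ ^ 2

/-! ### Stable and unstable sets of the cycle -/

/-- Points whose forward orbit converges to the set `C`. -/
def stableSet (R : ℝ → Γ → Γ) (C : Set Γ) : Set Γ :=
  {U | Tendsto (fun t => Metric.infDist (R t U) C) atTop (𝓝 0)}

/-- Points whose backward orbit converges to the set `C`. -/
def unstableSet (R : ℝ → Γ → Γ) (C : Set Γ) : Set Γ :=
  {U | Tendsto (fun t => Metric.infDist (R t U) C) atBot (𝓝 0)}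

/-- The stable set of `C` relative to `V`: the forward orbit stays in `V` and converges to `C`. -/
def localStableSet (R : ℝ → Γ → Γ) (C V : Set Γ) : Set Γ :=
  {U | U ∈ stableSet R C ∧ ∀ t, 0 ≤ t → R t U ∈ V}

/-- The unstable set of `C` relative to `V`: the backward orbit stays in `V` and converges
to `C`. -/
def localUnstableSet (R : ℝ → Γ → Γ) (C V : Set Γ) : Set Γ :=
  {U | U ∈ unstableSet R C ∧ ∀ t, t ≤ 0 → R t U ∈ V}

/-! ### Poincaré sections and Poincaré maps -/

/-- The direction `Y^{(s)}` of the section at the point `R s U₀`: the image of `Eu ⊕ Es` under the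
tangent map. -/
noncomputable def sectionDir (R : ℝ → Γ → Γ) (U₀ : Γ) (Eu Es : Submodule ℝ Γ) (s : ℝ) :
    Submodule ℝ Γ :=
  (Eu ⊔ Es).map (flowTangent R s U₀ : Γ →ₗ[ℝ] Γ)

/-- The Poincaré section `S^{(s)}`: the affine subspace through `R s U₀` in direction `Y^{(s)}`. -/
def poincareSection (R : ℝ → Γ → Γ) (U₀ : Γ) (Eu Es : Submodule ℝ Γ) (s : ℝ) : Set Γ :=
  {U | U - R s U₀ ∈ sectionDir R U₀ Eu Es s}

/-- `p` is a `C^{1,1}` time function on the open neighbourhood `O` of `x`, with `p x = τ`, such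
that the flow carries every `U ∈ O` into the section `B` after time `p U`. -/
structure IsTransitTime (R : ℝ → Γ → Γ) (B : Set Γ) (x : Γ) (τ : ℝ) (O : Set Γ) (p : Γ → ℝ) :
    Prop where
  isOpen : IsOpen O
  mem : x ∈ O
  c11 : C11On p O
  time : p x = τ
  transit_mem : ∀ U ∈ O, R (p U) U ∈ B

/-- The map `U ↦ R (p U) U` defined by a time function. -/
def transit (R : ℝ → Γ → Γ) (p : Γ → ℝ) (U : Γ) : Γ := R (p U) U

/-- The local stable set, relative to `V`, of the fixed point `x` of the map `P` on `A`. -/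
def mapStableSet (P : Γ → Γ) (A V : Set Γ) (x : Γ) : Set Γ :=
  {U | U ∈ A ∧ (∀ n : ℕ, P^[n] U ∈ V) ∧ Tendsto (fun n : ℕ => P^[n] U) atTop (𝓝 x)}

/-- The local unstable set, relative to `V`, of the fixed point `x` of the map `P` on `A`: points
with a backward `P`-orbit in `A ∩ V` that converges to `x`. -/
def mapUnstableSet (P : Γ → Γ) (A V : Set Γ) (x : Γ) : Set Γ :=
  {U | ∃ u : ℕ → Γ, u 0 = U ∧ (∀ n, u n ∈ A ∩ V) ∧ (∀ n, P (u (n + 1)) = u n) ∧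
    Tendsto u atTop (𝓝 x)}

/-- `W` is a (local) stable manifold of the system `(A, P)` at its fixed point `x`, where `P` is
defined on `A ∩ O`: it is the stable set relative to some neighbourhood of `x`, and a `C^{1,1}`
submanifold of the prescribed size with tangent space `E` at `x`. -/
def IsStableManifold (P : Γ → Γ) (A O : Set Γ) (x : Γ) (Size : Submodule ℝ Γ → Prop)
    (E : Submodule ℝ Γ) (W : Set Γ) : Prop :=
  (∃ V : Set Γ, IsOpen V ∧ x ∈ V ∧ V ⊆ O ∧ W = mapStableSet P A V x) ∧
    IsC11Submanifold Size W ∧ tangentSet W x = E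

/-- The same for a (local) unstable manifold. -/
def IsUnstableManifold (P : Γ → Γ) (A O : Set Γ) (x : Γ) (Size : Submodule ℝ Γ → Prop)
    (E : Submodule ℝ Γ) (W : Set Γ) : Prop :=
  (∃ V : Set Γ, IsOpen V ∧ x ∈ V ∧ V ⊆ O ∧ W = mapUnstableSet P A V x) ∧
    IsC11Submanifold Size W ∧ tangentSet W x = E

end RG

open RG

/-! Everything rests on one stable manifold theorem for a hyperbolic fixed point, applied to a
return map of the flow and then to the return map of the time-reversed flow.

Regularity. (L2′) expands separately in `s` and in `U`, for forward times only. Joint `C^{1,1}`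
regularity also needs a Lipschitz generator. Over a short time `τ`, the displacement `R τ V - V` is
the time integral of the tangent maps applied to `generator R V`. Their average is close to the
identity, so the generator inherits the Lipschitz dependence of the flow and of its tangent maps
(`FlowExpansion.exists_generator_lipschitz`). The inverse function theorem then supplies negative
times (`AssumptionL2.c11At`).

Stable manifold (`exists_stable_graph`). The orbits that converge to the fixed point are null
sequences solving one equation in `C₀(ℕ, A × B)`. Its linearization at `0` is the identity minus a
contraction, so the inverse function theorem parametrizes the solutions by the stable component of
their initial point. This is Irwin's method; it works in `C^{1,1}` because the superposition
operator on null sequences is as regular as the map itself.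

Return map. `returnMap` is defined on a full neighbourhood of `U₀`, not only on the section. Its
derivative acts as the tangent map over a period on `Es` and `Eu` and kills the flow direction, so
that direction simply joins the stable ones. The resulting stable manifold is locally the stable set
of the cycle, and its trace on the section is the stable manifold of the Poincaré map; one chart
serves both (`TransitSys.exists_stableChart`). The passage between continuous and discrete time is
made by `TransitSys.exists_nhds_subset_localStableSet` and
`TransitSys.exists_localStableSet_subset`.

Spreading. Any point attracted by the cycle flows into this local piece. The flow is a local
diffeomorphism along orbits in a thin tube, so the manifold structure can be pulled back
(`HypCycle.exists_stableManifold`). The transit maps `slide R q s` conjugate the return maps of the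
different sections and carry the manifolds along (`HypCycle.exists_sectionManifolds`).

Reversal. `HypCycle` is formulated so that reversing time only exchanges `Es` and `Eu`; the unstable
half is the stable half for the reversed flow (`HypCycle.reverse`, `mapUnstableSet_eq`). -/

set_option linter.unusedSectionVars false

namespace RG

/-! ### Calculus of `C^{1,1}` germs: composition, quadratic remainders, inverse functions. -/

section Calculus

variable {X Y Z W : Type*} [NormedAddCommGroup X] [NormedSpace ℝ X]
  [NormedAddCommGroup Y] [NormedSpace ℝ Y] [NormedAddCommGroup Z] [NormedSpace ℝ Z]
  [NormedAddCommGroup W] [NormedSpace ℝ W]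

/-! ### Maps that are Lipschitz near a point -/

/-- `f` is Lipschitz on a neighbourhood of `x`. -/
def LipAt {X Y : Type*} [PseudoEMetricSpace X] [PseudoEMetricSpace Y] (f : X → Y) (x : X) : Prop :=
  ∃ K, ∃ t ∈ 𝓝 x, LipschitzOnWith K f t

section

variable {X Y Z : Type*} [PseudoEMetricSpace X] [PseudoEMetricSpace Y] [PseudoEMetricSpace Z]

theorem LipAt.continuousAt {f : X → Y} {x : X} (h : LipAt f x) : ContinuousAt f x := by
  obtain ⟨K, t, ht, hf⟩ := h
  exact hf.continuousOn.continuousAt ht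

theorem LipAt.eventually {f : X → Y} {x : X} (h : LipAt f x) : ∀ᶠ y in 𝓝 x, LipAt f y := by
  obtain ⟨K, t, ht, hf⟩ := h
  filter_upwards [eventually_mem_nhds_iff.2 ht] with y hy
  exact ⟨K, t, hy, hf⟩

theorem LipAt.comp {g : Y → Z} {f : X → Y} {x : X} (hg : LipAt g (f x)) (hf : LipAt f x) :
    LipAt (fun y => g (f y)) x := by
  have hc := hf.continuousAt
  obtain ⟨K, t, ht, hf⟩ := hf
  obtain ⟨K', t', ht', hg⟩ := hg
  exact ⟨K' * K, t ∩ f ⁻¹' t', inter_mem ht (hc ht'),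
    hg.comp (hf.mono inter_subset_left) fun y hy => hy.2⟩

theorem LipAt.prodMk {f : X → Y} {g : X → Z} {x : X} (hf : LipAt f x) (hg : LipAt g x) :
    LipAt (fun y => (f y, g y)) x := by
  obtain ⟨K, t, ht, hf⟩ := hf
  obtain ⟨K', t', ht', hg⟩ := hg
  exact ⟨_, t ∩ t', inter_mem ht ht',
    (hf.mono inter_subset_left).prodMk (hg.mono inter_subset_right)⟩

theorem LipAt.congr {f g : X → Y} {x : X} (hf : LipAt f x) (h : f =ᶠ[𝓝 x] g) : LipAt g x := by
  obtain ⟨K, t, ht, hf⟩ := hf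
  refine ⟨K, t ∩ {y | f y = g y}, inter_mem ht h, fun y hy z hz => ?_⟩
  rw [← hy.2, ← hz.2]
  exact hf hy.1 hz.1

end

theorem _root_.ContDiffAt.lipAt {f : X → Y} {x : X} (h : ContDiffAt ℝ 1 f x) : LipAt f x :=
  h.exists_lipschitzOnWith

/-! ### Maps that are of class `C^{1,1}` near a point -/

/-- `f` is of class `C^{1,1}` on a neighbourhood of `x`. -/
def C11At (f : X → Y) (x : X) : Prop :=
  (∀ᶠ y in 𝓝 x, DifferentiableAt ℝ f y) ∧ LipAt (fderiv ℝ f) x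

theorem c11On_iff {f : X → Y} {O : Set X} (hO : IsOpen O) : C11On f O ↔ ∀ x ∈ O, C11At f x := by
  constructor
  · rintro ⟨h1, h2⟩ x hx
    refine ⟨eventually_of_mem (hO.mem_nhds hx) h1, ?_⟩
    obtain ⟨K, t, ht, h⟩ := h2 hx
    rw [hO.nhdsWithin_eq hx] at ht
    exact ⟨K, t, ht, h⟩
  · refine fun h => ⟨fun x hx => (h x hx).1.self_of_nhds, fun x hx => ?_⟩
    obtain ⟨K, t, ht, h⟩ := (h x hx).2
    exact ⟨K, t, mem_nhdsWithin_of_mem_nhds ht, h⟩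

theorem C11At.differentiableAt {f : X → Y} {x : X} (h : C11At f x) : DifferentiableAt ℝ f x :=
  h.1.self_of_nhds

theorem C11At.hasFDerivAt {f : X → Y} {x : X} (h : C11At f x) :
    HasFDerivAt f (fderiv ℝ f x) x :=
  h.differentiableAt.hasFDerivAt

theorem C11At.continuousAt {f : X → Y} {x : X} (h : C11At f x) : ContinuousAt f x :=
  h.differentiableAt.continuousAt

theorem C11At.continuousAt_fderiv {f : X → Y} {x : X} (h : C11At f x) :
    ContinuousAt (fderiv ℝ f) x :=
  h.2.continuousAt

theorem C11At.eventually {f : X → Y} {x : X} (h : C11At f x) : ∀ᶠ y in 𝓝 x, C11At f y := by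
  filter_upwards [h.1.eventually_nhds, h.2.eventually] with y h1 h2 using ⟨h1, h2⟩

theorem C11At.hasStrictFDerivAt {f : X → Y} {x : X} (h : C11At f x) :
    HasStrictFDerivAt f (fderiv ℝ f x) x :=
  hasStrictFDerivAt_of_hasFDerivAt_of_continuousAt (h.1.mono fun _ hy => hy.hasFDerivAt)
    h.continuousAt_fderiv

theorem C11At.lipAt {f : X → Y} {x : X} (h : C11At f x) : LipAt f x :=
  h.hasStrictFDerivAt.exists_lipschitzOnWith

theorem C11At.congr {f g : X → Y} {x : X} (hf : C11At f x) (h : f =ᶠ[𝓝 x] g) : C11At g x := by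
  refine ⟨?_, hf.2.congr h.fderiv⟩
  filter_upwards [hf.1, h.eventually_nhds] with y hy hy'
  exact hy.congr_of_eventuallyEq (EventuallyEq.symm hy')

theorem C11At.of_hasFDerivAt {f : X → Y} {f' : X → X →L[ℝ] Y} {x : X}
    (h : ∀ᶠ y in 𝓝 x, HasFDerivAt f (f' y) y) (h' : LipAt f' x) : C11At f x :=
  ⟨h.mono fun _ hy => hy.differentiableAt, h'.congr (h.mono fun _ hy => hy.fderiv.symm)⟩

theorem _root_.ContDiffAt.c11At {f : X → Y} {x : X} (h : ContDiffAt ℝ 2 f x) : C11At f x := by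
  refine ⟨?_, (h.fderiv_right (m := 1) (by norm_num)).lipAt⟩
  exact (h.eventually (by simp)).mono fun y hy => hy.differentiableAt (by norm_num)

theorem _root_.ContDiff.c11At {f : X → Y} (h : ContDiff ℝ 2 f) (x : X) : C11At f x :=
  h.contDiffAt.c11At

theorem C11At.comp {g : Y → Z} {f : X → Y} {x : X} (hg : C11At g (f x)) (hf : C11At f x) :
    C11At (fun y => g (f y)) x := by
  have hc := hf.continuousAt
  refine C11At.of_hasFDerivAt (f' := fun y => (fderiv ℝ g (f y)).comp (fderiv ℝ f y)) ?_ ?_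
  · filter_upwards [hf.1, hc.eventually hg.1] with y h1 h2
    exact h2.hasFDerivAt.comp y h1.hasFDerivAt
  · have h1 : LipAt (fun y => (fderiv ℝ g (f y), fderiv ℝ f y)) x :=
      (LipAt.comp (f := f) (g := fderiv ℝ g) hg.2 hf.lipAt).prodMk hf.2
    have h2 : ContDiff ℝ 1 (fun p : (Y →L[ℝ] Z) × (X →L[ℝ] Y) => p.1.comp p.2) :=
      isBoundedBilinearMap_comp.contDiff
    have h3 : LipAt (fun p : (Y →L[ℝ] Z) × (X →L[ℝ] Y) => p.1.comp p.2)
      (fderiv ℝ g (f x), fderiv ℝ f x) := h2.contDiffAt.lipAt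
    exact LipAt.comp (f := fun y => (fderiv ℝ g (f y), fderiv ℝ f y)) h3 h1

theorem C11At.comp' {g : Y → Z} {f : X → Y} {x : X} {y : Y} (hg : C11At g y) (hf : C11At f x)
    (hy : f x = y) : C11At (fun z => g (f z)) x := by
  subst hy; exact hg.comp hf

theorem C11At.prodMk {f : X → Y} {g : X → Z} {x : X} (hf : C11At f x) (hg : C11At g x) :
    C11At (fun y => (f y, g y)) x := by
  refine C11At.of_hasFDerivAt (f' := fun y => (fderiv ℝ f y).prod (fderiv ℝ g y)) ?_ ?_
  · filter_upwards [hf.1, hg.1] with y h1 h2 using h1.hasFDerivAt.prodMk h2.hasFDerivAt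
  · have h2 : ContDiff ℝ 1 (fun p : (X →L[ℝ] Y) × (X →L[ℝ] Z) => p.1.prod p.2) :=
      (ContinuousLinearMap.prodₗᵢ ℝ (𝕜 := ℝ) (E := X) (F := Y) (G := Z)).contDiff
    have h3 : LipAt (fun p : (X →L[ℝ] Y) × (X →L[ℝ] Z) => p.1.prod p.2)
      (fderiv ℝ f x, fderiv ℝ g x) := h2.contDiffAt.lipAt
    exact LipAt.comp (f := fun y => (fderiv ℝ f y, fderiv ℝ g y)) h3 (hf.2.prodMk hg.2)

theorem C11At.const (y : Y) (x : X) : C11At (fun _ : X => y) x := contDiff_const.c11At x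

theorem C11At.id (x : X) : C11At (fun y : X => y) x := contDiff_id.c11At x

theorem C11At.clm (L : X →L[ℝ] Y) (x : X) : C11At (fun y => L y) x := L.contDiff.c11At x

theorem C11At.clm_comp (L : Y →L[ℝ] Z) {f : X → Y} {x : X} (hf : C11At f x) :
    C11At (fun y => L (f y)) x := C11At.comp (g := fun y => L y) (C11At.clm L _) hf

theorem C11At.add {f g : X → Y} {x : X} (hf : C11At f x) (hg : C11At g x) :
    C11At (fun y => f y + g y) x :=
  C11At.comp (g := fun p : Y × Y => p.1 + p.2) (contDiff_add.c11At _) (hf.prodMk hg)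

theorem C11At.neg {f : X → Y} {x : X} (hf : C11At f x) : C11At (fun y => -f y) x :=
  C11At.comp (g := fun p : Y => -p) (contDiff_neg.c11At _) hf

theorem C11At.sub {f g : X → Y} {x : X} (hf : C11At f x) (hg : C11At g x) :
    C11At (fun y => f y - g y) x := by
  simpa [sub_eq_add_neg] using hf.add hg.neg

theorem C11At.fst {x : X × Y} : C11At (fun p : X × Y => p.1) x := contDiff_fst.c11At _

theorem C11At.snd {x : X × Y} : C11At (fun p : X × Y => p.2) x := contDiff_snd.c11At _

/-! ### The quadratic characterization -/

/-- Expanding along the triangle `x`, `y`, `y + k` with `‖k‖ = ‖y - x‖` writes `(L y - L x) k` as a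
combination of three remainders; they contribute `4 + 1 + 1` times `K ‖y - x‖ ^ 2`. The radius `r /
3` keeps `y + k` in the ball, and homogeneity handles other `k`. -/
theorem norm_sub_le_of_quadratic {f : X → Y} {L : X → X →L[ℝ] Y} {K r : ℝ} {x₀ : X}
    (h : ∀ x ∈ Metric.ball x₀ r, ∀ x' ∈ Metric.ball x₀ r,
      ‖f x' - f x - L x (x' - x)‖ ≤ K * ‖x' - x‖ ^ 2) {x y : X}
    (hx : x ∈ Metric.ball x₀ (r / 3)) (hy : y ∈ Metric.ball x₀ (r / 3)) :
    ‖L y - L x‖ ≤ 6 * K * ‖y - x‖ := by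
  rcases eq_or_ne y x with rfl | hne
  · simp
  have hd : 0 < ‖y - x‖ := norm_pos_iff.2 (sub_ne_zero.2 hne)
  rw [Metric.mem_ball, dist_eq_norm] at hx hy
  have hr : 0 < r := by linarith [norm_nonneg (x - x₀)]
  have hdr : ‖y - x‖ < 2 * r / 3 := by
    have : y - x = (y - x₀) - (x - x₀) := by abel
    rw [this]
    linarith [norm_sub_le (y - x₀) (x - x₀)]
  have hxr : x ∈ Metric.ball x₀ r := by rw [Metric.mem_ball, dist_eq_norm]; linarith
  have hyr : y ∈ Metric.ball x₀ r := by rw [Metric.mem_ball, dist_eq_norm]; linarith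
  have hK : 0 ≤ K := by
    have := (norm_nonneg _).trans (h x hxr y hyr)
    by_contra hK
    push Not at hK
    nlinarith [mul_pos (neg_pos.2 hK) (pow_pos hd 2)]
  have key : ∀ k : X, ‖k‖ = ‖y - x‖ → ‖(L y - L x) k‖ ≤ 6 * K * ‖y - x‖ * ‖k‖ := by
    intro k hk
    have hkr : y + k ∈ Metric.ball x₀ r := by
      rw [Metric.mem_ball, dist_eq_norm]
      have : y + k - x₀ = (y - x₀) + k := by abel
      rw [this]
      linarith [norm_add_le (y - x₀) k]
    have h1 := h y hyr (y + k) hkr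
    have h2 := h x hxr (y + k) hkr
    have h3 := h x hxr y hyr
    have e : (L y - L x) k = (f (y + k) - f x - L x (y + k - x)) -
        (f (y + k) - f y - L y (y + k - y)) - (f y - f x - L x (y - x)) := by
      simp only [sub_apply, map_sub, map_add]
      abel
    have h4 : ‖y + k - x‖ ≤ 2 * ‖y - x‖ := by
      have : y + k - x = (y - x) + k := by abel
      rw [this]
      linarith [norm_add_le (y - x) k]
    have h5 : ‖y + k - x‖ ^ 2 ≤ 4 * ‖y - x‖ ^ 2 := by
      nlinarith [norm_nonneg (y + k - x), norm_nonneg (y - x)]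
    rw [add_sub_cancel_left, hk] at h1
    rw [e, hk]
    refine (norm_sub_le _ _).trans ?_
    have h6 := norm_sub_le (f (y + k) - f x - L x (y + k - x))
      (f (y + k) - f y - L y (y + k - y))
    rw [add_sub_cancel_left] at h6 ⊢
    nlinarith
  refine ContinuousLinearMap.opNorm_le_of_unit_norm (by positivity) fun k hk => ?_
  have := key (‖y - x‖ • k) (by rw [norm_smul, hk]; simp)
  rw [map_smul, norm_smul, norm_smul, hk, norm_norm] at this
  have h' : ‖y - x‖ * ‖(L y - L x) k‖ ≤ ‖y - x‖ * (6 * K * ‖y - x‖) := by linarith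
  exact le_of_mul_le_mul_left h' hd

theorem hasFDerivAt_of_quadratic {f : X → Y} {L : X →L[ℝ] Y} {K : ℝ} {x : X}
    (h : ∀ᶠ x' in 𝓝 x, ‖f x' - f x - L (x' - x)‖ ≤ K * ‖x' - x‖ ^ 2) : HasFDerivAt f L x := by
  refine HasFDerivAt.of_isLittleO ?_
  rw [Asymptotics.isLittleO_iff]
  intro c hc
  have h2 : ∀ᶠ x' in 𝓝 x, K * ‖x' - x‖ < c := by
    have : ContinuousAt (fun x' => K * ‖x' - x‖) x := by fun_prop
    exact this.eventually (gt_mem_nhds (by simpa using hc))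
  filter_upwards [h, h2] with y hy hy2
  nlinarith [norm_nonneg (y - x)]

/-- This is how (L2′) becomes differentiability: a uniform quadratic remainder identifies `L` as the
derivative and also makes it Lipschitz, so no regularity of `L` has to be assumed. -/
theorem C11At.of_quadratic {f : X → Y} {L : X → X →L[ℝ] Y} {K r : ℝ} {x₀ : X} (hr : 0 < r)
    (h : ∀ x ∈ Metric.ball x₀ r, ∀ x' ∈ Metric.ball x₀ r,
      ‖f x' - f x - L x (x' - x)‖ ≤ K * ‖x' - x‖ ^ 2) : C11At f x₀ := by
  refine C11At.of_hasFDerivAt (f' := L) ?_ ?_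
  · filter_upwards [Metric.ball_mem_nhds x₀ hr] with y hy
    exact hasFDerivAt_of_quadratic
      (eventually_of_mem (Metric.isOpen_ball.mem_nhds hy) fun z hz => h y hy z hz)
  · refine ⟨(6 * K).toNNReal, Metric.ball x₀ (r / 3), Metric.ball_mem_nhds _ (by positivity), ?_⟩
    refine LipschitzOnWith.of_dist_le_mul fun x hx y hy => ?_
    rw [dist_eq_norm, dist_eq_norm]
    exact (norm_sub_le_of_quadratic h hy hx).trans
      (mul_le_mul_of_nonneg_right (Real.le_coe_toNNReal _) (norm_nonneg _))

theorem C11At.exists_quadratic {f : X → Y} {x₀ : X} (hf : C11At f x₀) :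
    ∃ K r : ℝ, 0 < r ∧ 0 ≤ K ∧
      (∀ x ∈ Metric.ball x₀ r, ‖fderiv ℝ f x - fderiv ℝ f x₀‖ ≤ K * ‖x - x₀‖) ∧
      ∀ x ∈ Metric.ball x₀ r, ∀ x' ∈ Metric.ball x₀ r,
        ‖f x' - f x - fderiv ℝ f x (x' - x)‖ ≤ K * ‖x' - x‖ ^ 2 := by
  obtain ⟨K, t, ht, hK⟩ := hf.2
  obtain ⟨r, hr, hrt⟩ := Metric.mem_nhds_iff.1 (inter_mem ht hf.1)
  refine ⟨K, r, hr, K.2, fun x hx => ?_, fun x hx x' hx' => ?_⟩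
  · rw [← dist_eq_norm, ← dist_eq_norm]
    exact hK.dist_le_mul _ (hrt hx).1 _ (mem_of_mem_nhds ht)
  -- The mean value inequality is applied on the part of the ball within `‖x' - x‖` of `x`, where
  -- the derivative varies by at most `K * ‖x' - x‖`; this makes the remainder quadratic.
  · have hc : Convex ℝ (Metric.ball x₀ r ∩ Metric.closedBall x ‖x' - x‖) :=
      (convex_ball _ _).inter (convex_closedBall _ _)
    have := hc.norm_image_sub_le_of_norm_hasFDerivWithin_le' (f := f) (f' := fderiv ℝ f)
      (φ := fderiv ℝ f x) (C := K * ‖x' - x‖) (x := x) (y := x')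
      (fun y hy => (hrt hy.1).2.hasFDerivAt.hasFDerivWithinAt) (fun y hy => ?_)
      ⟨hx, by simp⟩ ⟨hx', by simp [dist_eq_norm]⟩
    · exact this.trans (by nlinarith)
    · rw [← dist_eq_norm]
      refine (hK.dist_le_mul _ (hrt hy.1).1 _ (hrt hx).1).trans ?_
      have := hy.2
      rw [Metric.mem_closedBall] at this
      gcongr

/-! ### Inverse and implicit functions of class `C^{1,1}` -/

theorem C11At.symm {φ : OpenPartialHomeomorph X Y} [CompleteSpace X] {y : Y} (hy : y ∈ φ.target)
    (h : C11At φ (φ.symm y)) {e : X ≃L[ℝ] Y} (he : fderiv ℝ φ (φ.symm y) = e) :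
    C11At φ.symm y := by
  have hcont : ContinuousAt φ.symm y := φ.symm.continuousAt hy
  have hev : ∀ᶠ z in 𝓝 y, HasFDerivAt φ.symm (fderiv ℝ φ (φ.symm z)).inverse z := by
    have h1 := h.continuousAt_fderiv.eventually
      (ContinuousLinearEquiv.isOpen.mem_nhds (he ▸ mem_range_self e))
    filter_upwards [φ.open_target.mem_nhds hy, hcont.eventually h1, hcont.eventually h.1]
      with z hz ⟨e', he'⟩ hd
    rw [← he', ContinuousLinearMap.inverse_equiv]
    refine φ.hasFDerivAt_symm hz ?_
    rw [he']
    exact hd.hasFDerivAt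
  refine C11At.of_hasFDerivAt hev ?_
  have hcf : ContinuousAt (fun z => (fderiv ℝ φ (φ.symm z)).inverse) y := by
    have h2 : ContinuousAt (fun L : X →L[ℝ] Y => L.inverse) (fderiv ℝ φ (φ.symm y)) := by
      rw [he]; exact (contDiffAt_map_inverse (n := 1) e).continuousAt
    exact ContinuousAt.comp (g := fun L : X →L[ℝ] Y => L.inverse) h2
      (ContinuousAt.comp (g := fderiv ℝ φ) h.continuousAt_fderiv hcont)
  -- Bootstrap: continuity of the derivative of the inverse makes the inverse Lipschitz, and only
  -- then is that derivative, which is composed with the inverse itself, seen to be Lipschitz.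
  have hs : LipAt φ.symm y :=
    (hasStrictFDerivAt_of_hasFDerivAt_of_continuousAt hev hcf).exists_lipschitzOnWith
  have h3 : LipAt (fun L : X →L[ℝ] Y => L.inverse) (fderiv ℝ φ (φ.symm y)) := by
    rw [he]; exact (contDiffAt_map_inverse (n := 1) e).lipAt
  exact LipAt.comp (g := fun L : X →L[ℝ] Y => L.inverse) h3 (LipAt.comp (g := fderiv ℝ φ) h.2 hs)

theorem C11At.exists_openPartialHomeomorph [CompleteSpace X] {f : X → Y} {x : X}
    (hf : C11At f x) {e : X ≃L[ℝ] Y} (he : fderiv ℝ f x = e) :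
    ∃ φ : OpenPartialHomeomorph X Y, x ∈ φ.source ∧ (∀ z, φ z = f z) ∧
      ∀ y ∈ φ.target, C11At φ.symm y := by
  have hs : HasStrictFDerivAt f (e : X →L[ℝ] Y) x := he ▸ hf.hasStrictFDerivAt
  let φ₀ := hs.toOpenPartialHomeomorph f
  have hev : ∀ᶠ z in 𝓝 x, C11At f z ∧ fderiv ℝ f z ∈ range
      (ContinuousLinearEquiv.toContinuousLinearMap : (X ≃L[ℝ] Y) → (X →L[ℝ] Y)) :=
    hf.eventually.and (hf.continuousAt_fderiv.eventually
      (ContinuousLinearEquiv.isOpen.mem_nhds (he ▸ mem_range_self e)))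
  obtain ⟨O, hO, hOo, hxO⟩ := eventually_nhds_iff.1 hev
  refine ⟨φ₀.restrOpen O hOo, ⟨hs.mem_toOpenPartialHomeomorph_source, hxO⟩, fun z => rfl,
    fun y hy => ?_⟩
  have hy' := (φ₀.restrOpen O hOo).map_target hy
  obtain ⟨h1, e', h2⟩ := hO _ hy'.2
  exact C11At.symm hy h1 h2.symm

/-- The map `(y, b) ↦ (y, k (y, b))` has invertible derivative at `(x, a)`; its local inverse
restricted to the slice with second coordinate `0` is the graph of the implicit function. -/
theorem C11At.exists_implicit [CompleteSpace X] {k : X × ℝ → ℝ} {x : X} {a : ℝ}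
    (hk : C11At k (x, a)) (h0 : k (x, a) = 0) (hd : fderiv ℝ k (x, a) (0, 1) ≠ 0) :
    ∃ ψ : X → ℝ, C11At ψ x ∧ ψ x = a ∧ ∀ᶠ y in 𝓝 x, k (y, ψ y) = 0 := by
  set D := fderiv ℝ k (x, a) with hD
  set c := D (0, 1) with hc
  have hD' : ∀ v : X, ∀ b : ℝ, D (v, b) = D (v, 0) + c * b := by
    intro v b
    have : ((v, b) : X × ℝ) = (v, 0) + b • (0, 1) := by simp
    rw [this, map_add, map_smul, smul_eq_mul, mul_comm]
  let F : X × ℝ → X × ℝ := fun z => (z.1, k z)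
  have hF : C11At F (x, a) := C11At.fst.prodMk hk
  let A : X × ℝ →L[ℝ] X × ℝ := (ContinuousLinearMap.fst ℝ X ℝ).prod D
  let B : X × ℝ →L[ℝ] X × ℝ := (ContinuousLinearMap.fst ℝ X ℝ).prod
    (c⁻¹ • (ContinuousLinearMap.snd ℝ X ℝ -
      (D.comp (ContinuousLinearMap.inl ℝ X ℝ)).comp (ContinuousLinearMap.fst ℝ X ℝ)))
  let e : (X × ℝ) ≃L[ℝ] (X × ℝ) := ContinuousLinearEquiv.equivOfInverse A B
    (by rintro ⟨v, b⟩; simp [A, B, hD' v b]; field_simp)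
    (by rintro ⟨v, b⟩; simp [A, B]; rw [hD']; field_simp; ring)
  have he : fderiv ℝ F (x, a) = e := by
    have h1 : HasFDerivAt F A (x, a) := hasFDerivAt_fst.prodMk hk.hasFDerivAt
    rw [h1.fderiv]; rfl
  obtain ⟨φ, hxs, hφ, hsymm⟩ := hF.exists_openPartialHomeomorph he
  have hFx : φ (x, a) = (x, 0) := by rw [hφ]; simp [F, h0]
  have ht : (x, (0 : ℝ)) ∈ φ.target := hFx ▸ φ.map_source hxs
  have hinv : φ.symm (x, 0) = (x, a) := by rw [← hFx, φ.left_inv hxs]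
  have hc1 : C11At (fun y : X => (y, (0 : ℝ))) x := (C11At.id x).prodMk (C11At.const _ _)
  refine ⟨fun y => (φ.symm (y, 0)).2, ?_, by simp [hinv], ?_⟩
  · exact C11At.comp (g := fun z : X × ℝ => z.2) C11At.snd
      (C11At.comp (g := φ.symm) (hsymm _ ht) hc1)
  · filter_upwards [hc1.continuousAt.eventually (φ.open_target.mem_nhds ht)] with y hy
    have h1 := φ.right_inv hy
    rw [hφ] at h1
    have h2 : (φ.symm (y, 0)).1 = y := congrArg Prod.fst h1
    have h3 : k (φ.symm (y, 0)) = 0 := congrArg Prod.snd h1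
    have h4 : (y, (φ.symm (y, 0)).2) = φ.symm (y, 0) := Prod.ext h2.symm rfl
    rw [h4, h3]

end Calculus

end RG

namespace RG

/-! ### Linear and superposition operators on null sequences. -/

section SequenceSpace

open scoped ZeroAtInfty

variable {X Y : Type*} [NormedAddCommGroup X] [NormedSpace ℝ X]
  [NormedAddCommGroup Y] [NormedSpace ℝ Y]

/-! ### Null sequences in a normed space -/

/-- A null sequence as an element of `C₀(ℕ, X)`. -/
def c0mk (x : ℕ → X) (h : Tendsto x atTop (𝓝 0)) : C₀(ℕ, X) :=
  ⟨⟨x, continuous_of_discreteTopology⟩, by rw [cocompact_eq_atTop]; exact h⟩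

@[simp] theorem c0mk_apply (x : ℕ → X) (h : Tendsto x atTop (𝓝 0)) (n : ℕ) :
    c0mk x h n = x n := rfl

theorem c0_tendsto (x : C₀(ℕ, X)) : Tendsto x atTop (𝓝 0) := by
  have := x.zero_at_infty'
  rw [cocompact_eq_atTop] at this
  exact this

theorem c0_norm_le {x : C₀(ℕ, X)} {C : ℝ} (hC : 0 ≤ C) : ‖x‖ ≤ C ↔ ∀ n, ‖x n‖ ≤ C := by
  rw [← ZeroAtInftyContinuousMap.norm_toBCF_eq_norm, BoundedContinuousFunction.norm_le hC]
  rfl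

theorem c0_norm_apply_le (x : C₀(ℕ, X)) (n : ℕ) : ‖x n‖ ≤ ‖x‖ :=
  (c0_norm_le (norm_nonneg x)).1 le_rfl n

/-- The supremum of a nonzero null sequence is attained, so strict bounds on the terms survive. This
lets an orbit staying in an open ball be identified with a point of the open ball of the same radius
in sequence space. -/
theorem c0_norm_lt {x : C₀(ℕ, X)} {r : ℝ} (hr : 0 < r) (h : ∀ n, ‖x n‖ < r) : ‖x‖ < r := by
  have h1 : ∀ᶠ n in atTop, ‖x n‖ < r / 2 := by
    have := (c0_tendsto x).norm
    rw [norm_zero] at this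
    exact this.eventually (gt_mem_nhds (by positivity))
  obtain ⟨n₀, hn₀⟩ := eventually_atTop.1 h1
  obtain ⟨m, -, hm⟩ := Finset.exists_max_image (Finset.range (n₀ + 1)) (fun n => ‖x n‖) (by simp)
  have : ‖x‖ ≤ max ‖x m‖ (r / 2) := by
    refine (c0_norm_le (by positivity)).2 fun n => ?_
    rcases le_total n₀ n with hn | hn
    · exact (hn₀ n hn).le.trans (le_max_right _ _)
    · exact (hm n (by simp; omega)).trans (le_max_left _ _)
  exact this.trans_lt (max_lt (h m) (by linarith))

/-- Evaluation of null sequences. -/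
noncomputable def c0eval (n : ℕ) : C₀(ℕ, X) →L[ℝ] X :=
  LinearMap.mkContinuous ⟨⟨fun x => x n, fun _ _ => rfl⟩, fun _ _ => rfl⟩ 1
    fun x => by simpa using c0_norm_apply_le x n

@[simp] theorem c0eval_apply (n : ℕ) (x : C₀(ℕ, X)) : c0eval n x = x n := rfl

/-- The sequence with one nonzero term, at index `0`. -/
noncomputable def c0single : X →L[ℝ] C₀(ℕ, X) :=
  LinearMap.mkContinuous
    ⟨⟨fun a => c0mk (fun n => if n = 0 then a else 0)
        (tendsto_const_nhds.congr' (eventually_atTop.2 ⟨1, fun n hn => by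
          exact (if_neg (by omega)).symm⟩)),
      fun a b => by ext n; by_cases h : n = 0 <;> simp [h]⟩,
      fun c a => by ext n; by_cases h : n = 0 <;> simp [h]⟩ 1
    fun a => by
      rw [one_mul]
      refine (c0_norm_le (norm_nonneg _)).2 fun n => ?_
      by_cases h : n = 0 <;> simp [h]

theorem c0single_apply (a : X) (n : ℕ) : c0single a n = if n = 0 then a else 0 := rfl

theorem tendsto_clm_apply_zero {σ : ℕ → ℕ} (hσ : Tendsto σ atTop atTop) {L : ℕ → X →L[ℝ] Y}
    {C : ℝ} (hL : ∀ n, ‖L n‖ ≤ C) {x : ℕ → X} (hx : Tendsto x atTop (𝓝 0)) :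
    Tendsto (fun n => L n (x (σ n))) atTop (𝓝 0) := by
  have h1 : Tendsto (fun n => C * ‖x (σ n)‖) atTop (𝓝 0) := by
    simpa using ((hx.comp hσ).norm.const_mul C)
  refine squeeze_zero_norm (fun n => ?_) h1
  exact (L n).le_of_opNorm_le (hL n) _

/-- The operator `(x n) ↦ (L n (x (σ n)))` on null sequences. -/
noncomputable def c0Map (σ : ℕ → ℕ) (hσ : Tendsto σ atTop atTop) (L : ℕ → X →L[ℝ] Y) (C : ℝ)
    (hL : ∀ n, ‖L n‖ ≤ C) : C₀(ℕ, X) →L[ℝ] C₀(ℕ, Y) :=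
  LinearMap.mkContinuous
    ⟨⟨fun x => c0mk (fun n => L n (x (σ n))) (tendsto_clm_apply_zero hσ hL (c0_tendsto x)),
      fun a b => by ext n; simp⟩, fun c a => by ext n; simp⟩ C
    fun x => by
      have hC : 0 ≤ C := (norm_nonneg _).trans (hL 0)
      refine (c0_norm_le (by positivity)).2 fun n => ?_
      refine ((L n).le_of_opNorm_le (hL n) _).trans ?_
      exact mul_le_mul_of_nonneg_left (c0_norm_apply_le x _) hC

@[simp] theorem c0Map_apply (σ : ℕ → ℕ) (hσ : Tendsto σ atTop atTop) (L : ℕ → X →L[ℝ] Y) (C : ℝ)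
    (hL : ∀ n, ‖L n‖ ≤ C) (x : C₀(ℕ, X)) (n : ℕ) : c0Map σ hσ L C hL x n = L n (x (σ n)) := rfl

/-- The Nemytskii operator `(x n) ↦ (f (x n))` on null sequences. -/
noncomputable def nemytskii (f : X → Y) (hf : ContinuousAt f 0) (h0 : f 0 = 0) (x : C₀(ℕ, X)) :
    C₀(ℕ, Y) :=
  c0mk (fun n => f (x n)) (by
    have := hf.tendsto.comp (c0_tendsto x)
    rw [h0] at this
    exact this)

@[simp] theorem nemytskii_apply (f : X → Y) (hf : ContinuousAt f 0) (h0 : f 0 = 0) (x : C₀(ℕ, X))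
    (n : ℕ) : nemytskii f hf h0 x n = f (x n) := rfl

/-- A quadratic remainder estimate for `f` with a uniform constant passes to the supremum over the
terms. Hence the operator satisfies the same estimate, with derivative acting termwise. -/
theorem C11At.nemytskii {f : X → Y} (hf : C11At f 0) (h0 : f 0 = 0) :
    C11At (nemytskii f hf.continuousAt h0) 0 ∧
      ∀ x n, fderiv ℝ (RG.nemytskii f hf.continuousAt h0) 0 x n = fderiv ℝ f 0 (x n) := by
  obtain ⟨K, r, hr, hK, hL, hq⟩ := hf.exists_quadratic
  have hb : ∀ x : C₀(ℕ, X), x ∈ Metric.ball 0 r → ∀ n, x n ∈ Metric.ball (0 : X) r := by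
    intro x hx n
    rw [mem_ball_zero_iff] at hx ⊢
    exact (c0_norm_apply_le x n).trans_lt hx
  have hbd : ∀ x : C₀(ℕ, X), x ∈ Metric.ball 0 r → ∀ n,
      ‖fderiv ℝ f (x n)‖ ≤ ‖fderiv ℝ f 0‖ + K * r := by
    intro x hx n
    have h1 := hL _ (hb x hx n)
    have h2 := hb x hx n
    rw [mem_ball_zero_iff] at h2
    rw [sub_zero] at h1
    have h3 : ‖fderiv ℝ f (x n)‖ ≤ ‖fderiv ℝ f 0‖ + ‖fderiv ℝ f (x n) - fderiv ℝ f 0‖ :=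
      norm_le_norm_add_norm_sub' _ _
    nlinarith
  classical
  let D : C₀(ℕ, X) → C₀(ℕ, X) →L[ℝ] C₀(ℕ, Y) := fun x =>
    if hx : x ∈ Metric.ball 0 r then
      c0Map (fun n => n) tendsto_id (fun n => fderiv ℝ f (x n)) _ (hbd x hx) else 0
  have hD : ∀ x ∈ Metric.ball (0 : C₀(ℕ, X)) r, ∀ h n, D x h n = fderiv ℝ f (x n) (h n) := by
    intro x hx h n
    simp only [D, dif_pos hx]
    rfl
  have hquad : ∀ x ∈ Metric.ball (0 : C₀(ℕ, X)) r, ∀ x' ∈ Metric.ball (0 : C₀(ℕ, X)) r,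
      ‖RG.nemytskii f hf.continuousAt h0 x' - RG.nemytskii f hf.continuousAt h0 x
        - D x (x' - x)‖ ≤ K * ‖x' - x‖ ^ 2 := by
    intro x hx x' hx'
    refine (c0_norm_le (by positivity)).2 fun n => ?_
    have h1 := hq _ (hb x hx n) _ (hb x' hx' n)
    have h2 := c0_norm_apply_le (x' - x) n
    rw [ZeroAtInftyContinuousMap.sub_apply] at h2
    simp only [ZeroAtInftyContinuousMap.sub_apply, nemytskii_apply, hD x hx]
    refine h1.trans ?_
    gcongr
  refine ⟨C11At.of_quadratic hr hquad, fun x n => ?_⟩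
  have h0' : (0 : C₀(ℕ, X)) ∈ Metric.ball (0 : C₀(ℕ, X)) r := by simpa using hr
  have : HasFDerivAt (RG.nemytskii f hf.continuousAt h0) (D 0) 0 :=
    hasFDerivAt_of_quadratic
      (eventually_of_mem (Metric.ball_mem_nhds _ hr) fun z hz => hquad 0 h0' z hz)
  rw [this.fderiv, hD 0 h0']
  rfl

end SequenceSpace

/-! ### The local stable manifold of a hyperbolic fixed point, by Irwin's method. -/

section StableManifold

open scoped ZeroAtInfty

variable {A B : Type*} [NormedAddCommGroup A] [NormedSpace ℝ A] [CompleteSpace A]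
  [NormedAddCommGroup B] [NormedSpace ℝ B] [CompleteSpace B]

/-- The local stable set of a hyperbolic fixed point of a `C^{1,1}` map is the graph of a `C^{1,1}`
function over the stable subspace. -/
theorem exists_stable_graph {f : A × B → A × B} (hf : C11At f 0) (h0 : f 0 = 0)
    {α : A →L[ℝ] A} {β : B ≃L[ℝ] B} (hd : ∀ x, fderiv ℝ f 0 x = (α x.1, β x.2)) {c : ℝ}
    (hc : c < 1) (hα : ‖α‖ ≤ c) (hβ : ‖(β.symm : B →L[ℝ] B)‖ ≤ c) :
    ∃ r₀ : ℝ, 0 < r₀ ∧ ∃ h : A → B, h 0 = 0 ∧ HasFDerivAt h (0 : A →L[ℝ] B) 0 ∧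
      ∀ r, 0 < r → r ≤ r₀ → ∃ O : Set A, IsOpen O ∧ 0 ∈ O ∧ (∀ a ∈ O, C11At h a) ∧
        ∀ x : A × B, ((∀ n : ℕ, f^[n] x ∈ Metric.ball 0 r) ∧
          Tendsto (fun n : ℕ => f^[n] x) atTop (𝓝 0)) ↔ x.1 ∈ O ∧ x.2 = h x.1 := by
  have hc0 : 0 ≤ c := (norm_nonneg _).trans hα
  obtain ⟨hN, hDN⟩ := hf.nemytskii h0
  set N := nemytskii f hf.continuousAt h0 with hNdef
  let a₁ : A × B →L[ℝ] A × B :=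
    (ContinuousLinearMap.inl ℝ A B).comp (ContinuousLinearMap.fst ℝ A B)
  let b₁ : A × B →L[ℝ] A × B := (ContinuousLinearMap.inr ℝ A B).comp
    ((β.symm : B →L[ℝ] B).comp (ContinuousLinearMap.snd ℝ A B))
  have hs1 : Tendsto (fun n : ℕ => n + 1) atTop atTop := tendsto_add_atTop_nat 1
  have hs2 : Tendsto (fun n : ℕ => n - 1) atTop atTop := tendsto_sub_atTop_nat 1
  let S₀ : C₀(ℕ, A × B) →L[ℝ] C₀(ℕ, A × B) := c0Map (fun n => n) tendsto_id (fun _ => a₁) ‖a₁‖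
    fun _ => le_rfl
  let S₁ : C₀(ℕ, A × B) →L[ℝ] C₀(ℕ, A × B) := c0Map (fun n => n + 1) hs1 (fun _ => b₁) ‖b₁‖
    fun _ => le_rfl
  let S₂ : C₀(ℕ, A × B) →L[ℝ] C₀(ℕ, A × B) := c0Map (fun n => n) tendsto_id (fun _ => b₁) ‖b₁‖
    fun _ => le_rfl
  -- Term `0` has no predecessor, so it is set to `0`; the truncated value of `0 - 1` is never used.
  let S₃ : C₀(ℕ, A × B) →L[ℝ] C₀(ℕ, A × B) := c0Map (fun n => n - 1) hs2
    (fun n => if n = 0 then 0 else a₁) ‖a₁‖ fun n => by split_ifs <;> simp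
  -- `Θ` records the initial stable component and the defects of the orbit equation: the stable
  -- defect is read forward, the unstable one is multiplied by the inverse of `β`. In this way both
  -- off-diagonal terms of the linearization are contractions.
  let Θ : C₀(ℕ, A × B) → C₀(ℕ, A × B) := fun x => (S₀ - S₁) x + (S₂ - S₃) (N x)
  have hS₀ : ∀ x n, S₀ x n = ((x n).1, 0) := fun _ _ => rfl
  have hS₁ : ∀ x n, S₁ x n = (0, β.symm (x (n + 1)).2) := fun _ _ => rfl
  have hS₂ : ∀ x n, S₂ x n = (0, β.symm (x n).2) := fun _ _ => rfl
  have hS₃ : ∀ x, S₃ x 0 = 0 := fun _ => rfl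
  have hS₃' : ∀ x n, S₃ x (n + 1) = ((x n).1, 0) := fun _ _ => rfl
  have hΘn : ∀ x n, Θ x n = (S₀ x n - S₁ x n) + (S₂ (N x) n - S₃ (N x) n) := fun _ _ => rfl
  have hNn : ∀ x n, N x n = f (x n) := fun _ _ => rfl
  have hΘ0 : ∀ x, Θ x 0 = ((x 0).1, β.symm (f (x 0)).2 - β.symm (x 1).2) := by
    intro x
    rw [hΘn, hS₀, hS₁, hS₂, hS₃, hNn]
    refine Prod.ext ?_ ?_
    · simp
    · simp only [Prod.snd_add, Prod.snd_sub, Prod.snd_zero, zero_add]; abel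
  have hΘ1 : ∀ x n, Θ x (n + 1) = ((x (n + 1)).1 - (f (x n)).1,
      β.symm (f (x (n + 1))).2 - β.symm (x (n + 2)).2) := by
    intro x n
    rw [hΘn, hS₀, hS₁, hS₂, hS₃', hNn, hNn]
    refine Prod.ext ?_ ?_
    · simp only [Prod.fst_add, Prod.fst_sub]; abel
    · simp only [Prod.snd_add, Prod.snd_sub]; abel
  have hΘ : C11At Θ 0 := (C11At.clm _ _).add (hN.clm_comp _)
  have hN0 : N 0 = 0 := by ext n <;> simp [hNdef, h0]
  have hΘ00 : Θ 0 = 0 := by simp [Θ, hN0]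
  let D : C₀(ℕ, A × B) →L[ℝ] C₀(ℕ, A × B) := (S₀ - S₁) + (S₂ - S₃).comp (fderiv ℝ N 0)
  have hDΘ : HasFDerivAt Θ D 0 :=
    (S₀ - S₁).hasFDerivAt.add ((S₂ - S₃).hasFDerivAt.comp 0 hN.hasFDerivAt)
  have hDn : ∀ x n, D x n = (S₀ x n - S₁ x n) +
    (S₂ (fderiv ℝ N 0 x) n - S₃ (fderiv ℝ N 0 x) n) := fun _ _ => rfl
  have hD0 : ∀ x, D x 0 = ((x 0).1, (x 0).2 - β.symm (x 1).2) := by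
    intro x
    rw [hDn, hS₀, hS₁, hS₂, hS₃, hDN, hd, β.symm_apply_apply]
    refine Prod.ext ?_ ?_
    · simp
    · simp only [Prod.snd_add, Prod.snd_sub, Prod.snd_zero, zero_add]; abel
  have hD1 : ∀ x n, D x (n + 1) = ((x (n + 1)).1 - α (x n).1,
      (x (n + 1)).2 - β.symm (x (n + 2)).2) := by
    intro x n
    rw [hDn, hS₀, hS₁, hS₂, hS₃', hDN, hDN, hd, hd, β.symm_apply_apply]
    refine Prod.ext ?_ ?_
    · simp only [Prod.fst_add, Prod.fst_sub]; abel
    · simp only [Prod.snd_add, Prod.snd_sub]; abel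
  have hβ' : ∀ b, ‖β.symm b‖ ≤ c * ‖b‖ := fun b => (β.symm : B →L[ℝ] B).le_of_opNorm_le hβ b
  -- What remains of `D` off the identity is `α` acting from the previous term and the inverse of
  -- `β` acting from the next one, both of norm at most `c`. The Neumann series then inverts `D`.
  have hsmall : ‖1 - D‖ < 1 := by
    refine lt_of_le_of_lt (ContinuousLinearMap.opNorm_le_bound _ hc0 fun x => ?_) hc
    refine (c0_norm_le (by positivity)).2 fun n => ?_
    have hx : ∀ m, ‖(x m).1‖ ≤ ‖x‖ ∧ ‖(x m).2‖ ≤ ‖x‖ := fun m =>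
      ⟨(norm_fst_le _).trans (c0_norm_apply_le x m), (norm_snd_le _).trans (c0_norm_apply_le x m)⟩
    have h1 : (1 - D : C₀(ℕ, A × B) →L[ℝ] C₀(ℕ, A × B)) x n = x n - D x n := rfl
    rw [h1]
    have hb : ∀ m, ‖β.symm (x m).2‖ ≤ c * ‖x‖ := fun m =>
      (hβ' _).trans (mul_le_mul_of_nonneg_left (hx m).2 hc0)
    rcases n with _ | n
    · rw [hD0]
      refine max_le ?_ ?_
      · simp; positivity
      · simpa using hb 1
    · rw [hD1]
      refine max_le ?_ ?_
      · simpa using (α.le_of_opNorm_le hα _).trans (mul_le_mul_of_nonneg_left (hx n).1 hc0)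
      · simpa using hb (n + 2)
  let e : C₀(ℕ, A × B) ≃L[ℝ] C₀(ℕ, A × B) :=
    ContinuousLinearEquiv.ofUnit (Units.oneSub (1 - D) hsmall)
  have heD : ∀ x, e x = D x := fun x =>
    DFunLike.congr_fun (sub_sub_cancel (1 : C₀(ℕ, A × B) →L[ℝ] C₀(ℕ, A × B)) D) x
  have he : fderiv ℝ Θ 0 = e := by
    rw [hDΘ.fderiv]
    ext1 x
    exact (heD x).symm
  obtain ⟨φ, hφ0, hφ, hφs⟩ := hΘ.exists_openPartialHomeomorph he
  obtain ⟨r₀, hr₀, hball⟩ := Metric.isOpen_iff.1 φ.open_source 0 hφ0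
  let ι : A →L[ℝ] C₀(ℕ, A × B) := c0single.comp (ContinuousLinearMap.inl ℝ A B)
  let pr : C₀(ℕ, A × B) →L[ℝ] B := (ContinuousLinearMap.snd ℝ A B).comp (c0eval 0)
  have h0t : (0 : C₀(ℕ, A × B)) ∈ φ.target := by
    have := φ.map_source hφ0
    rwa [hφ, hΘ00] at this
  have hs0 : φ.symm 0 = 0 := by
    have := φ.left_inv hφ0
    rwa [hφ, hΘ00] at this
  -- Orbits are thus the preimages under `Θ` of the sequences `(a, 0), 0, 0, …`. In the unstable
  -- component the equation at index `n` is the orbit equation from `n` to `n + 1`, whereas the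
  -- stable one is shifted by one.
  have horb : ∀ x a, Θ x = ι a ↔ (x 0).1 = a ∧ ∀ n, x (n + 1) = f (x n) := by
    intro x a
    constructor
    · intro hx
      have hz : Θ x 0 = (a, 0) := by rw [hx]; rfl
      have hsu : ∀ n, Θ x (n + 1) = 0 := fun n => by rw [hx]; rfl
      rw [hΘ0] at hz
      simp only [Prod.mk.injEq, sub_eq_zero, EmbeddingLike.apply_eq_iff_eq] at hz
      have hsu' : ∀ n, (x (n + 1)).1 = (f (x n)).1 ∧ (f (x (n + 1))).2 = (x (n + 2)).2 := by
        intro n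
        have := hsu n
        rw [hΘ1] at this
        simpa [Prod.mk_eq_zero, sub_eq_zero] using this
      refine ⟨hz.1, fun n => Prod.ext (hsu' n).1 ?_⟩
      rcases n with _ | n
      · exact hz.2.symm
      · exact (hsu' n).2.symm
    · rintro ⟨h1, h2⟩
      ext1 n
      rcases n with _ | n
      · rw [hΘ0, h1, ← h2 0]; simp [ι, c0single_apply]
      · rw [hΘ1, ← h2 n, ← h2 (n + 1)]; simp [ι, c0single_apply]
  refine ⟨r₀, hr₀, fun a => pr (φ.symm (ι a)), by simp [hs0], ?_, fun r hr hrr => ?_⟩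
  · have h1 : HasFDerivAt φ.symm (e.symm : C₀(ℕ, A × B) →L[ℝ] C₀(ℕ, A × B)) (ι 0) := by
      rw [map_zero]
      refine φ.hasFDerivAt_symm h0t ?_
      rw [hs0, ← he]
      exact hΘ.hasFDerivAt.congr_of_eventuallyEq (Eventually.of_forall hφ)
    have h2 := pr.hasFDerivAt.comp (0 : A) (h1.comp 0 ι.hasFDerivAt)
    refine h2.congr_fderiv ?_
    ext1 a
    set x := e.symm (ι a) with hx
    have hDx : D x = ι a := by rw [← heD, hx, e.apply_symm_apply]
    -- For the linearized problem, going back one step contracts the unstable component. So `‖(x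
    -- 0).2‖` is bounded by every later term of a null sequence and vanishes: the graph is tangent
    -- to the stable space.
    have hb : ∀ n, (x n).2 = β.symm (x (n + 1)).2 := by
      intro n
      have h3 : (D x n).2 = 0 := by
        rw [hDx]; rcases n with _ | n <;> simp [ι, c0single_apply]
      rcases n with _ | n
      · rw [hD0] at h3; exact sub_eq_zero.1 h3
      · rw [hD1] at h3; exact sub_eq_zero.1 h3
    have hbn : ∀ n, ‖(x 0).2‖ ≤ ‖(x n).2‖ := by
      intro n
      induction n with
      | zero => exact le_rfl
      | succ n ih =>
        refine ih.trans ?_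
        rw [hb n]
        refine (hβ' _).trans ?_
        nlinarith [norm_nonneg (x (n + 1)).2]
    have hlim : Tendsto (fun n => ‖(x n).2‖) atTop (𝓝 0) := by
      have := ((continuous_snd.tendsto _).comp (c0_tendsto x)).norm
      simpa using this
    have : ‖(x 0).2‖ ≤ 0 := ge_of_tendsto' hlim hbn
    exact norm_le_zero_iff.1 this
  · have hcont : ContinuousOn φ.symm φ.target := φ.symm.continuousOn
    have hopen : IsOpen (φ.target ∩ φ.symm ⁻¹' Metric.ball 0 r) :=
      hcont.isOpen_inter_preimage φ.open_target Metric.isOpen_ball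
    refine ⟨ι ⁻¹' (φ.target ∩ φ.symm ⁻¹' Metric.ball 0 r), hopen.preimage ι.continuous, ?_, ?_, ?_⟩
    · simp [h0t, hs0, hr]
    · intro a ha
      exact C11At.clm_comp pr (C11At.comp (g := φ.symm) (hφs _ ha.1) (C11At.clm ι a))
    · intro x
      constructor
      · rintro ⟨h1, h2⟩
        let y : C₀(ℕ, A × B) := c0mk (fun n => f^[n] x) h2
        -- Strictness matters: with it the stable set relative to the ball of radius `r` is exactly
        -- the graph over `O`, for every `r ≤ r₀`.
        have hyr : ‖y‖ < r := c0_norm_lt hr fun n => mem_ball_zero_iff.1 (h1 n)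
        have hys : y ∈ φ.source := hball (mem_ball_zero_iff.2 (hyr.trans_le hrr))
        have hΘy : Θ y = ι x.1 :=
          (horb y x.1).2 ⟨rfl, fun n => Function.iterate_succ_apply' f n x⟩
        have hφy : φ y = ι x.1 := by rw [hφ, hΘy]
        have hsy : φ.symm (ι x.1) = y := by rw [← hφy, φ.left_inv hys]
        refine ⟨⟨hφy ▸ φ.map_source hys, ?_⟩, ?_⟩
        · rw [mem_preimage, hsy]; exact mem_ball_zero_iff.2 hyr
        · simp only [hsy]; rfl
      · rintro ⟨⟨h1, h2⟩, h3⟩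
        set y := φ.symm (ι x.1) with hy
        have hΘy : Θ y = ι x.1 := by rw [← hφ, φ.right_inv h1]
        obtain ⟨h4, h5⟩ := (horb y x.1).1 hΘy
        have hx0 : y 0 = x := Prod.ext h4 h3.symm
        have hyn : ∀ n, y n = f^[n] x := by
          intro n
          induction n with
          | zero => exact hx0
          | succ n ih => rw [h5, ih, Function.iterate_succ_apply']
        have hyr : ‖y‖ < r := mem_ball_zero_iff.1 h2
        refine ⟨fun n => ?_, ?_⟩
        · rw [← hyn, mem_ball_zero_iff]
          exact (c0_norm_apply_le y n).trans_lt hyr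
        · exact (c0_tendsto y).congr hyn

end StableManifold

end RG

namespace RG

section FlowRegularity

variable {Γ : Type*} [NormedAddCommGroup Γ] [NormedSpace ℝ Γ]

/-! ### Joint regularity of the flow -/

/-- First order expansions of a flow near a point `x`, for small times. -/
structure FlowExpansion (R : ℝ → Γ → Γ) (T : ℝ → Γ → Γ →L[ℝ] Γ) (g : Γ → Γ) (x : Γ)
    (r t₁ K M : ℝ) : Prop where
  r_pos : 0 < r
  r_le : r ≤ 1
  t_pos : 0 < t₁
  t_le : t₁ ≤ 1
  K_nonneg : 0 ≤ K
  M_nonneg : 0 ≤ M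
  bound : ∀ V ∈ Metric.ball x r, ‖g V‖ ≤ M
  time : ∀ V ∈ Metric.ball x r, ∀ t, |t| ≤ t₁ → ‖R t V - V - t • g V‖ ≤ K * |t| ^ 2
  space : ∀ s, 0 ≤ s → s ≤ t₁ → ∀ U ∈ Metric.ball x r, ∀ U' ∈ Metric.ball x r,
    ‖R s U' - R s U - T s U (U' - U)‖ ≤ K * ‖U' - U‖ ^ 2

namespace FlowExpansion

variable {R : ℝ → Γ → Γ} {T : ℝ → Γ → Γ →L[ℝ] Γ} {g : Γ → Γ} {x : Γ} {r t₁ K M : ℝ}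

theorem displacement (h : FlowExpansion R T g x r t₁ K M) {V : Γ} (hV : V ∈ Metric.ball x r)
    {t : ℝ} (ht : |t| ≤ t₁) : ‖R t V - V‖ ≤ (M + K) * |t| := by
  have h1 := h.time V hV t ht
  have h2 : ‖t • g V‖ ≤ |t| * M := by
    rw [norm_smul, Real.norm_eq_abs]
    exact mul_le_mul_of_nonneg_left (h.bound V hV) (abs_nonneg _)
  have h3 : ‖R t V - V‖ ≤ ‖R t V - V - t • g V‖ + ‖t • g V‖ := norm_le_norm_sub_add _ _
  have h4 : K * |t| ^ 2 ≤ K * |t| := by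
    have := ht.trans h.t_le
    have := h.K_nonneg
    gcongr
    nlinarith [abs_nonneg t]
  linarith

/-- A difference quotient of `R s - id` with a fixed step `η` approximates `T s U - 1` up to `K * η
≤ 1 / 4`. Once `η` is fixed, shrinking the time makes each displacement at most `η / 8`, so the
quotient is at most `1 / 4` as well. -/
theorem norm_tangent_sub_one_le (h : FlowExpansion R T g x r t₁ K M) :
    ∃ t₀, 0 < t₀ ∧ t₀ ≤ t₁ ∧ (M + K) * t₀ ≤ r / 6 ∧
      ∀ s, 0 ≤ s → s ≤ t₀ → ∀ U ∈ Metric.ball x (r / 2), ‖T s U - 1‖ ≤ 1 / 2 := by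
  have hK := h.K_nonneg
  have hM := h.M_nonneg
  have hr := h.r_pos
  set η := min (r / 2) (1 / (4 * (K + 1))) with hη
  have hη0 : 0 < η := lt_min (by positivity) (by positivity)
  have hη1 : η ≤ r / 2 := min_le_left _ _
  have hη2 : K * η ≤ 1 / 4 := by
    have h1 : η ≤ 1 / (4 * (K + 1)) := min_le_right _ _
    have h2 : K * η ≤ K * (1 / (4 * (K + 1))) := by gcongr
    refine h2.trans ?_
    rw [mul_one_div, div_le_div_iff₀ (by positivity) (by positivity)]
    linarith
  set t₀ := min t₁ (min (r / (6 * (M + K + 1))) (η / (8 * (M + K + 1)))) with ht₀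
  have ht₀p : 0 < t₀ := lt_min h.t_pos (lt_min (by positivity) (by positivity))
  have ha : (M + K) * t₀ ≤ r / 6 := by
    have h1 : t₀ ≤ r / (6 * (M + K + 1)) := (min_le_right _ _).trans (min_le_left _ _)
    have h2 : (M + K) * t₀ ≤ (M + K + 1) * (r / (6 * (M + K + 1))) :=
      mul_le_mul (by linarith) h1 ht₀p.le (by positivity)
    refine h2.trans (le_of_eq ?_)
    field_simp
  have hb : (M + K) * t₀ ≤ η / 8 := by
    have h1 : t₀ ≤ η / (8 * (M + K + 1)) := (min_le_right _ _).trans (min_le_right _ _)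
    have h2 : (M + K) * t₀ ≤ (M + K + 1) * (η / (8 * (M + K + 1))) :=
      mul_le_mul (by linarith) h1 ht₀p.le (by positivity)
    refine h2.trans (le_of_eq ?_)
    field_simp
  refine ⟨t₀, ht₀p, min_le_left _ _, ha, fun s hs0 hs U hU => ?_⟩
  refine ContinuousLinearMap.opNorm_le_of_unit_norm (by norm_num) fun v hv => ?_
  have hst : |s| ≤ t₁ := by rw [abs_of_nonneg hs0]; exact hs.trans (min_le_left _ _)
  have hUr : U ∈ Metric.ball x r := Metric.ball_subset_ball (by linarith) hU
  have hU' : U + η • v ∈ Metric.ball x r := by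
    rw [Metric.mem_ball, dist_eq_norm] at hU ⊢
    have h1 : U + η • v - x = (U - x) + η • v := by abel
    have h2 : ‖η • v‖ = η := by rw [norm_smul, hv, mul_one, Real.norm_of_nonneg hη0.le]
    rw [h1]
    linarith [norm_add_le (U - x) (η • v)]
  have h1 := h.space s hs0 (hs.trans (min_le_left _ _)) U hUr _ hU'
  have h2 := h.displacement hUr hst
  have h3 := h.displacement hU' hst
  rw [add_sub_cancel_left] at h1
  have h4 : ‖η • v‖ = η := by rw [norm_smul, hv, mul_one, Real.norm_of_nonneg hη0.le]
  rw [h4] at h1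
  rw [abs_of_nonneg hs0] at h2 h3
  have hMs : (M + K) * s ≤ η / 8 := (by gcongr : (M + K) * s ≤ (M + K) * t₀).trans hb
  have e : η • ((T s U - 1) v) = (R s (U + η • v) - (U + η • v)) - (R s U - U)
      - (R s (U + η • v) - R s U - T s U (η • v)) := by
    rw [sub_apply, smul_sub, map_smul]
    simp only [one_apply_eq_self]
    abel
  have h5 : ‖η • ((T s U - 1) v)‖ ≤ η * (1 / 2) := by
    rw [e]
    refine (norm_sub_le _ _).trans ?_
    have := norm_sub_le (R s (U + η • v) - (U + η • v)) (R s U - U)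
    nlinarith
  rw [norm_smul, Real.norm_of_nonneg hη0.le] at h5
  exact le_of_mul_le_mul_left h5 hη0

theorem norm_tangent_sub_le (h : FlowExpansion R T g x r t₁ K M) {s : ℝ} (hs0 : 0 ≤ s)
    (hs : s ≤ t₁) {U U' : Γ} (hU : U ∈ Metric.ball x (r / 3)) (hU' : U' ∈ Metric.ball x (r / 3)) :
    ‖T s U' - T s U‖ ≤ 6 * K * ‖U' - U‖ :=
  norm_sub_le_of_quadratic (f := R s) (L := T s) (h.space s hs0 hs) hU hU'

theorem norm_flow_sub_le (h : FlowExpansion R T g x r t₁ K M) {s : ℝ} (hs0 : 0 ≤ s)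
    (hs : s ≤ t₁) {U U' : Γ} (hU : U ∈ Metric.ball x (r / 3)) (hU' : U' ∈ Metric.ball x (r / 3))
    (hT : ‖T s U - 1‖ ≤ 1 / 2) : ‖R s U' - R s U‖ ≤ (3 / 2 + K) * ‖U' - U‖ := by
  have hr := h.r_pos
  have hr1 := h.r_le
  have h1 := h.space s hs0 hs U (Metric.ball_subset_ball (by linarith) hU) U'
    (Metric.ball_subset_ball (by linarith) hU')
  have hd : ‖U' - U‖ ≤ 1 := by
    rw [Metric.mem_ball, dist_eq_norm] at hU hU'
    have e : U' - U = (U' - x) - (U - x) := by abel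
    rw [e]
    linarith [norm_sub_le (U' - x) (U - x)]
  have h2 : ‖T s U (U' - U)‖ ≤ 3 / 2 * ‖U' - U‖ := by
    have e : T s U (U' - U) = (T s U - 1) (U' - U) + (U' - U) := by
      simp [sub_apply]
    rw [e]
    have := (T s U - 1).le_of_opNorm_le hT (U' - U)
    linarith [norm_add_le ((T s U - 1) (U' - U)) (U' - U)]
  have h3 : ‖R s U' - R s U‖ ≤ ‖R s U' - R s U - T s U (U' - U)‖ + ‖T s U (U' - U)‖ :=
    norm_le_norm_sub_add _ _
  have h4 : K * ‖U' - U‖ ^ 2 ≤ K * ‖U' - U‖ := by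
    have := h.K_nonneg
    gcongr
    nlinarith [norm_nonneg (U' - U)]
  linarith

/-- Averaging the tangent maps over a short time recovers the generator from the flow. -/
theorem norm_average_sub_le (hR : IsFlow R) (h : FlowExpansion R T g x r t₁ K M) {τ : ℝ}
    (hτ0 : 0 < τ) (hτ : τ ≤ t₁) (hMτ : (M + K) * τ ≤ r / 6)
    (hT : ∀ s, 0 ≤ s → s ≤ τ → ∀ U ∈ Metric.ball x (r / 2), ‖T s U - 1‖ ≤ 1 / 2)
    {V : Γ} (hV : V ∈ Metric.ball x (r / 3)) (n : ℕ) :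
    ‖R τ V - V - (τ / (n + 1)) • (∑ k ∈ Finset.range (n + 1), T (k * (τ / (n + 1))) V) (g V)‖ ≤
      (K * (M + K) ^ 2 + 3 / 2 * K) * τ ^ 2 * (1 / (n + 1)) := by
  have hr := h.r_pos
  have hK := h.K_nonneg
  have hM := h.M_nonneg
  set t := τ / (n + 1) with ht
  have hn : (0 : ℝ) < n + 1 := by positivity
  have ht0 : 0 < t := by positivity
  have htn : (n + 1) * t = τ := by rw [ht]; field_simp
  have htτ : t ≤ τ := by nlinarith [(Nat.cast_nonneg n : (0 : ℝ) ≤ n)]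
  have hVr : V ∈ Metric.ball x r := Metric.ball_subset_ball (by linarith) hV
  have hV2 : V ∈ Metric.ball x (r / 2) := Metric.ball_subset_ball (by linarith) hV
  have htt : |t| ≤ t₁ := by rw [abs_of_pos ht0]; linarith
  have hdisp := h.displacement hVr htt
  rw [abs_of_pos ht0] at hdisp
  have hRt : R t V ∈ Metric.ball x r := by
    rw [Metric.mem_ball, dist_eq_norm] at hV ⊢
    have h1 : R t V - x = (R t V - V) + (V - x) := by abel
    have h2 : (M + K) * t ≤ (M + K) * τ := by gcongr
    rw [h1]
    linarith [norm_add_le (R t V - V) (V - x)]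
  have hstep : ∀ k ∈ Finset.range (n + 1),
      ‖R ((k + 1 : ℕ) * t) V - R (k * t) V - t • T (k * t) V (g V)‖ ≤
        (K * (M + K) ^ 2 + 3 / 2 * K) * t ^ 2 := by
    intro k hk
    have hk' : (k : ℝ) ≤ n := by
      exact_mod_cast Nat.lt_succ_iff.1 (Finset.mem_range.1 hk)
    have hkt0 : 0 ≤ k * t := by positivity
    have hktτ : k * t ≤ τ := by nlinarith
    -- The group law makes an increment in time an increment in the initial point `V ↦ R t V`. It is
    -- therefore governed by the tangent map at `V` itself, with an error of order `t ^ 2`; the `n +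
    -- 1` errors add up to order `1 / (n + 1)`.
    have e1 : R ((k + 1 : ℕ) * t) V = R (k * t) (R t V) := by
      rw [← hR.add]; congr 1; push_cast; ring
    have h1 := h.space _ hkt0 (hktτ.trans hτ) V hVr _ hRt
    have h2 := h.time V hVr t htt
    rw [abs_of_pos ht0] at h2
    have h3 : ‖T (k * t) V (R t V - V - t • g V)‖ ≤ 3 / 2 * (K * t ^ 2) := by
      set w := R t V - V - t • g V
      have e : T (k * t) V w = (T (k * t) V - 1) w + w := by simp [sub_apply]
      rw [e]
      have := (T (k * t) V - 1).le_of_opNorm_le (hT _ hkt0 hktτ V hV2) w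
      linarith [norm_add_le ((T (k * t) V - 1) w) w]
    have e2 : R ((k + 1 : ℕ) * t) V - R (k * t) V - t • T (k * t) V (g V) =
        (R (k * t) (R t V) - R (k * t) V - T (k * t) V (R t V - V))
          + T (k * t) V (R t V - V - t • g V) := by
      rw [e1]; simp only [map_sub, map_smul]; abel
    have h4 : ‖R t V - V‖ ^ 2 ≤ ((M + K) * t) ^ 2 := by gcongr
    have h5 : K * ‖R t V - V‖ ^ 2 ≤ K * ((M + K) * t) ^ 2 := by gcongr
    rw [e2]
    refine (norm_add_le _ _).trans ?_
    nlinarith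
  have hsum : R τ V - V - t • (∑ k ∈ Finset.range (n + 1), T (k * t) V) (g V) =
      ∑ k ∈ Finset.range (n + 1),
        (R ((k + 1 : ℕ) * t) V - R (k * t) V - t • T (k * t) V (g V)) := by
    rw [Finset.sum_sub_distrib, Finset.sum_range_sub (fun k : ℕ => R (k * t) V),
      ← Finset.smul_sum, sum_apply]
    push_cast
    rw [htn, zero_mul, hR.zero]
  rw [hsum]
  refine (norm_sum_le_of_le _ hstep).trans (le_of_eq ?_)
  rw [Finset.sum_const, Finset.card_range, nsmul_eq_mul, ht]
  push_cast
  field_simp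

/-- The Riemann sums express `R τ V - V` as `τ` times an averaged tangent map applied to `g V`, with
an error that vanishes as `n` grows. Subtract the relations at `V` and `V'`: the flow and the
tangent maps are Lipschitz in `V`, and the average is within `1 / 2` of the identity, so the
difference of the generators is controlled. -/
theorem exists_generator_lipschitz (hR : IsFlow R) (h : FlowExpansion R T g x r t₁ K M) {τ : ℝ}
    (hτ0 : 0 < τ) (hτ : τ ≤ t₁) (hMτ : (M + K) * τ ≤ r / 6)
    (hT : ∀ s, 0 ≤ s → s ≤ τ → ∀ U ∈ Metric.ball x (r / 2), ‖T s U - 1‖ ≤ 1 / 2) :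
    ∃ C, 0 ≤ C ∧ ∀ V ∈ Metric.ball x (r / 3), ∀ V' ∈ Metric.ball x (r / 3),
      ‖g V' - g V‖ ≤ C * ‖V' - V‖ := by
  have hr := h.r_pos
  have hK := h.K_nonneg
  have hM := h.M_nonneg
  set C₁ := (K * (M + K) ^ 2 + 3 / 2 * K) * τ ^ 2 with hC₁
  set C₂ := (3 / 2 + K) + 1 + τ * (6 * K * M) with hC₂
  have hC₂0 : 0 ≤ C₂ := by positivity
  refine ⟨2 * C₂ / τ, by positivity, fun V hV V' hV' => ?_⟩
  have hV2 : V ∈ Metric.ball x (r / 2) := Metric.ball_subset_ball (by linarith) hV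
  have hV'2 : V' ∈ Metric.ball x (r / 2) := Metric.ball_subset_ball (by linarith) hV'
  have key : ∀ n : ℕ, τ / 2 * ‖g V' - g V‖ ≤ C₂ * ‖V' - V‖ + 2 * C₁ * (1 / ((n : ℝ) + 1)) := by
    intro n
    set t := τ / ((n : ℝ) + 1) with ht
    have hn : (0 : ℝ) < n + 1 := by positivity
    have ht0 : 0 < t := by positivity
    have htn : (n + 1) * t = τ := by rw [ht]; field_simp
    have h1 := h.norm_average_sub_le hR hτ0 hτ hMτ hT hV n
    have h2 := h.norm_average_sub_le hR hτ0 hτ hMτ hT hV' n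
    rw [← ht, ← hC₁] at h1 h2
    set B := ∑ k ∈ Finset.range (n + 1), T (k * t) V with hB
    set B' := ∑ k ∈ Finset.range (n + 1), T (k * t) V' with hB'
    have hkt : ∀ k ∈ Finset.range (n + 1), 0 ≤ (k : ℝ) * t ∧ (k : ℝ) * t ≤ τ := by
      intro k hk
      have hk' : (k : ℝ) ≤ n := by
        exact_mod_cast Nat.lt_succ_iff.1 (Finset.mem_range.1 hk)
      exact ⟨by positivity, by nlinarith⟩
    have h3 : ‖B' - B‖ ≤ (n + 1) * (6 * K * ‖V' - V‖) := by
      rw [hB, hB', ← Finset.sum_sub_distrib]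
      refine (norm_sum_le_of_le _ fun k hk =>
        h.norm_tangent_sub_le (hkt k hk).1 ((hkt k hk).2.trans hτ) hV hV').trans (le_of_eq ?_)
      rw [Finset.sum_const, Finset.card_range, nsmul_eq_mul]
      push_cast; ring
    have h4 : ‖B' - ((n : ℝ) + 1) • (1 : Γ →L[ℝ] Γ)‖ ≤ (n + 1) * (1 / 2) := by
      have e : B' - ((n : ℝ) + 1) • (1 : Γ →L[ℝ] Γ) =
          ∑ k ∈ Finset.range (n + 1), (T (k * t) V' - 1) := by
        rw [Finset.sum_sub_distrib, Finset.sum_const, Finset.card_range, ← Nat.cast_smul_eq_nsmul ℝ]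
        push_cast; rfl
      rw [e]
      refine (norm_sum_le_of_le _ fun k hk =>
        hT _ (hkt k hk).1 (hkt k hk).2 _ hV'2).trans (le_of_eq ?_)
      rw [Finset.sum_const, Finset.card_range, nsmul_eq_mul]
      push_cast; ring
    set w := g V' - g V with hw
    -- Only a lower bound for the averaged tangent map is needed, so it is never inverted and
    -- completeness plays no part.
    have h5 : (n + 1) * (1 / 2) * ‖w‖ ≤ ‖B' w‖ := by
      have e : ((n : ℝ) + 1) • w = B' w - (B' - ((n : ℝ) + 1) • (1 : Γ →L[ℝ] Γ)) w := by
        simp [sub_apply]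
      have h6 : ‖((n : ℝ) + 1) • w‖ = (n + 1) * ‖w‖ := by
        rw [norm_smul, Real.norm_of_nonneg hn.le]
      have h7 := (B' - ((n : ℝ) + 1) • (1 : Γ →L[ℝ] Γ)).le_of_opNorm_le h4 w
      rw [e] at h6
      linarith [norm_sub_le (B' w) ((B' - ((n : ℝ) + 1) • (1 : Γ →L[ℝ] Γ)) w)]
    have h8 : ‖R τ V' - R τ V‖ ≤ (3 / 2 + K) * ‖V' - V‖ :=
      h.norm_flow_sub_le hτ0.le hτ hV hV' (hT τ hτ0.le le_rfl V hV2)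
    have h9 : ‖(B' - B) (g V)‖ ≤ (n + 1) * (6 * K * ‖V' - V‖) * M :=
      ((B' - B).le_of_opNorm_le h3 _).trans (mul_le_mul_of_nonneg_left
        (h.bound V (Metric.ball_subset_ball (by linarith) hV)) (by positivity))
    have e : t • B' w = -(R τ V' - V' - t • B' (g V')) + (R τ V - V - t • B (g V))
        + (R τ V' - R τ V) - (V' - V) - t • (B' - B) (g V) := by
      rw [hw, map_sub, smul_sub, sub_apply, smul_sub]; abel
    have h10 : ‖t • B' w‖ ≤ 2 * (C₁ * (1 / ((n : ℝ) + 1))) + (3 / 2 + K) * ‖V' - V‖ + ‖V' - V‖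
        + t * ((n + 1) * (6 * K * ‖V' - V‖) * M) := by
      rw [e]
      have i1 := norm_sub_le (-(R τ V' - V' - t • B' (g V')) + (R τ V - V - t • B (g V))
        + (R τ V' - R τ V) - (V' - V)) (t • (B' - B) (g V))
      have i2 := norm_sub_le (-(R τ V' - V' - t • B' (g V')) + (R τ V - V - t • B (g V))
        + (R τ V' - R τ V)) (V' - V)
      have i3 := norm_add_le (-(R τ V' - V' - t • B' (g V')) + (R τ V - V - t • B (g V)))
        (R τ V' - R τ V)
      have i4 := norm_add_le (-(R τ V' - V' - t • B' (g V'))) (R τ V - V - t • B (g V))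
      rw [norm_neg] at i4
      have i5 : ‖t • (B' - B) (g V)‖ ≤ t * ((n + 1) * (6 * K * ‖V' - V‖) * M) := by
        rw [norm_smul, Real.norm_of_nonneg ht0.le]
        exact mul_le_mul_of_nonneg_left h9 ht0.le
      linarith
    rw [norm_smul, Real.norm_of_nonneg ht0.le] at h10
    have h11 : τ / 2 * ‖w‖ ≤ t * ‖B' w‖ := by
      have : τ / 2 * ‖w‖ = t * ((n + 1) * (1 / 2) * ‖w‖) := by rw [← htn]; ring
      rw [this]
      exact mul_le_mul_of_nonneg_left h5 ht0.le
    have h12 : t * ((n + 1) * (6 * K * ‖V' - V‖) * M) = τ * (6 * K * M) * ‖V' - V‖ := by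
      rw [← htn]; ring
    rw [h12] at h10
    rw [hC₂]
    linarith
  have hlim : Tendsto (fun n : ℕ => C₂ * ‖V' - V‖ + 2 * C₁ * (1 / ((n : ℝ) + 1))) atTop
      (𝓝 (C₂ * ‖V' - V‖ + 2 * C₁ * 0)) :=
    (tendsto_one_div_add_atTop_nhds_zero_nat.const_mul _).const_add _
  have := ge_of_tendsto' hlim key
  rw [mul_zero, add_zero] at this
  rw [div_mul_eq_mul_div, le_div_iff₀ hτ0]
  linarith

/-- Move first in `V`, then in `s`. The mixed term is `s' - s` times a difference of generators at
flowed points; the Lipschitz bound on the generator makes it quadratic in the total increment. -/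
theorem c11At (hR : IsFlow R) (h : FlowExpansion R T g x r t₁ K M) :
    ∃ t₀, 0 < t₀ ∧ t₀ ≤ t₁ ∧ ∀ᶠ y in 𝓝 x, ∀ s ∈ Ioo 0 t₀,
      C11At (fun z : ℝ × Γ => R z.1 z.2) (s, y) ∧ ‖T s y - 1‖ ≤ 1 / 2 := by
  obtain ⟨t₀, ht₀, ht₀1, hMt, hT⟩ := h.norm_tangent_sub_one_le
  obtain ⟨C, hC, hg⟩ := h.exists_generator_lipschitz hR ht₀ ht₀1 hMt hT
  have hr := h.r_pos
  have hK := h.K_nonneg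
  have hM := h.M_nonneg
  refine ⟨t₀ / 2, by positivity, by linarith, ?_⟩
  filter_upwards [Metric.ball_mem_nhds x (by positivity : 0 < r / 6)] with y hy s₀ hs₀
  refine ⟨?_, hT s₀ hs₀.1.le (by linarith [hs₀.2]) y (Metric.ball_subset_ball (by linarith) hy)⟩
  obtain ⟨ρ, hρ, hball⟩ := Metric.isOpen_iff.1 (isOpen_Ioo.prod Metric.isOpen_ball) (s₀, y)
    (⟨hs₀, hy⟩ : (s₀, y) ∈ Ioo 0 (t₀ / 2) ×ˢ Metric.ball x (r / 6))
  let L : ℝ × Γ → ℝ × Γ →L[ℝ] Γ := fun z =>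
    (ContinuousLinearMap.fst ℝ ℝ Γ).smulRight (g (R z.1 z.2)) +
      (T z.1 z.2).comp (ContinuousLinearMap.snd ℝ ℝ Γ)
  refine C11At.of_quadratic (L := L) (K := 2 * K + C * (3 / 2 + K)) hρ ?_
  rintro ⟨s, V⟩ hz ⟨s', V'⟩ hz'
  obtain ⟨hs, hV⟩ := hball hz
  obtain ⟨hs', hV'⟩ := hball hz'
  simp only at hs hV hs' hV'
  have hV3 : V ∈ Metric.ball x (r / 3) := Metric.ball_subset_ball (by linarith) hV
  have hV'3 : V' ∈ Metric.ball x (r / 3) := Metric.ball_subset_ball (by linarith) hV'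
  have hs1 : |s| ≤ t₁ := by rw [abs_of_pos hs.1]; linarith [hs.2]
  have hflow : ∀ W ∈ Metric.ball x (r / 6), R s W ∈ Metric.ball x (r / 3) := by
    intro W hW
    have h1 := h.displacement (Metric.ball_subset_ball (by linarith) hW) hs1
    rw [abs_of_pos hs.1] at h1
    have h2 : (M + K) * s ≤ (M + K) * t₀ := by
      gcongr; linarith [hs.2]
    rw [Metric.mem_ball, dist_eq_norm] at hW ⊢
    have e : R s W - x = (R s W - W) + (W - x) := by abel
    rw [e]
    linarith [norm_add_le (R s W - W) (W - x)]
  have hRV := hflow V hV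
  have hRV' := hflow V' hV'
  have e1 : R s' V' = R (s' - s) (R s V') := by rw [← hR.add]; congr 1; ring
  have hss : |s' - s| ≤ t₁ := by
    rw [abs_le]; constructor <;> linarith [hs.1, hs.2, hs'.1, hs'.2]
  have h1 := h.time _ (Metric.ball_subset_ball (by linarith) hRV') (s' - s) hss
  have h2 := h.space s hs.1.le (by linarith [hs.2]) V
    (Metric.ball_subset_ball (by linarith) hV3) V' (Metric.ball_subset_ball (by linarith) hV'3)
  have h3 := hg _ hRV _ hRV'
  have h4 := h.norm_flow_sub_le hs.1.le (by linarith [hs.2]) hV3 hV'3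
    (hT s hs.1.le (by linarith [hs.2]) V (Metric.ball_subset_ball (by linarith) hV3))
  have e2 : R s' V' - R s V - L (s, V) ((s', V') - (s, V)) =
      (R (s' - s) (R s V') - R s V' - (s' - s) • g (R s V')) +
      (s' - s) • (g (R s V') - g (R s V)) + (R s V' - R s V - T s V (V' - V)) := by
    rw [e1, smul_sub]
    simp only [L, Prod.mk_sub_mk, add_apply, ContinuousLinearMap.smulRight_apply,
      ContinuousLinearMap.comp_apply, ContinuousLinearMap.coe_fst', ContinuousLinearMap.coe_snd']
    abel
  have h5 : ‖(s' - s) • (g (R s V') - g (R s V))‖ ≤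
      |s' - s| * (C * ((3 / 2 + K) * ‖V' - V‖)) := by
    rw [norm_smul, Real.norm_eq_abs]
    gcongr
    exact h3.trans (by gcongr)
  simp only
  rw [e2]
  set N := ‖((s', V') : ℝ × Γ) - (s, V)‖ with hN
  have hN1 : |s' - s| ≤ N := by
    rw [hN, ← Real.norm_eq_abs]; exact norm_fst_le (((s', V') : ℝ × Γ) - (s, V))
  have hN2 : ‖V' - V‖ ≤ N := norm_snd_le (((s', V') : ℝ × Γ) - (s, V))
  have hN0 : 0 ≤ N := norm_nonneg _
  have i1 : K * |s' - s| ^ 2 ≤ K * N ^ 2 := by gcongr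
  have i2 : K * ‖V' - V‖ ^ 2 ≤ K * N ^ 2 := by gcongr
  have i3 : |s' - s| * (C * ((3 / 2 + K) * ‖V' - V‖)) ≤ N * (C * ((3 / 2 + K) * N)) := by gcongr
  refine (norm_add₃_le).trans ?_
  nlinarith

end FlowExpansion

theorem IsFlow.neg_apply {R : ℝ → Γ → Γ} (hR : IsFlow R) (t : ℝ) (U : Γ) : R (-t) (R t U) = U := by
  rw [← hR.add, neg_add_cancel, hR.zero]

theorem IsFlow.apply_neg {R : ℝ → Γ → Γ} (hR : IsFlow R) (t : ℝ) (U : Γ) : R t (R (-t) U) = U := by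
  rw [← hR.add, add_neg_cancel, hR.zero]

theorem IsFlow.mem_cycle {R : ℝ → Γ → Γ} (hR : IsFlow R) {U₀ x : Γ} (hx : x ∈ cycle R U₀) (t : ℝ) :
    R t x ∈ cycle R U₀ := by
  obtain ⟨s, rfl⟩ := hx
  exact ⟨t + s, hR.add _ _ _⟩

theorem IsLimitCycle.periodic_orbit {R : ℝ → Γ → Γ} (hR : IsFlow R) {U₀ : Γ} {Δ : ℝ}
    (hlc : IsLimitCycle R U₀ Δ) : Function.Periodic (fun t => R t U₀) Δ := fun t => by
  simp only [hR.add, hlc.periodic]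

theorem isCompact_cycle {R : ℝ → Γ → Γ} (hR : IsFlow R) {U₀ : Γ} {Δ : ℝ}
    (hlc : IsLimitCycle R U₀ Δ) (hc : Continuous fun t => R t U₀) : IsCompact (cycle R U₀) := by
  have := (hlc.periodic_orbit hR).image_Icc hlc.pos 0
  rw [cycle, ← this]
  exact isCompact_Icc.image hc

/-- The spatial expansion is granted only while the orbit segment stays in the tube. The time
expansion at `s = 0` tests the tube condition at the initial point alone; together with a bound on
the generator it shows that short segments starting near `x` do not leave. -/
theorem AssumptionL2.exists_flowExpansion {R : ℝ → Γ → Γ} (hR : IsFlow R) {U₀ : Γ}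
    (hL2 : AssumptionL2 R U₀) {x : Γ} (hx : x ∈ cycle R U₀) :
    ∃ r t₁ K M, FlowExpansion R (flowTangent R) (generator R) x r t₁ K M := by
  obtain ⟨δ', hδ', h⟩ := hL2
  obtain ⟨δ, hδ, K₀, h⟩ := h 1 one_pos
  set K := max K₀ 0 with hK
  have hK0 : 0 ≤ K := le_max_right _ _
  have htube : ∀ V ∈ Metric.ball x δ', Metric.infDist V (cycle R U₀) < δ' := fun V hV =>
    (Metric.infDist_le_dist_of_mem hx).trans_lt hV
  have h1 : ∀ V ∈ Metric.ball x δ', ∀ t, |t| < δ →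
      ‖R t V - V - t • generator R V‖ ≤ K * |t| ^ 2 := by
    intro V hV t ht
    have := (h 0 t V V le_rfl zero_le_one (by simpa using ht) (by simpa using hδ) (by
      intro s'' hs''
      rw [Icc_self, mem_singleton_iff] at hs''
      rw [hs'', hR.zero]
      exact htube V hV)).1
    rw [hR.zero, sub_zero] at this
    exact this.trans (by gcongr; exact le_max_left _ _)
  have h2 : ∀ s, 0 ≤ s → s ≤ 1 → ∀ U U', ‖U' - U‖ < δ →
      (∀ s'' ∈ Icc 0 s, Metric.infDist (R s'' U) (cycle R U₀) < δ') →
      ‖R s U' - R s U - flowTangent R s U (U' - U)‖ ≤ K * ‖U' - U‖ ^ 2 := by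
    intro s hs0 hs1 U U' hU hs
    exact (h s s U U' hs0 hs1 (by simpa using hδ) hU hs).2.trans
      (by gcongr; exact le_max_left _ _)
  set τ := min δ 1 / 2 with hτ
  have hτ0 : 0 < τ := by positivity
  have hτ1 : τ ≤ 1 / 2 := by have := min_le_right δ 1; linarith
  have hτδ : τ < δ := by have := min_le_left δ 1; linarith
  set M := (‖R τ x‖ + ‖flowTangent R τ x‖ * δ + K * δ ^ 2 + (‖x‖ + δ') + K * τ ^ 2) / τ with hM
  have hM0 : 0 ≤ M := by positivity
  -- The generator is bounded through a fixed time `τ`: the time expansion at `V` gives it from `R τ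
  -- V`, which is compared with `R τ x`. The base point of that comparison lies on the cycle, so its
  -- tube condition is automatic.
  have hbound : ∀ V ∈ Metric.ball x (min δ δ'), ‖generator R V‖ ≤ M := by
    intro V hV
    have hVδ : ‖V - x‖ < δ := by
      rw [← dist_eq_norm]; exact (Metric.mem_ball.1 hV).trans_le (min_le_left _ _)
    have hVδ' : ‖V - x‖ < δ' := by
      rw [← dist_eq_norm]; exact (Metric.mem_ball.1 hV).trans_le (min_le_right _ _)
    have i1 := h1 V (by rwa [Metric.mem_ball, dist_eq_norm]) τ (by rwa [abs_of_pos hτ0])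
    have i2 := h2 τ hτ0.le (by linarith) x V hVδ (fun s'' _ => by
      rw [Metric.infDist_zero_of_mem (hR.mem_cycle hx s'')]; exact hδ')
    rw [abs_of_pos hτ0] at i1
    have i3 : ‖flowTangent R τ x (V - x)‖ ≤ ‖flowTangent R τ x‖ * δ :=
      ((flowTangent R τ x).le_opNorm _).trans (by gcongr)
    have i4 : K * ‖V - x‖ ^ 2 ≤ K * δ ^ 2 := by gcongr
    have e : τ • generator R V = (R τ V - R τ x - flowTangent R τ x (V - x))
        + flowTangent R τ x (V - x) + R τ x - (V - x) - x
        - (R τ V - V - τ • generator R V) := by abel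
    have i5 : ‖τ • generator R V‖ ≤ τ * M := by
      rw [hM, mul_div_cancel₀ _ hτ0.ne', e]
      have j1 := norm_sub_le ((R τ V - R τ x - flowTangent R τ x (V - x))
        + flowTangent R τ x (V - x) + R τ x - (V - x) - x) (R τ V - V - τ • generator R V)
      have j2 := norm_sub_le ((R τ V - R τ x - flowTangent R τ x (V - x))
        + flowTangent R τ x (V - x) + R τ x - (V - x)) x
      have j3 := norm_sub_le ((R τ V - R τ x - flowTangent R τ x (V - x))
        + flowTangent R τ x (V - x) + R τ x) (V - x)
      have j4 := norm_add_le ((R τ V - R τ x - flowTangent R τ x (V - x))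
        + flowTangent R τ x (V - x)) (R τ x)
      have j5 := norm_add_le (R τ V - R τ x - flowTangent R τ x (V - x))
        (flowTangent R τ x (V - x))
      linarith
    rw [norm_smul, Real.norm_of_nonneg hτ0.le] at i5
    exact le_of_mul_le_mul_left i5 hτ0
  set r₁ := min δ δ' with hr₁
  have hr₁0 : 0 < r₁ := lt_min hδ hδ'
  set r := min (r₁ / 4) 1 with hr
  have hr0 : 0 < r := by positivity
  have hr4 : r ≤ r₁ / 4 := min_le_left _ _
  set t₁ := min τ (r₁ / (2 * (M + K + 1))) with ht₁
  have ht₁0 : 0 < t₁ := lt_min hτ0 (by positivity)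
  have ht₁τ : t₁ ≤ τ := min_le_left _ _
  have hMt : (M + K) * t₁ ≤ r₁ / 2 := by
    have h2 : (M + K) * t₁ ≤ (M + K + 1) * (r₁ / (2 * (M + K + 1))) :=
      mul_le_mul (by linarith) (min_le_right _ _) ht₁0.le (by positivity)
    refine h2.trans (le_of_eq ?_)
    field_simp
  have hsub : Metric.ball x r ⊆ Metric.ball x r₁ := Metric.ball_subset_ball (by linarith)
  have hsub' : Metric.ball x r₁ ⊆ Metric.ball x δ' := Metric.ball_subset_ball (min_le_right _ _)
  refine ⟨r, t₁, K, M, hr0, min_le_right _ _, ht₁0, by linarith, hK0, hM0,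
    fun V hV => hbound V (hsub hV), fun V hV t ht => h1 V (hsub' (hsub hV)) t (by linarith),
    fun s hs0 hs1 U hU U' hU' => h2 s hs0 (by linarith) U U' ?_ fun s'' hs'' => htube _ (hsub' ?_)⟩
  · rw [Metric.mem_ball, dist_eq_norm] at hU hU'
    have e : U' - U = (U' - x) - (U - x) := by abel
    have := min_le_left δ δ'
    rw [e]
    linarith [norm_sub_le (U' - x) (U - x)]
  · have i1 := h1 U (hsub' (hsub hU)) s'' (by rw [abs_of_nonneg hs''.1]; linarith [hs''.2])
    have i2 : ‖s'' • generator R U‖ ≤ s'' * M := by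
      rw [norm_smul, Real.norm_of_nonneg hs''.1]
      exact mul_le_mul_of_nonneg_left (hbound U (hsub hU)) hs''.1
    rw [abs_of_nonneg hs''.1] at i1
    rw [Metric.mem_ball, dist_eq_norm] at hU ⊢
    have e : R s'' U - x = (R s'' U - U - s'' • generator R U) + s'' • generator R U + (U - x) := by
      abel
    have i3 : K * s'' ^ 2 ≤ K * s'' := by
      gcongr; nlinarith [hs''.1, hs''.2]
    have i4 : (M + K) * s'' ≤ (M + K) * t₁ := by
      gcongr; linarith [hs''.2]
    rw [e]
    linarith [norm_add₃_le (a := R s'' U - U - s'' • generator R U)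
      (b := s'' • generator R U) (c := U - x)]

theorem FlowExpansion.hasDerivAt {R : ℝ → Γ → Γ} {T : ℝ → Γ → Γ →L[ℝ] Γ} {g : Γ → Γ} {x : Γ}
    {r t₁ K M : ℝ} (hR : IsFlow R) (h : FlowExpansion R T g x r t₁ K M) :
    HasDerivAt (fun t => R t x) (g x) 0 := by
  have : HasFDerivAt (fun t => R t x) ((1 : ℝ →L[ℝ] ℝ).smulRight (g x)) 0 := by
    refine hasFDerivAt_of_quadratic (K := K) ?_
    filter_upwards [Metric.ball_mem_nhds (0 : ℝ) h.t_pos] with t ht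
    have h1 := h.time x (Metric.mem_ball_self h.r_pos) t (by
      rw [Metric.mem_ball, dist_zero_right, Real.norm_eq_abs] at ht; exact ht.le)
    simpa [hR.zero] using h1
  have h2 := this.hasDerivAt
  simpa using h2

theorem AssumptionL2.hasDerivAt {R : ℝ → Γ → Γ} (hR : IsFlow R) {U₀ : Γ}
    (hL2 : AssumptionL2 R U₀) : HasDerivAt (fun t => R t U₀) (generator R U₀) 0 := by
  obtain ⟨r, t₁, K, M, h⟩ := hL2.exists_flowExpansion hR ⟨0, hR.zero U₀⟩
  exact h.hasDerivAt hR

theorem AssumptionL2.continuous_orbit {R : ℝ → Γ → Γ} (hR : IsFlow R) {U₀ : Γ}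
    (hL2 : AssumptionL2 R U₀) : Continuous fun t => R t U₀ := by
  refine continuous_iff_continuousAt.2 fun t => ?_
  obtain ⟨r, t₁, K, M, h⟩ := hL2.exists_flowExpansion hR (x := R t U₀) ⟨t, rfl⟩
  have h1 : ContinuousAt (fun s => R s (R t U₀)) (t - t) := by
    rw [sub_self]; exact (h.hasDerivAt hR).continuousAt
  have h2 : ContinuousAt (fun s => R (s - t) (R t U₀)) t :=
    ContinuousAt.comp (f := fun s => s - t) h1 (by fun_prop)
  refine h2.congr (Eventually.of_forall fun s => ?_)
  simp only [← hR.add, sub_add_cancel]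

/-- The flow is jointly of class `C^{1,1}` near the cycle, for all positive and negative times. -/
theorem AssumptionL2.c11At [CompleteSpace Γ] {R : ℝ → Γ → Γ} (hR : IsFlow R) {U₀ : Γ} {Δ : ℝ}
    (hlc : IsLimitCycle R U₀ Δ) (hL2 : AssumptionL2 R U₀) (s : ℝ) {x : Γ} (hx : x ∈ cycle R U₀) :
    C11At (fun z : ℝ × Γ => R z.1 z.2) (s, x) := by
  have hC := isCompact_cycle hR hlc (hL2.continuous_orbit hR)
  -- Compactness of the cycle turns the local time scales into one.
  obtain ⟨t₀, ht₀, hsmall⟩ : ∃ t₀, 0 < t₀ ∧ ∀ y ∈ cycle R U₀, ∀ s ∈ Ioo 0 t₀,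
      C11At (fun z : ℝ × Γ => R z.1 z.2) (s, y) ∧ ‖flowTangent R s y - 1‖ ≤ 1 / 2 := by
    refine hC.induction_on (p := fun A => ∃ t₀, 0 < t₀ ∧ ∀ y ∈ A, ∀ s ∈ Ioo 0 t₀,
      C11At (fun z : ℝ × Γ => R z.1 z.2) (s, y) ∧ ‖flowTangent R s y - 1‖ ≤ 1 / 2)
      ⟨1, one_pos, by simp⟩ ?_ ?_ ?_
    · rintro A B hAB ⟨t, ht, h⟩
      exact ⟨t, ht, fun y hy => h y (hAB hy)⟩
    · rintro A B ⟨t, ht, h⟩ ⟨t', ht', h'⟩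
      refine ⟨min t t', lt_min ht ht', ?_⟩
      rintro y (hy | hy) s hs
      · exact h y hy s ⟨hs.1, hs.2.trans_le (min_le_left _ _)⟩
      · exact h' y hy s ⟨hs.1, hs.2.trans_le (min_le_right _ _)⟩
    · intro y hy
      obtain ⟨r, t₁, K, M, h⟩ := hL2.exists_flowExpansion hR hy
      obtain ⟨t₀, ht₀, -, hev⟩ := h.c11At hR
      exact ⟨_, mem_nhdsWithin_of_mem_nhds hev, t₀, ht₀, fun z hz => hz⟩
  set τ := t₀ / 2 with hτ
  have hτ0 : 0 < τ := by positivity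
  have hτm : τ ∈ Ioo 0 t₀ := ⟨hτ0, by linarith⟩
  have hpos : ∀ y ∈ cycle R U₀, C11At (R τ) y := fun y hy =>
    C11At.comp (g := fun z : ℝ × Γ => R z.1 z.2) (f := fun y => (τ, y)) (hsmall y hy τ hτm).1
      ((C11At.const _ _).prodMk (C11At.id y))
  have hneg : ∀ y ∈ cycle R U₀, C11At (R (-τ)) y := by
    intro y hy
    set z := R (-τ) y with hz
    have hzc : z ∈ cycle R U₀ := hR.mem_cycle hy _
    have hzy : R τ z = y := hR.apply_neg τ y
    -- The tangent map over the short time `τ` is invertible by the Neumann series, so `R τ` has a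
    -- local `C^{1,1}` inverse; by the group law it is `R (-τ)`.
    have hn : ‖1 - flowTangent R τ z‖ < 1 := by
      rw [norm_sub_rev]; exact (hsmall z hzc τ hτm).2.trans_lt (by norm_num)
    let e : Γ ≃L[ℝ] Γ := ContinuousLinearEquiv.ofUnit (Units.oneSub _ hn)
    have he : fderiv ℝ (R τ) z = e :=
      (sub_sub_cancel (1 : Γ →L[ℝ] Γ) (flowTangent R τ z)).symm
    obtain ⟨φ, hzs, hφ, hφs⟩ := (hpos z hzc).exists_openPartialHomeomorph he
    have hyt : y ∈ φ.target := by
      have := φ.map_source hzs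
      rwa [hφ, hzy] at this
    refine (hφs y hyt).congr ?_
    filter_upwards [φ.open_target.mem_nhds hyt] with w hw
    have h1 := φ.right_inv hw
    rw [hφ] at h1
    rw [← hR.neg_apply τ (φ.symm w), h1]
  have hint : ∀ k : ℤ, ∀ y ∈ cycle R U₀, C11At (R (k * τ)) y := by
    intro k
    induction k using Int.induction_on with
    | zero =>
      intro y hy
      refine (C11At.id y).congr (Eventually.of_forall fun z => ?_)
      simp [hR.zero]
    | succ k ih =>
      intro y hy
      refine (C11At.comp (ih _ (hR.mem_cycle hy τ)) (hpos y hy)).congr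
        (Eventually.of_forall fun z => ?_)
      simp only [← hR.add]
      congr 1; push_cast; ring
    | pred k ih =>
      intro y hy
      refine (C11At.comp (ih _ (hR.mem_cycle hy (-τ))) (hneg y hy)).congr
        (Eventually.of_forall fun z => ?_)
      simp only [← hR.add]
      congr 1; push_cast; ring
  -- With the ceiling minus one, the residual time `s - k * τ` lies in `(0, τ]`. A floor could leave
  -- the residual `0`, which `hsmall` does not cover.
  set k : ℤ := ⌈s / τ⌉ - 1 with hk
  have hk1 : s - k * τ ∈ Ioo 0 t₀ := by
    have h1 := Int.ceil_lt_add_one (s / τ)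
    have h2 := Int.le_ceil (s / τ)
    have e : s / τ * τ = s := div_mul_cancel₀ _ hτ0.ne'
    have hkr : (k : ℝ) = ⌈s / τ⌉ - 1 := by rw [hk]; push_cast; ring
    rw [hkr]
    constructor <;> nlinarith
  have hfin : C11At (fun z : ℝ × Γ => R (z.1 - k * τ) (R (k * τ) z.2)) (s, x) := by
    refine C11At.comp (g := fun z : ℝ × Γ => R z.1 z.2)
      (f := fun z : ℝ × Γ => (z.1 - k * τ, R (k * τ) z.2))
      (hsmall _ (hR.mem_cycle hx _) _ hk1).1 ?_
    exact (C11At.fst.sub (C11At.const _ _)).prodMk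
      (C11At.comp (g := R (k * τ)) (hint k x hx) C11At.snd)
  refine hfin.congr (Eventually.of_forall fun z => ?_)
  simp only [← hR.add, sub_add_cancel]

end FlowRegularity

end RG

namespace RG

section Submanifolds

variable {Γ : Type*} [NormedAddCommGroup Γ] [NormedSpace ℝ Γ]

/-! ### Local diffeomorphisms, submanifolds and tangent spaces in terms of germs -/

/-- `f` restricts to a `C^{1,1}` diffeomorphism between neighbourhoods of `x` and `f x`. -/
def IsDiffeoAt (f : Γ → Γ) (x : Γ) : Prop :=
  C11At f x ∧ ∃ g : Γ → Γ, C11At g (f x) ∧ (∀ᶠ y in 𝓝 x, g (f y) = y) ∧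
    ∀ᶠ z in 𝓝 (f x), f (g z) = z

theorem IsDiffeoAt.comp {f g : Γ → Γ} {x : Γ} (hg : IsDiffeoAt g (f x)) (hf : IsDiffeoAt f x) :
    IsDiffeoAt (fun y => g (f y)) x := by
  obtain ⟨hf, f', hf', h1, h2⟩ := hf
  obtain ⟨hg, g', hg', h3, h4⟩ := hg
  have hgx : g' (g (f x)) = f x := h3.self_of_nhds
  have hc : Tendsto g' (𝓝 (g (f x))) (𝓝 (f x)) := by
    have := hg'.continuousAt.tendsto
    rwa [hgx] at this
  refine ⟨hg.comp hf, fun z => f' (g' z), C11At.comp' hf' hg' hgx, ?_, ?_⟩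
  · filter_upwards [h1, hf.continuousAt.eventually h3] with y i1 i2
    rw [i2, i1]
  · filter_upwards [h4, hc.eventually h2] with y i1 i2
    rw [i2, i1]

/-- Near `x` the set `M` is a `C^{1,1}` submanifold. -/
def IsSubmanifoldAt (Size : Submodule ℝ Γ → Prop) (M : Set Γ) (x : Γ) : Prop :=
  ∃ E : Submodule ℝ Γ, E.ClosedComplemented ∧ Size E ∧
    ∃ f : Γ → Γ, IsDiffeoAt f x ∧ ∀ᶠ y in 𝓝 x, y ∈ M ↔ f y ∈ E

theorem IsSubmanifoldAt.preimage {Size : Submodule ℝ Γ → Prop} {M M' : Set Γ} {f : Γ → Γ} {x : Γ}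
    (h : IsSubmanifoldAt Size M (f x)) (hf : IsDiffeoAt f x)
    (hM : ∀ᶠ y in 𝓝 x, y ∈ M' ↔ f y ∈ M) : IsSubmanifoldAt Size M' x := by
  obtain ⟨E, hE, hS, k, hk, hkM⟩ := h
  refine ⟨E, hE, hS, fun y => k (f y), hk.comp hf, ?_⟩
  filter_upwards [hM, hf.1.continuousAt.eventually hkM] with y h1 h2
  rw [h1, h2]

/-- Shrinking a germ of a diffeomorphism to open sets on which both compositions are the identity
yields an actual chart; the remaining arguments can therefore work with germs only. -/
theorem isC11Submanifold_of_at {Size : Submodule ℝ Γ → Prop} {M : Set Γ}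
    (h : ∀ x ∈ M, IsSubmanifoldAt Size M x) : IsC11Submanifold Size M := by
  intro x hx
  obtain ⟨E, hE, hS, f, ⟨hf, g, hg, h1, h2⟩, hM⟩ := h x hx
  refine ⟨E, hE, hS, ?_⟩
  obtain ⟨O₁, hO₁, hO₁o, hxO⟩ := eventually_nhds_iff.1 (hf.eventually.and (h1.and hM))
  obtain ⟨O₂, hO₂, hO₂o, hfO⟩ := eventually_nhds_iff.1 (hg.eventually.and h2)
  have hfc : ContinuousOn f O₁ := fun y hy => (hO₁ y hy).1.continuousAt.continuousWithinAt
  have hgc : ContinuousOn g O₂ := fun y hy => (hO₂ y hy).1.continuousAt.continuousWithinAt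
  let φ : OpenPartialHomeomorph Γ Γ :=
    { toFun := f
      invFun := g
      source := O₁ ∩ f ⁻¹' O₂
      target := O₂ ∩ g ⁻¹' O₁
      map_source' := fun y hy => ⟨hy.2, by rw [mem_preimage, (hO₁ y hy.1).2.1]; exact hy.1⟩
      map_target' := fun y hy => ⟨hy.2, by rw [mem_preimage, (hO₂ y hy.1).2]; exact hy.1⟩
      left_inv' := fun y hy => (hO₁ y hy.1).2.1
      right_inv' := fun y hy => (hO₂ y hy.1).2
      open_source := hfc.isOpen_inter_preimage hO₁o hO₂o
      open_target := hgc.isOpen_inter_preimage hO₂o hO₁o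
      continuousOn_toFun := hfc.mono inter_subset_left
      continuousOn_invFun := hgc.mono inter_subset_left }
  refine ⟨φ, ⟨hxO, hfO⟩, (c11On_iff φ.open_source).2 fun y hy => (hO₁ y hy.1).1,
    (c11On_iff φ.open_target).2 fun y hy => (hO₂ y hy.1).1, ?_⟩
  ext z
  constructor
  · rintro ⟨y, ⟨hyM, hy⟩, rfl⟩
    exact ⟨(hO₁ y hy.1).2.2.1 hyM, φ.map_source hy⟩
  · rintro ⟨hzE, hz⟩
    have hz' := φ.map_target hz
    refine ⟨φ.symm z, ⟨(hO₁ _ hz'.1).2.2.2 ?_, hz'⟩, φ.right_inv hz⟩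
    have : f (φ.symm z) = z := φ.right_inv hz
    rwa [this]

/-- Curves are pushed by `f` and pulled back by its local inverse; the two derivatives are inverse
to each other at `x`. -/
theorem tangentSet_preimage {M M' : Set Γ} {f : Γ → Γ} {x : Γ} (hf : IsDiffeoAt f x)
    (hM : ∀ᶠ y in 𝓝 x, y ∈ M' ↔ f y ∈ M) :
    tangentSet M' x = {v | fderiv ℝ f x v ∈ tangentSet M (f x)} := by
  obtain ⟨hf, g, hg, h1, h2⟩ := hf
  have hgx : g (f x) = x := h1.self_of_nhds
  ext v
  constructor
  · rintro ⟨γ, hγ0, hγM, hγ⟩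
    have hc : Tendsto γ (𝓝 0) (𝓝 x) := by
      have := hγ.continuousAt.tendsto
      rwa [hγ0] at this
    refine ⟨fun t => f (γ t), by simp only [hγ0], ?_, ?_⟩
    · filter_upwards [hγM, hc.eventually hM] with t i1 i2 using i2.1 i1
    · have h3 : HasFDerivAt f (fderiv ℝ f x) (γ 0) := by rw [hγ0]; exact hf.hasFDerivAt
      exact h3.comp_hasDerivAt 0 hγ
  · rintro ⟨γ, hγ0, hγM, hγ⟩
    have hc : Tendsto γ (𝓝 0) (𝓝 (f x)) := by
      have := hγ.continuousAt.tendsto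
      rwa [hγ0] at this
    have hgc : Tendsto g (𝓝 (f x)) (𝓝 x) := by
      have := hg.continuousAt.tendsto
      rwa [hgx] at this
    refine ⟨fun t => g (γ t), by simp only [hγ0, hgx], ?_, ?_⟩
    · filter_upwards [hγM, hc.eventually h2, (hgc.comp hc).eventually hM] with t i1 i2 i3
      refine i3.2 ?_
      rwa [Function.comp_apply, i2]
    · have h3 : HasFDerivAt g (fderiv ℝ g (f x)) (γ 0) := by rw [hγ0]; exact hg.hasFDerivAt
      have h4 := h3.comp_hasDerivAt 0 hγ
      have h5 : HasFDerivAt (fun y => g (f y)) ((fderiv ℝ g (f x)).comp (fderiv ℝ f x)) x :=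
        hg.hasFDerivAt.comp x hf.hasFDerivAt
      have h6 : HasFDerivAt (fun y => g (f y)) (ContinuousLinearMap.id ℝ Γ) x :=
        (hasFDerivAt_id x).congr_of_eventuallyEq h1
      have h7 := DFunLike.congr_fun (h5.unique h6) v
      simp only [ContinuousLinearMap.comp_apply, ContinuousLinearMap.id_apply] at h7
      rwa [h7] at h4

theorem tangentSet_submodule {E : Submodule ℝ Γ} (hE : IsClosed (E : Set Γ)) {x : Γ}
    (hx : x ∈ E) : tangentSet (E : Set Γ) x = E := by
  ext v
  constructor
  · rintro ⟨γ, hγ0, hγM, hγ⟩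
    have h1 := hasDerivAt_iff_tendsto_slope.1 hγ
    refine hE.mem_of_tendsto h1 ?_
    filter_upwards [mem_nhdsWithin_of_mem_nhds hγM] with t ht
    rw [slope_def_module, hγ0]
    exact E.smul_mem _ (E.sub_mem ht hx)
  · intro hv
    refine ⟨fun t => x + t • v, by simp, Eventually.of_forall fun t =>
      E.add_mem hx (E.smul_mem _ hv), ?_⟩
    simpa using ((hasDerivAt_id (0 : ℝ)).smul_const v).const_add x

theorem tangentSet_chart {M : Set Γ} {E : Submodule ℝ Γ} (hE : IsClosed (E : Set Γ)) {f : Γ → Γ}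
    {x : Γ} (hf : IsDiffeoAt f x) (hM : ∀ᶠ y in 𝓝 x, y ∈ M ↔ f y ∈ E) (hx : f x ∈ E) :
    tangentSet M x = {v | fderiv ℝ f x v ∈ E} := by
  rw [tangentSet_preimage hf hM, tangentSet_submodule hE hx]
  rfl

theorem tangentSet_congr {M M' : Set Γ} {x : Γ} (hM : ∀ᶠ y in 𝓝 x, y ∈ M ↔ y ∈ M') :
    tangentSet M x = tangentSet M' x := by
  ext v
  constructor <;> rintro ⟨γ, hγ0, hγM, hγ⟩ <;>
  · have hc : Tendsto γ (𝓝 0) (𝓝 x) := by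
      have := hγ.continuousAt.tendsto
      rwa [hγ0] at this
    refine ⟨γ, hγ0, ?_, hγ⟩
    filter_upwards [hγM, hc.eventually hM] with t h1 h2
    first | exact h2.1 h1 | exact h2.2 h1

end Submanifolds

end RG

namespace RG

section Hyperbolic

variable {Γ : Type*} [NormedAddCommGroup Γ] [NormedSpace ℝ Γ]

/-! ### Hyperbolic cycles -/

section FlowDerivatives

variable {R : ℝ → Γ → Γ}

theorem c11At_flow {s : ℝ} {x : Γ} (h : C11At (fun z : ℝ × Γ => R z.1 z.2) (s, x)) :
    C11At (R s) x :=
  C11At.comp (g := fun z : ℝ × Γ => R z.1 z.2) (f := fun y => (s, y)) h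
    ((C11At.const _ _).prodMk (C11At.id x))

theorem flowTangent_eq {s : ℝ} {x : Γ} (h : C11At (fun z : ℝ × Γ => R z.1 z.2) (s, x)) :
    flowTangent R s x =
      (fderiv ℝ (fun z : ℝ × Γ => R z.1 z.2) (s, x)).comp (ContinuousLinearMap.inr ℝ ℝ Γ) := by
  have h1 : HasFDerivAt (fun y : Γ => (s, y)) (ContinuousLinearMap.inr ℝ ℝ Γ) x :=
    hasFDerivAt_prodMk_right s x
  exact (HasFDerivAt.comp x h.hasFDerivAt h1).fderiv

theorem hasDerivAt_flow_time {s : ℝ} {x : Γ} (h : C11At (fun z : ℝ × Γ => R z.1 z.2) (s, x)) :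
    HasDerivAt (fun t => R t x) (fderiv ℝ (fun z : ℝ × Γ => R z.1 z.2) (s, x) (1, 0)) s := by
  have h1 : HasDerivAt (fun t : ℝ => (t, x)) (1, (0 : Γ)) s :=
    (hasDerivAt_id s).prodMk (hasDerivAt_const s x)
  exact HasFDerivAt.comp_hasDerivAt s h.hasFDerivAt h1

end FlowDerivatives

/-- A limit cycle of a flow that is of class `C^{1,1}` near the cycle, with a hyperbolic splitting.
The roles of the stable and the unstable space are interchanged by time reversal. -/
structure HypCycle (R : ℝ → Γ → Γ) (U₀ : Γ) (Δ : ℝ) (g₀ : Γ) (Es Eu : Submodule ℝ Γ) : Prop where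
  flow : IsFlow R
  lc : IsLimitCycle R U₀ Δ
  c11 : ∀ s, ∀ x ∈ cycle R U₀, C11At (fun z : ℝ × Γ => R z.1 z.2) (s, x)
  gen : HasDerivAt (fun t => R t U₀) g₀ 0
  closed_s : IsClosed (Es : Set Γ)
  closed_u : IsClosed (Eu : Set Γ)
  bij : Function.Bijective fun z : (Es × ℝ) × Eu => (z.1.1 : Γ) + z.1.2 • g₀ + z.2
  map_s : ∀ F ∈ Es, flowTangent R Δ U₀ F ∈ Es
  map_u : ∀ F ∈ Eu, flowTangent R Δ U₀ F ∈ Eu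
  -- Automatic when `Eu` is finite-dimensional, but after time reversal this slot is occupied by the
  -- contracted space, which may be infinite-dimensional.
  surj_u : ∀ F ∈ Eu, ∃ F' ∈ Eu, flowTangent R Δ U₀ F' = F
  rate : ∃ c, c < 1 ∧ (∀ F ∈ Es, ‖flowTangent R Δ U₀ F‖ ≤ c * ‖F‖) ∧
    ∀ F ∈ Eu, ‖F‖ ≤ c * ‖flowTangent R Δ U₀ F‖

namespace HypCycle

variable {R : ℝ → Γ → Γ} {U₀ : Γ} {Δ : ℝ} {g₀ : Γ} {Es Eu : Submodule ℝ Γ}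

/-- The sum map of the splitting. -/
noncomputable def sumMap (g₀ : Γ) (Es Eu : Submodule ℝ Γ) : ((Es × ℝ) × Eu) →L[ℝ] Γ :=
  (Es.subtypeL.comp (ContinuousLinearMap.fst ℝ Es ℝ) +
    (ContinuousLinearMap.snd ℝ Es ℝ).smulRight g₀).comp (ContinuousLinearMap.fst ℝ (Es × ℝ) Eu)
    + Eu.subtypeL.comp (ContinuousLinearMap.snd ℝ (Es × ℝ) Eu)

theorem sumMap_apply (z : (Es × ℝ) × Eu) :
    sumMap g₀ Es Eu z = (z.1.1 : Γ) + z.1.2 • g₀ + z.2 := rfl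

/-- Closedness makes the summands Banach spaces, so the open mapping theorem upgrades the algebraic
splitting to a topological one. -/
theorem exists_splitting [CompleteSpace Γ] (H : HypCycle R U₀ Δ g₀ Es Eu) :
    ∃ e : ((Es × ℝ) × Eu) ≃L[ℝ] Γ, ∀ z, e z = (z.1.1 : Γ) + z.1.2 • g₀ + z.2 := by
  have : CompleteSpace Es := H.closed_s.completeSpace_coe
  have : CompleteSpace Eu := H.closed_u.completeSpace_coe
  refine ⟨ContinuousLinearEquiv.ofBijective (sumMap g₀ Es Eu) ?_ ?_, fun z => rfl⟩
  · exact LinearMap.ker_eq_bot.2 H.bij.1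
  · exact LinearMap.range_eq_top.2 H.bij.2

theorem mem_cycle_base (H : HypCycle R U₀ Δ g₀ Es Eu) : U₀ ∈ cycle R U₀ := ⟨0, H.flow.zero U₀⟩

theorem mem_cycle (_ : HypCycle R U₀ Δ g₀ Es Eu) (s : ℝ) : R s U₀ ∈ cycle R U₀ := ⟨s, rfl⟩

theorem continuousAt (H : HypCycle R U₀ Δ g₀ Es Eu) (s : ℝ) {x : Γ} (hx : x ∈ cycle R U₀) :
    ContinuousAt (fun z : ℝ × Γ => R z.1 z.2) (s, x) := (H.c11 s x hx).continuousAt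

theorem continuous_orbit (H : HypCycle R U₀ Δ g₀ Es Eu) : Continuous fun t => R t U₀ :=
  continuous_iff_continuousAt.2 fun s =>
    (hasDerivAt_flow_time (H.c11 s U₀ H.mem_cycle_base)).continuousAt

theorem isCompact_cycle (H : HypCycle R U₀ Δ g₀ Es Eu) : IsCompact (cycle R U₀) :=
  RG.isCompact_cycle H.flow H.lc H.continuous_orbit

theorem hasFDerivAt (H : HypCycle R U₀ Δ g₀ Es Eu) (s : ℝ) {x : Γ} (hx : x ∈ cycle R U₀) :
    HasFDerivAt (R s) (flowTangent R s x) x := (c11At_flow (H.c11 s x hx)).hasFDerivAt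

theorem flowTangent_add (H : HypCycle R U₀ Δ g₀ Es Eu) (s t : ℝ) {x : Γ} (hx : x ∈ cycle R U₀)
    (v : Γ) : flowTangent R (s + t) x v = flowTangent R s (R t x) (flowTangent R t x v) := by
  have h1 := (H.hasFDerivAt s (H.flow.mem_cycle hx t)).comp x (H.hasFDerivAt t hx)
  have h2 : R s ∘ R t = R (s + t) := funext fun U => (H.flow.add s t U).symm
  rw [h2] at h1
  exact DFunLike.congr_fun h1.fderiv v

theorem flowTangent_zero (H : HypCycle R U₀ Δ g₀ Es Eu) (x v : Γ) : flowTangent R 0 x v = v := by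
  have h2 : R 0 = id := funext H.flow.zero
  rw [flowTangent, h2, fderiv_id]
  rfl

theorem flowTangent_neg_apply (H : HypCycle R U₀ Δ g₀ Es Eu) (s : ℝ) (v : Γ) :
    flowTangent R (-s) (R s U₀) (flowTangent R s U₀ v) = v := by
  rw [← H.flowTangent_add _ _ H.mem_cycle_base, neg_add_cancel, H.flowTangent_zero]

theorem flowTangent_apply_neg (H : HypCycle R U₀ Δ g₀ Es Eu) (s : ℝ) (v : Γ) :
    flowTangent R s U₀ (flowTangent R (-s) (R s U₀) v) = v := by
  have := H.flowTangent_add s (-s) (H.mem_cycle s) v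
  rw [add_neg_cancel, H.flowTangent_zero, H.flow.neg_apply] at this
  exact this.symm

theorem hasDerivAt_orbit (H : HypCycle R U₀ Δ g₀ Es Eu) (s : ℝ) :
    HasDerivAt (fun t => R t U₀) (flowTangent R s U₀ g₀) s := by
  have h1 : HasDerivAt (fun t => R (t - s) U₀) g₀ s := by
    have h2 : HasDerivAt (fun t => R t U₀) g₀ (s - s) := by rw [sub_self]; exact H.gen
    exact h2.comp_sub_const s s
  have h3 : HasFDerivAt (R s) (flowTangent R s U₀) (R (s - s) U₀) := by
    rw [sub_self, H.flow.zero]; exact H.hasFDerivAt s H.mem_cycle_base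
  have h4 := h3.comp_hasDerivAt s h1
  refine h4.congr_of_eventuallyEq (Eventually.of_forall fun t => ?_)
  simp only [Function.comp_apply, ← H.flow.add, add_sub_cancel]

/-- By the group law, moving in time at `R s U₀` is the image under the tangent map of moving along
`g₀` at `U₀`. All derivatives of transit and return maps are computed from this formula. -/
theorem fderiv_flow_base (H : HypCycle R U₀ Δ g₀ Es Eu) (s : ℝ) (a : ℝ) (v : Γ) :
    fderiv ℝ (fun z : ℝ × Γ => R z.1 z.2) (s, U₀) (a, v) = flowTangent R s U₀ (a • g₀ + v) := by
  have h1 := (hasDerivAt_flow_time (H.c11 s U₀ H.mem_cycle_base)).unique (H.hasDerivAt_orbit s)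
  have h2 := DFunLike.congr_fun (flowTangent_eq (H.c11 s U₀ H.mem_cycle_base)) v
  have e : ((a, v) : ℝ × Γ) = a • (1, 0) + (0, v) := by simp
  rw [e, map_add, map_smul, h1, map_add, map_smul, h2]
  rfl

theorem flowTangent_period (H : HypCycle R U₀ Δ g₀ Es Eu) : flowTangent R Δ U₀ g₀ = g₀ := by
  have h1 := H.hasDerivAt_orbit Δ
  have h2 : HasDerivAt (fun t => R (t - Δ) U₀) g₀ Δ := by
    have h2 : HasDerivAt (fun t => R t U₀) g₀ (Δ - Δ) := by rw [sub_self]; exact H.gen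
    exact h2.comp_sub_const Δ Δ
  refine h1.unique (h2.congr_of_eventuallyEq (Eventually.of_forall fun t => ?_))
  have := H.lc.periodic_orbit H.flow (t - Δ)
  simp only [sub_add_cancel] at this
  exact this

end HypCycle

/-! ### Transit times to the sections -/

/-- Transit times `s + q s V` from a neighbourhood `B` of the point `U₀` to sections `S s`. -/
structure TransitSys (R : ℝ → Γ → Γ) (U₀ : Γ) (Δ : ℝ) (g₀ : Γ) (Es Eu : Submodule ℝ Γ)
    (S : ℝ → Set Γ) (ε : ℝ) (B : Set Γ) (q : ℝ → Γ → ℝ) : Prop where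
  eps_pos : 0 < ε
  -- Keeps all return times between `Δ / 2` and `2 * Δ`.
  eps_le : ε ≤ Δ / 4
  isOpen : IsOpen B
  mem : U₀ ∈ B
  lt : ∀ s ∈ Icc (-Δ) Δ, ∀ V ∈ B, |q s V| < ε
  sec : ∀ s ∈ Icc (-Δ) Δ, ∀ V ∈ B, R (s + q s V) V ∈ S s
  -- The uniqueness window is twice the range of `q`: a point displaced along its orbit by less than
  -- `ε` still has its shifted transit time in the window.
  uniq : ∀ s ∈ Icc (-Δ) Δ, ∀ V ∈ B, ∀ a, |a| < 2 * ε → R (s + a) V ∈ S s → a = q s V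
  c11 : ∀ s ∈ Icc (-Δ) Δ, ∀ V ∈ B, C11At (q s) V
  small : ∀ η, 0 < η → ∀ᶠ V in 𝓝 U₀, ∀ s ∈ Icc (-Δ) Δ, |q s V| < η
  base : ∀ s ∈ Icc (-Δ) Δ, q s U₀ = 0
  deriv_s : ∀ s ∈ Icc (-Δ) Δ, ∀ v ∈ Es, fderiv ℝ (q s) U₀ v = 0
  deriv_u : ∀ s ∈ Icc (-Δ) Δ, ∀ v ∈ Eu, fderiv ℝ (q s) U₀ v = 0
  deriv_c : ∀ s ∈ Icc (-Δ) Δ, fderiv ℝ (q s) U₀ g₀ = -1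
  isClosed : IsClosed (S 0)
  mem_zero : ∀ U, U ∈ S 0 ↔ U - U₀ ∈ Es ⊔ Eu

/-- Growth at rate at least `1 / 2` forces a sign change on `[-ε, ε]` and excludes a second root.
The bound by `2 * |f 0|` is what later makes transit times small uniformly in the section. -/
theorem exists_unique_root {f f' : ℝ → ℝ} {ε : ℝ} (hε : 0 < ε)
    (hf : ∀ a ∈ Icc (-(2 * ε)) (2 * ε), HasDerivAt f (f' a) a)
    (hf' : ∀ a ∈ Icc (-(2 * ε)) (2 * ε), 1 / 2 < f' a) (h0 : |f 0| < ε / 2) :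
    ∃ a, |a| < ε ∧ f a = 0 ∧ |a| ≤ 2 * |f 0| ∧ ∀ b, |b| < 2 * ε → f b = 0 → b = a := by
  have hmono : ∀ a ∈ Icc (-(2 * ε)) (2 * ε), ∀ b ∈ Icc (-(2 * ε)) (2 * ε), a ≤ b →
      1 / 2 * (b - a) ≤ f b - f a := by
    refine Convex.mul_sub_le_image_sub_of_le_deriv (convex_Icc _ _)
      (fun a ha => (hf a ha).continuousAt.continuousWithinAt)
      (fun a ha => (hf a (interior_subset ha)).differentiableAt.differentiableWithinAt) ?_
    intro a ha
    rw [(hf a (interior_subset ha)).deriv]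
    exact (hf' a (interior_subset ha)).le
  have m1 : ε ∈ Icc (-(2 * ε)) (2 * ε) := ⟨by linarith, by linarith⟩
  have m2 : -ε ∈ Icc (-(2 * ε)) (2 * ε) := ⟨by linarith, by linarith⟩
  have m0 : (0 : ℝ) ∈ Icc (-(2 * ε)) (2 * ε) := ⟨by linarith, by linarith⟩
  have h1 := hmono 0 m0 ε m1 hε.le
  have h2 := hmono (-ε) m2 0 m0 (by linarith)
  rw [abs_lt] at h0
  have hpos : 0 < f ε := by linarith
  have hneg : f (-ε) < 0 := by linarith
  have hcont : ContinuousOn f (Icc (-ε) ε) := fun a ha =>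
    (hf a ⟨by linarith [ha.1], by linarith [ha.2]⟩).continuousAt.continuousWithinAt
  obtain ⟨a, ha, hfa⟩ := intermediate_value_Icc (by linarith) hcont ⟨hneg.le, hpos.le⟩
  have ha1 : a ≠ ε := by rintro rfl; linarith
  have ha2 : a ≠ -ε := by rintro rfl; linarith
  have haε : |a| < ε := abs_lt.2 ⟨lt_of_le_of_ne ha.1 ha2.symm, lt_of_le_of_ne ha.2 ha1⟩
  have mem : ∀ b, |b| < 2 * ε → b ∈ Icc (-(2 * ε)) (2 * ε) := fun b hb =>
    ⟨(abs_lt.1 hb).1.le, (abs_lt.1 hb).2.le⟩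
  have ma := mem a (by linarith)
  refine ⟨a, haε, hfa, ?_, fun b hb hfb => ?_⟩
  · rcases le_total 0 a with h | h
    · have := hmono 0 m0 a ma h
      rw [abs_of_nonneg h]
      linarith [neg_abs_le (f 0)]
    · have := hmono a ma 0 m0 h
      rw [abs_of_nonpos h]
      linarith [le_abs_self (f 0)]
  · rcases le_total a b with h | h
    · have := hmono a ma b (mem b hb) h
      linarith
    · have := hmono b (mem b hb) a ma h
      linarith

/-- Pulling back by the inverse tangent map describes each section by one scalar equation that
depends continuously on `s`. -/
theorem HypCycle.mem_section [CompleteSpace Γ] {R : ℝ → Γ → Γ} {U₀ : Γ} {Δ : ℝ} {g₀ : Γ}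
    {Es Eu : Submodule ℝ Γ} (H : HypCycle R U₀ Δ g₀ Es Eu) {ℓ : Γ →L[ℝ] ℝ}
    (hℓ : ∀ v, ℓ v = 0 ↔ v ∈ Es ⊔ Eu) (s : ℝ) (U : Γ) :
    U ∈ poincareSection R U₀ Eu Es s ↔ ℓ (flowTangent R (-s) (R s U₀) (U - R s U₀)) = 0 := by
  rw [hℓ, sup_comm, poincareSection, sectionDir]
  constructor
  · rintro ⟨v, hv, hvU⟩
    rw [← hvU]
    exact (H.flowTangent_neg_apply s v).symm ▸ hv
  · intro h
    exact ⟨_, h, H.flowTangent_apply_neg s _⟩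

/-- With `ℓ` the coordinate along `g₀`, the height of `R (s + a) V` over the section grows at rate
`1` in `a` at `V = U₀`. Compactness of `[-Δ, Δ]` makes the neighbourhood and the time window uniform
in `s`. -/
theorem HypCycle.exists_transitSys [CompleteSpace Γ] {R : ℝ → Γ → Γ} {U₀ : Γ} {Δ : ℝ} {g₀ : Γ}
    {Es Eu : Submodule ℝ Γ} (H : HypCycle R U₀ Δ g₀ Es Eu) :
    ∃ ε B q, TransitSys R U₀ Δ g₀ Es Eu (poincareSection R U₀ Eu Es) ε B q := by
  obtain ⟨e, he⟩ := H.exists_splitting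
  set F := fun z : ℝ × Γ => R z.1 z.2 with hF
  let ℓ : Γ →L[ℝ] ℝ := ((ContinuousLinearMap.snd ℝ Es ℝ).comp
    (ContinuousLinearMap.fst ℝ (Es × ℝ) Eu)).comp (e.symm : Γ →L[ℝ] (Es × ℝ) × Eu)
  have hℓe : ∀ z, ℓ (e z) = z.1.2 := fun z => by simp [ℓ]
  have hℓs : ∀ v ∈ Es, ℓ v = 0 := fun v hv => by
    have := hℓe ((⟨v, hv⟩, 0), 0)
    rw [he] at this
    simpa using this
  have hℓu : ∀ v ∈ Eu, ℓ v = 0 := fun v hv => by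
    have := hℓe ((0, 0), ⟨v, hv⟩)
    rw [he] at this
    simpa using this
  have hℓc : ℓ g₀ = 1 := by
    have := hℓe ((0, 1), 0)
    rw [he] at this
    simpa using this
  have hℓ : ∀ v, ℓ v = 0 ↔ v ∈ Es ⊔ Eu := by
    intro v
    constructor
    · intro h
      obtain ⟨z, rfl⟩ := e.surjective v
      rw [hℓe] at h
      rw [he, h, zero_smul, add_zero]
      exact Submodule.add_mem_sup z.1.1.2 z.2.2
    · intro h
      obtain ⟨a, ha, b, hb, rfl⟩ := Submodule.mem_sup.1 h
      rw [map_add, hℓs a ha, hℓu b hb, add_zero]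
  have hΔ := H.lc.pos
  set J := Icc (-Δ) Δ with hJ
  have hJc : IsCompact J := isCompact_Icc
  have hC11 : ∀ s, C11At F (s, U₀) := fun s => H.c11 s U₀ H.mem_cycle_base
  let ℓs : ℝ → Γ →L[ℝ] ℝ := fun s => ℓ.comp (flowTangent R (-s) (R s U₀))
  have hsec : ∀ s U, U ∈ poincareSection R U₀ Eu Es s ↔ ℓs s (U - R s U₀) = 0 := fun s U =>
    H.mem_section hℓ s U
  have hℓsc : Continuous ℓs := by
    refine continuous_iff_continuousAt.2 fun s => ?_
    have h1 : ContinuousAt (fun s => fderiv ℝ F (-s, R s U₀)) s :=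
      ContinuousAt.comp (g := fderiv ℝ F) (f := fun s => (-s, R s U₀))
        (H.c11 (-s) _ (H.mem_cycle s)).continuousAt_fderiv
        (continuousAt_neg.prodMk H.continuous_orbit.continuousAt)
    have h2 : ℓs = fun s => ℓ.comp ((fderiv ℝ F (-s, R s U₀)).comp
        (ContinuousLinearMap.inr ℝ ℝ Γ)) := by
      funext s
      simp only [ℓs, flowTangent_eq (H.c11 (-s) _ (H.mem_cycle s)), hF]
    rw [h2]
    exact continuousAt_const.clm_comp (h1.clm_comp continuousAt_const)
  let κ : ℝ → ℝ → Γ → ℝ := fun s a V => ℓs s (R (s + a) V - R s U₀)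
  let κ' : ℝ → ℝ → Γ → ℝ := fun s a V => ℓs s (fderiv ℝ F (s + a, V) (1, 0))
  have hκ' : ∀ s a V, C11At F (s + a, V) → HasDerivAt (fun a => κ s a V) (κ' s a V) a := by
    intro s a V h
    have h1 : HasDerivAt (fun a => R (s + a) V) (fderiv ℝ F (s + a, V) (1, 0)) a :=
      (hasDerivAt_flow_time h).comp_const_add s a
    exact (ℓs s).hasFDerivAt.comp_hasDerivAt a (h1.sub_const _)
  have hκ'0 : ∀ s, κ' s 0 U₀ = 1 := by
    intro s
    simp only [κ', ℓs, add_zero, hF, ContinuousLinearMap.comp_apply]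
    rw [H.fderiv_flow_base s 1 0, one_smul, add_zero, H.flowTangent_neg_apply, hℓc]
  have hev : ∀ᶠ z : ℝ × Γ in 𝓝 (0, U₀), ∀ s ∈ J,
      C11At F (s + z.1, z.2) ∧ 1 / 2 < κ' s z.1 z.2 := by
    refine hJc.eventually_forall_of_forall_eventually
      (P := fun (z : ℝ × Γ) (s : ℝ) => C11At F (s + z.1, z.2) ∧ 1 / 2 < κ' s z.1 z.2) ?_
    intro s _
    have hcm : ContinuousAt (fun w : (ℝ × Γ) × ℝ => (w.2 + w.1.1, w.1.2)) ((0, U₀), s) := by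
      fun_prop
    have hcm0 : (s + 0, U₀) = (s, U₀) := by rw [add_zero]
    refine Eventually.and ?_ ?_
    · refine hcm.eventually (p := fun z => C11At F z) ?_
      simp only [hcm0]
      exact (hC11 s).eventually
    · have h1 : ContinuousAt (fun w : (ℝ × Γ) × ℝ => fderiv ℝ F (w.2 + w.1.1, w.1.2))
          ((0, U₀), s) := by
        refine ContinuousAt.comp (g := fderiv ℝ F)
          (f := fun w : (ℝ × Γ) × ℝ => (w.2 + w.1.1, w.1.2)) ?_ hcm
        simp only [hcm0]
        exact (hC11 s).continuousAt_fderiv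
      have h2 : ContinuousAt (fun w : (ℝ × Γ) × ℝ => κ' w.2 w.1.1 w.1.2) ((0, U₀), s) :=
        ((hℓsc.comp continuous_snd).continuousAt).clm_apply (h1.clm_apply continuousAt_const)
      refine h2.eventually (lt_mem_nhds ?_)
      simp only [hκ'0]
      norm_num
  have hκ0 : ∀ η, 0 < η → ∀ᶠ V in 𝓝 U₀, ∀ s ∈ J, |κ s 0 V| < η := by
    intro η hη
    refine hJc.eventually_forall_of_forall_eventually
      (P := fun (V : Γ) (s : ℝ) => |κ s 0 V| < η) ?_
    intro s _
    have h1 : ContinuousAt (fun w : Γ × ℝ => R (w.2 + 0) w.1) (U₀, s) := by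
      have h3 : ContinuousAt (fun w : Γ × ℝ => (w.2 + 0, w.1)) (U₀, s) := by fun_prop
      refine ContinuousAt.comp (g := F) (f := fun w : Γ × ℝ => (w.2 + 0, w.1)) ?_ h3
      simp only [add_zero]
      exact (hC11 s).continuousAt
    have h2 : ContinuousAt (fun w : Γ × ℝ => |κ w.2 0 w.1|) (U₀, s) :=
      (((hℓsc.comp continuous_snd).continuousAt).clm_apply
        (h1.sub ((H.continuous_orbit.comp continuous_snd).continuousAt))).abs
    refine h2.eventually (gt_mem_nhds ?_)
    simpa [κ] using hη
  obtain ⟨ρ, hρ, hball⟩ := Metric.eventually_nhds_iff_ball.1 hev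
  set ε := min (ρ / 4) (Δ / 4) with hε
  have hε0 : 0 < ε := by positivity
  have hερ : 2 * ε < ρ := by have := min_le_left (ρ / 4) (Δ / 4); linarith
  have hevB : ∀ᶠ V in 𝓝 U₀, V ∈ Metric.ball U₀ ρ := Metric.ball_mem_nhds U₀ hρ
  obtain ⟨B, hB, hBo, hUB⟩ := eventually_nhds_iff.1 (hevB.and (hκ0 (ε / 2) (by positivity)))
  have hz : ∀ V ∈ B, ∀ a, |a| ≤ 2 * ε → (a, V) ∈ Metric.ball ((0 : ℝ), U₀) ρ := by
    intro V hV a ha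
    rw [← ball_prod_same]
    exact ⟨by simpa using lt_of_le_of_lt ha hερ, (hB V hV).1⟩
  have hroot : ∀ s ∈ J, ∀ V ∈ B, ∃ a, |a| < ε ∧ κ s a V = 0 ∧ |a| ≤ 2 * |κ s 0 V| ∧
      ∀ b, |b| < 2 * ε → κ s b V = 0 → b = a := by
    intro s hs V hV
    refine exists_unique_root (f := fun a => κ s a V) (f' := fun a => κ' s a V) hε0 ?_ ?_
      ((hB V hV).2 s hs)
    · intro a ha
      exact hκ' s a V (hball _ (hz V hV a (abs_le.2 ha)) s hs).1
    · intro a ha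
      exact (hball _ (hz V hV a (abs_le.2 ha)) s hs).2
  choose! q hq1 hq2 hq3 hq4 using hroot
  have hc11q : ∀ s ∈ J, ∀ V ∈ B, C11At (q s) V := by
    intro s hs V hV
    have hFa := hball _ (hz V hV (q s V) (by linarith [hq1 s hs V hV])) s hs
    let k : Γ × ℝ → ℝ := fun w => κ s w.2 w.1
    have hk : C11At k (V, q s V) := by
      refine C11At.clm_comp (ℓs s) (C11At.sub ?_ (C11At.const _ _))
      exact C11At.comp (g := F) (f := fun w : Γ × ℝ => (s + w.2, w.1)) hFa.1
        (((C11At.const _ _).add C11At.snd).prodMk C11At.fst)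
    have hd : fderiv ℝ k (V, q s V) (0, 1) = κ' s (q s V) V := by
      have h1 : HasDerivAt (fun b : ℝ => (V, b)) ((0 : Γ), (1 : ℝ)) (q s V) :=
        (hasDerivAt_const _ V).prodMk (hasDerivAt_id _)
      have h2 := HasFDerivAt.comp_hasDerivAt (q s V) hk.hasFDerivAt h1
      exact h2.unique (hκ' s _ V hFa.1)
    -- The implicit function theorem provides a `C^{1,1}` solution near `V`; uniqueness in the
    -- window identifies it with `q s`, which was only chosen pointwise.
    obtain ⟨ψ, hψ, hψV, hψ0⟩ := hk.exists_implicit (hq2 s hs V hV)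
      (by rw [hd]; linarith [hFa.2])
    refine hψ.congr ?_
    have h3 : ∀ᶠ V' in 𝓝 V, |ψ V'| < 2 * ε :=
      hψ.continuousAt.abs.eventually (gt_mem_nhds (by
        simp only [hψV]; linarith [hq1 s hs V hV]))
    filter_upwards [h3, hψ0, hBo.mem_nhds hV] with V' i1 i2 i3
    exact hq4 s hs V' i3 _ i1 i2
  have hbase : ∀ s ∈ J, q s U₀ = 0 := fun s hs =>
    (hq4 s hs U₀ hUB 0 (by simpa using hε0) (by simp [κ])).symm
  -- Differentiate the identity `κ s (q s V) V = 0` at `U₀`; the tangent map and its inverse cancel,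
  -- and the result is the same for all sections.
  have hderiv : ∀ s ∈ J, ∀ v, fderiv ℝ (q s) U₀ v = - ℓ v := by
    intro s hs v
    have h1 : HasFDerivAt (fun V => (s + q s V, V))
        ((fderiv ℝ (q s) U₀).prod (ContinuousLinearMap.id ℝ Γ)) U₀ :=
      ((hc11q s hs U₀ hUB).hasFDerivAt.const_add s).prodMk (hasFDerivAt_id U₀)
    have h2 : HasFDerivAt F (fderiv ℝ F (s, U₀)) (s + q s U₀, U₀) := by
      rw [hbase s hs, add_zero]; exact (hC11 s).hasFDerivAt
    have h3 := (ℓs s).hasFDerivAt.comp U₀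
      ((HasFDerivAt.comp (g := F) (f := fun V => (s + q s V, V)) U₀ h2 h1).sub_const (R s U₀))
    have h4 : HasFDerivAt (fun _ : Γ => (0 : ℝ)) (0 : Γ →L[ℝ] ℝ) U₀ := hasFDerivAt_const _ _
    have h5 := h3.unique (h4.congr_of_eventuallyEq
      (eventually_of_mem (hBo.mem_nhds hUB) fun V hV => hq2 s hs V hV))
    have h6 := DFunLike.congr_fun h5 v
    simp only [ContinuousLinearMap.comp_apply, ContinuousLinearMap.prod_apply,
      ContinuousLinearMap.id_apply] at h6
    rw [H.fderiv_flow_base] at h6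
    simp only [ℓs, ContinuousLinearMap.comp_apply] at h6
    rw [H.flowTangent_neg_apply, map_add, map_smul, hℓc, smul_eq_mul, mul_one] at h6
    have h7 : fderiv ℝ (q s) U₀ v + ℓ v = 0 := h6
    linarith
  have hmem0 : ∀ U, U ∈ poincareSection R U₀ Eu Es 0 ↔ ℓ (U - U₀) = 0 := by
    intro U
    rw [hsec]
    simp only [ℓs, ContinuousLinearMap.comp_apply, neg_zero]
    rw [H.flowTangent_zero, H.flow.zero]
  refine ⟨ε, B, q, hε0, min_le_right _ _, hBo, hUB, hq1, fun s hs V hV =>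
    (hsec _ _).2 (hq2 s hs V hV), fun s hs V hV a ha h => hq4 s hs V hV a ha ((hsec _ _).1 h),
    hc11q, ?_, hbase, fun s hs v hv => by rw [hderiv s hs, hℓs v hv, neg_zero],
    fun s hs v hv => by rw [hderiv s hs, hℓu v hv, neg_zero],
    fun s hs => by rw [hderiv s hs, hℓc], ?_, fun U => by rw [hmem0, hℓ]⟩
  · intro η hη
    filter_upwards [hκ0 (η / 2) (by positivity), hBo.mem_nhds hUB] with V hV hVB s hs
    exact (hq3 s hs V hVB).trans_lt (by linarith [hV s hs])
  · have : poincareSection R U₀ Eu Es 0 = (fun U => ℓ (U - U₀)) ⁻¹' {0} := by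
      ext U; exact hmem0 U
    rw [this]
    exact isClosed_singleton.preimage (by fun_prop)

end Hyperbolic

end RG

namespace RG

section StableChart

variable {Γ : Type*} [NormedAddCommGroup Γ] [NormedSpace ℝ Γ]

/-! ### The return map and its stable manifold -/

/-- The map that carries points near `U₀` into the section `S s`. -/
def slide (R : ℝ → Γ → Γ) (q : ℝ → Γ → ℝ) (s : ℝ) (V : Γ) : Γ := R (s + q s V) V

/-- The return map to the section `S 0`, defined on a full neighbourhood of `U₀`. -/
def returnMap (R : ℝ → Γ → Γ) (Δ : ℝ) (q : ℝ → Γ → ℝ) (V : Γ) : Γ := slide R q 0 (R Δ V)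

variable {R : ℝ → Γ → Γ} {U₀ : Γ} {Δ : ℝ} {g₀ : Γ} {Es Eu : Submodule ℝ Γ}
  {S : ℝ → Set Γ} {ε : ℝ} {B : Set Γ} {q : ℝ → Γ → ℝ}

theorem HypCycle.zero_mem (H : HypCycle R U₀ Δ g₀ Es Eu) : (0 : ℝ) ∈ Icc (-Δ) Δ :=
  ⟨by linarith [H.lc.pos], H.lc.pos.le⟩

theorem c11At_slide {s : ℝ} {V : Γ} (hq : C11At (q s) V)
    (hF : C11At (fun z : ℝ × Γ => R z.1 z.2) (s + q s V, V)) : C11At (slide R q s) V :=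
  C11At.comp (g := fun z : ℝ × Γ => R z.1 z.2) (f := fun V => (s + q s V, V)) hF
    (((C11At.const _ _).add hq).prodMk (C11At.id V))

namespace TransitSys

theorem slide_base (Tr : TransitSys R U₀ Δ g₀ Es Eu S ε B q) {s : ℝ} (hs : s ∈ Icc (-Δ) Δ) :
    slide R q s U₀ = R s U₀ := by
  rw [slide, Tr.base s hs, add_zero]

theorem c11At_slide_base (Tr : TransitSys R U₀ Δ g₀ Es Eu S ε B q)
    (H : HypCycle R U₀ Δ g₀ Es Eu) {s : ℝ} (hs : s ∈ Icc (-Δ) Δ) : C11At (slide R q s) U₀ :=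
  c11At_slide (Tr.c11 s hs U₀ Tr.mem) (H.c11 _ _ H.mem_cycle_base)

theorem fderiv_slide_base (Tr : TransitSys R U₀ Δ g₀ Es Eu S ε B q)
    (H : HypCycle R U₀ Δ g₀ Es Eu) {s : ℝ} (hs : s ∈ Icc (-Δ) Δ) (v : Γ) :
    fderiv ℝ (slide R q s) U₀ v = flowTangent R s U₀ (fderiv ℝ (q s) U₀ v • g₀ + v) := by
  have h1 : HasFDerivAt (fun V => (s + q s V, V))
      ((fderiv ℝ (q s) U₀).prod (ContinuousLinearMap.id ℝ Γ)) U₀ :=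
    ((Tr.c11 s hs U₀ Tr.mem).hasFDerivAt.const_add s).prodMk (hasFDerivAt_id U₀)
  have h2 : HasFDerivAt (fun z : ℝ × Γ => R z.1 z.2) (fderiv ℝ (fun z : ℝ × Γ => R z.1 z.2) (s, U₀))
      (s + q s U₀, U₀) := by
    rw [Tr.base s hs, add_zero]; exact (H.c11 s _ H.mem_cycle_base).hasFDerivAt
  have h3 := HasFDerivAt.comp (g := fun z : ℝ × Γ => R z.1 z.2)
    (f := fun V => (s + q s V, V)) U₀ h2 h1
  have h4 : fderiv ℝ (slide R q s) U₀ = _ := h3.fderiv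
  rw [h4]
  exact H.fderiv_flow_base s _ v

theorem returnMap_base (Tr : TransitSys R U₀ Δ g₀ Es Eu S ε B q)
    (H : HypCycle R U₀ Δ g₀ Es Eu) : returnMap R Δ q U₀ = U₀ := by
  rw [returnMap, H.lc.periodic, Tr.slide_base H.zero_mem, H.flow.zero]

theorem c11At_returnMap (Tr : TransitSys R U₀ Δ g₀ Es Eu S ε B q)
    (H : HypCycle R U₀ Δ g₀ Es Eu) : C11At (returnMap R Δ q) U₀ :=
  C11At.comp' (g := slide R q 0) (f := R Δ) (Tr.c11At_slide_base H H.zero_mem)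
    (c11At_flow (H.c11 _ _ H.mem_cycle_base)) H.lc.periodic

/-- Because the derivative of `q 0` is minus the coordinate along `g₀`, the first term removes the
`g₀`-component of the second. The flow direction is thus in the kernel. -/
theorem fderiv_returnMap (Tr : TransitSys R U₀ Δ g₀ Es Eu S ε B q)
    (H : HypCycle R U₀ Δ g₀ Es Eu) (v : Γ) : fderiv ℝ (returnMap R Δ q) U₀ v =
      fderiv ℝ (q 0) U₀ (flowTangent R Δ U₀ v) • g₀ + flowTangent R Δ U₀ v := by
  have h1 := H.hasFDerivAt Δ H.mem_cycle_base
  have h2 : HasFDerivAt (slide R q 0) (fderiv ℝ (slide R q 0) U₀) (R Δ U₀) := by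
    rw [H.lc.periodic]; exact (Tr.c11At_slide_base H H.zero_mem).hasFDerivAt
  have h3 : fderiv ℝ (returnMap R Δ q) U₀ = _ := (h2.comp U₀ h1).fderiv
  rw [h3, ContinuousLinearMap.comp_apply, Tr.fderiv_slide_base H H.zero_mem, H.flowTangent_zero]

end TransitSys

/-- A local diffeomorphism `χ` that straightens the stable sets of the fixed point `U₀` of `P`
relative to a basis of neighbourhoods `V r`, together with their sections by `S₀`. -/
structure StableChart (P : Γ → Γ) (U₀ : Γ) (E Es : Submodule ℝ Γ) (S₀ : Set Γ) (V : ℝ → Set Γ)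
    (χ : Γ → Γ) (A : ℝ → Set Γ) (r₀ : ℝ) : Prop where
  r_pos : 0 < r₀
  isOpen : ∀ r, IsOpen (V r)
  mem : ∀ r, 0 < r → U₀ ∈ V r
  basis : ∀ W ∈ 𝓝 U₀, ∃ r, 0 < r ∧ V r ⊆ W
  mono : ∀ r r', r ≤ r' → V r ⊆ V r'
  chart_deriv : ∀ v, fderiv ℝ χ U₀ v = v
  isOpen_A : ∀ r, 0 < r → r ≤ r₀ → IsOpen (A r)
  diffeo : ∀ r, 0 < r → r ≤ r₀ → ∀ U ∈ A r, IsDiffeoAt χ U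
  stable : ∀ r, 0 < r → r ≤ r₀ → ∀ U, U ∈ mapStableSet P univ (V r) U₀ ↔ U ∈ A r ∧ χ U ∈ E
  inter : ∀ U, χ U ∈ E ∧ U ∈ S₀ ↔ χ U ∈ Es

/-- In the coordinates `(Es × ℝ) × Eu` the derivative of the return map is block diagonal: a
contraction on `Es`, zero on the flow direction, an expansion on `Eu`. The fixed point is hyperbolic
on the full space, with stable space `Es ⊔ span {g₀}`, and `exists_stable_graph` applies without
restricting to the section. -/
theorem TransitSys.exists_stableChart [CompleteSpace Γ]
    (Tr : TransitSys R U₀ Δ g₀ Es Eu S ε B q) (H : HypCycle R U₀ Δ g₀ Es Eu) :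
    ∃ V χ A r₀, StableChart (returnMap R Δ q) U₀ (Es ⊔ Submodule.span ℝ {g₀}) Es (S 0) V χ A r₀ := by
  obtain ⟨e, he⟩ := H.exists_splitting
  have : CompleteSpace Es := H.closed_s.completeSpace_coe
  have : CompleteSpace Eu := H.closed_u.completeSpace_coe
  obtain ⟨c, hc1, hcs, hcu⟩ := H.rate
  set T := flowTangent R Δ U₀ with hT
  set P := returnMap R Δ q with hP
  have hPU : P U₀ = U₀ := Tr.returnMap_base H
  -- the splitting in coordinates
  have m_sc : ∀ w, w ∈ Es ⊔ Submodule.span ℝ {g₀} ↔ (e.symm w).2 = 0 := by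
    intro w
    obtain ⟨z, rfl⟩ := e.surjective w
    rw [e.symm_apply_apply]
    constructor
    · intro h
      obtain ⟨a, ha, b, hb, hab⟩ := Submodule.mem_sup.1 h
      obtain ⟨t, rfl⟩ := Submodule.mem_span_singleton.1 hb
      have : e ((⟨a, ha⟩, t), 0) = e z := by rw [he, ← hab]; simp
      rw [← e.injective this]
    · intro h
      rw [he, h, ZeroMemClass.coe_zero, add_zero]
      exact Submodule.add_mem_sup z.1.1.2 (Submodule.smul_mem _ _
        (Submodule.mem_span_singleton_self g₀))
  have m_su : ∀ w, w ∈ Es ⊔ Eu ↔ (e.symm w).1.2 = 0 := by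
    intro w
    obtain ⟨z, rfl⟩ := e.surjective w
    rw [e.symm_apply_apply]
    constructor
    · intro h
      obtain ⟨a, ha, b, hb, hab⟩ := Submodule.mem_sup.1 h
      have : e ((⟨a, ha⟩, 0), ⟨b, hb⟩) = e z := by rw [he, ← hab]; simp
      rw [← e.injective this]
    · intro h
      rw [he, h, zero_smul, add_zero]
      exact Submodule.add_mem_sup z.1.1.2 z.2.2
  have m_s : ∀ w, w ∈ Es ↔ (e.symm w).2 = 0 ∧ (e.symm w).1.2 = 0 := by
    intro w
    obtain ⟨z, rfl⟩ := e.surjective w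
    rw [e.symm_apply_apply]
    constructor
    · intro h
      have : e ((⟨e z, h⟩, 0), 0) = e z := by rw [he]; simp
      have := e.injective this
      rw [← this]
      exact ⟨rfl, rfl⟩
    · rintro ⟨h1, h2⟩
      rw [he, h1, h2]
      simp
  have e_u : ∀ b : Eu, e.symm (b : Γ) = (0, b) := by
    intro b
    rw [e.symm_apply_eq, he]; simp
  -- the return map in coordinates
  let f : (Es × ℝ) × Eu → (Es × ℝ) × Eu := fun z => e.symm (P (U₀ + e z) - U₀)
  have hin : C11At (fun z => U₀ + e z) (0 : (Es × ℝ) × Eu) :=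
    (C11At.const _ _).add (C11At.clm (e : ((Es × ℝ) × Eu) →L[ℝ] Γ) _)
  have hPe : C11At (fun z => P (U₀ + e z)) (0 : (Es × ℝ) × Eu) :=
    C11At.comp' (g := P) (f := fun z => U₀ + e z) (Tr.c11At_returnMap H) hin (by simp)
  have hf : C11At f 0 :=
    C11At.clm_comp (e.symm : Γ →L[ℝ] (Es × ℝ) × Eu) (hPe.sub (C11At.const U₀ _))
  have hf0 : f 0 = 0 := by simp [f, hPU]
  have hfd : ∀ z, fderiv ℝ f 0 z = e.symm (fderiv ℝ P U₀ (e z)) := by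
    intro z
    have h1 : HasFDerivAt (fun z => U₀ + e z) (e : ((Es × ℝ) × Eu) →L[ℝ] Γ) 0 :=
      e.hasFDerivAt.const_add U₀
    have h2 : HasFDerivAt P (fderiv ℝ P U₀) (U₀ + e 0) := by
      rw [map_zero, add_zero]; exact (Tr.c11At_returnMap H).hasFDerivAt
    have h3 := HasFDerivAt.comp (g := P) (f := fun z => U₀ + e z) 0 h2 h1
    have h4 := HasFDerivAt.comp (0 : (Es × ℝ) × Eu) e.symm.hasFDerivAt (h3.sub_const U₀)
    exact DFunLike.congr_fun h4.fderiv z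
  -- the linear parts
  let Ts : Es →L[ℝ] Es := (T.comp Es.subtypeL).codRestrict Es fun a => H.map_s a a.2
  let Tu : Eu →L[ℝ] Eu := (T.comp Eu.subtypeL).codRestrict Eu fun a => H.map_u a a.2
  have hTu0 : (Tu : Eu →ₗ[ℝ] Eu).ker = ⊥ := by
    refine LinearMap.ker_eq_bot'.2 fun b hb => ?_
    have h1 := hcu b b.2
    have h2 : T (b : Γ) = 0 := congrArg Subtype.val hb
    rw [h2, norm_zero, mul_zero] at h1
    exact Subtype.ext (norm_le_zero_iff.1 h1)
  have hTu1 : (Tu : Eu →ₗ[ℝ] Eu).range = ⊤ := by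
    refine LinearMap.range_eq_top.2 fun b => ?_
    obtain ⟨b', hb', h⟩ := H.surj_u b b.2
    exact ⟨⟨b', hb'⟩, Subtype.ext h⟩
  let β : Eu ≃L[ℝ] Eu := ContinuousLinearEquiv.ofBijective Tu hTu0 hTu1
  have hβ : ∀ b : Eu, ((β b : Eu) : Γ) = T b := fun _ => rfl
  let α : (Es × ℝ) →L[ℝ] (Es × ℝ) :=
    (ContinuousLinearMap.inl ℝ Es ℝ).comp (Ts.comp (ContinuousLinearMap.fst ℝ Es ℝ))
  have hTg : T g₀ = g₀ := H.flowTangent_period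
  have hd : ∀ z, fderiv ℝ f 0 z = (α z.1, β z.2) := by
    intro z
    rw [hfd, e.symm_apply_eq, he, he, hP, Tr.fderiv_returnMap H, ← hT]
    have e1 : T ((z.1.1 : Γ) + z.1.2 • g₀ + z.2) = T z.1.1 + z.1.2 • g₀ + T z.2 := by
      rw [map_add, map_add, map_smul, hTg]
    have e2 : fderiv ℝ (q 0) U₀ (T z.1.1 + z.1.2 • g₀ + T z.2) = - z.1.2 := by
      rw [map_add, map_add, map_smul, Tr.deriv_s 0 H.zero_mem _ (H.map_s _ z.1.1.2),
        Tr.deriv_u 0 H.zero_mem _ (H.map_u _ z.2.2), Tr.deriv_c 0 H.zero_mem]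
      simp
    rw [e1, e2, hβ]
    have e3 : (((α z.1).1 : Es) : Γ) = T z.1.1 := rfl
    have e4 : (α z.1).2 = 0 := rfl
    rw [e3, e4]
    simp only [neg_smul, zero_smul, add_zero]
    abel
  -- The rate `c` is only known to be less than `1`; it could be negative when both spaces are
  -- trivial.
  have hα : ‖α‖ ≤ max c 0 := by
    refine ContinuousLinearMap.opNorm_le_bound _ (le_max_right _ _) fun z => ?_
    have h1 : ‖α z‖ = ‖T z.1‖ := by
      have : α z = (Ts z.1, 0) := rfl
      rw [this, Prod.norm_mk, norm_zero, max_eq_left (norm_nonneg _)]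
      rfl
    rw [h1]
    refine (hcs _ z.1.2).trans ?_
    exact mul_le_mul (le_max_left _ _) (norm_fst_le z) (norm_nonneg _) (le_max_right _ _)
  have hβs : ‖(β.symm : Eu →L[ℝ] Eu)‖ ≤ max c 0 := by
    refine ContinuousLinearMap.opNorm_le_bound _ (le_max_right _ _) fun b => ?_
    have h1 := hcu (β.symm b) (β.symm b).2
    rw [← hβ, β.apply_symm_apply] at h1
    exact h1.trans (mul_le_mul_of_nonneg_right (le_max_left _ _) (norm_nonneg _))
  obtain ⟨r₀, hr₀, h, hh0, hhd, hst⟩ := exists_stable_graph hf hf0 hd (max_lt hc1 one_pos) hα hβs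
  choose! O hOo hO0 hOh hOst using hst
  -- the chart
  let x : Γ → (Es × ℝ) × Eu := fun U => e.symm (U - U₀)
  have hx0 : x U₀ = 0 := by simp [x]
  have hxc : Continuous x := by
    exact e.symm.continuous.comp (continuous_id.sub continuous_const)
  have hx11 : ∀ U, C11At (fun U => (x U).1) U := fun U =>
    C11At.clm_comp ((ContinuousLinearMap.fst ℝ (Es × ℝ) Eu).comp
      (e.symm : Γ →L[ℝ] (Es × ℝ) × Eu)) ((C11At.id U).sub (C11At.const U₀ _))
  let χ : Γ → Γ := fun U => (U - U₀) - (h (x U).1 : Γ)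
  let χ' : Γ → Γ := fun y => y + (h (e.symm y).1 : Γ) + U₀
  have hχx : ∀ U, e.symm (χ U) = ((x U).1, (x U).2 - h (x U).1) := by
    intro U
    change e.symm ((U - U₀) - (h (x U).1 : Γ)) = _
    rw [map_sub, e_u]
    exact Prod.ext (sub_zero _) rfl
  have hdiff : ∀ U, C11At h (x U).1 → IsDiffeoAt χ U := by
    intro U hU
    refine ⟨?_, χ', ?_, Eventually.of_forall fun y => ?_, Eventually.of_forall fun y => ?_⟩
    · exact ((C11At.id U).sub (C11At.const U₀ _)).sub
        (C11At.clm_comp Eu.subtypeL (C11At.comp (g := h) hU (hx11 U)))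
    · refine ((C11At.id _).add (C11At.clm_comp Eu.subtypeL ?_)).add (C11At.const U₀ _)
      refine C11At.comp (g := h) (f := fun y => (e.symm y).1) ?_
        (C11At.clm ((ContinuousLinearMap.fst ℝ (Es × ℝ) Eu).comp
          (e.symm : Γ →L[ℝ] (Es × ℝ) × Eu)) _)
      simp only [hχx]
      exact hU
    · simp only [χ', hχx]
      simp [χ]
    · have h1 : x (χ' y) = e.symm y + (0, h (e.symm y).1) := by
        simp only [x, χ', add_sub_cancel_right, map_add, e_u]
      simp only [χ, h1]
      simp [χ']
  refine ⟨fun r => x ⁻¹' Metric.ball 0 r, χ, fun r => {U | (x U).1 ∈ O r}, r₀, hr₀,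
    fun r => Metric.isOpen_ball.preimage hxc, fun r hr => ?_, fun W hW => ?_,
    fun r r' hr => preimage_mono (Metric.ball_subset_ball hr), fun v => ?_,
    fun r hr hrr => (hOo r hr hrr).preimage (continuous_fst.comp hxc),
    fun r hr hrr U hU => hdiff U (hOh r hr hrr _ hU), fun r hr hrr U => ?_, fun U => ?_⟩
  · rw [mem_preimage, hx0]; exact Metric.mem_ball_self hr
  · have h1 : ContinuousAt (fun z => U₀ + e z) 0 := hin.continuousAt
    have h2 : (fun z => U₀ + e z) ⁻¹' W ∈ 𝓝 (0 : (Es × ℝ) × Eu) := h1 (by simpa using hW)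
    obtain ⟨r, hr, hb⟩ := Metric.mem_nhds_iff.1 h2
    refine ⟨r, hr, fun U hU => ?_⟩
    have := hb hU
    simpa [x] using this
  · have h1 : HasFDerivAt (fun U => (x U).1) ((ContinuousLinearMap.fst ℝ (Es × ℝ) Eu).comp
      (e.symm : Γ →L[ℝ] (Es × ℝ) × Eu)) U₀ :=
      (ContinuousLinearMap.fst ℝ (Es × ℝ) Eu).hasFDerivAt.comp U₀
        (HasFDerivAt.comp (g := e.symm) U₀ e.symm.hasFDerivAt ((hasFDerivAt_id U₀).sub_const U₀))
    have h2 : HasFDerivAt h (0 : (Es × ℝ) →L[ℝ] Eu) (x U₀).1 := by rw [hx0]; exact hhd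
    have h3 : HasFDerivAt (fun U => h (x U).1) (0 : Γ →L[ℝ] Eu) U₀ := by
      have := HasFDerivAt.comp (g := h) (f := fun U => (x U).1) U₀ h2 h1
      rwa [ContinuousLinearMap.zero_comp] at this
    have h4 : HasFDerivAt χ (ContinuousLinearMap.id ℝ Γ - Eu.subtypeL.comp (0 : Γ →L[ℝ] Eu)) U₀ :=
      ((hasFDerivAt_id U₀).sub_const U₀).sub (Eu.subtypeL.hasFDerivAt.comp U₀ h3)
    rw [h4.fderiv]
    simp
  · have hsemi : ∀ n, x (P^[n] U) = f^[n] (x U) := by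
      have hs : Function.Semiconj x P f := fun U => by simp [f, x]
      exact fun n => hs.iterate_right n U
    have h1 := hOst r hr hrr (x U)
    simp only [mem_ofPred_eq]
    rw [m_sc, hχx]
    simp only [sub_eq_zero]
    rw [← h1]
    simp only [mapStableSet, mem_ofPred_eq, mem_univ, true_and, mem_preimage, hsemi]
    refine and_congr_right fun _ => ?_
    have hx_eq : ∀ n, P^[n] U = U₀ + e (f^[n] (x U)) := fun n => by
      rw [← hsemi]; simp [x]
    constructor
    · intro ht
      have h2 := (hxc.tendsto U₀).comp ht
      rw [hx0] at h2
      exact h2.congr hsemi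
    · intro ht
      have h2 := hin.continuousAt.tendsto.comp ht
      simp only [map_zero, add_zero] at h2
      exact h2.congr fun n => (hx_eq n).symm
  · rw [m_sc, m_s, hχx, Tr.mem_zero, m_su]

end StableChart

end RG

namespace RG

section Dynamics

variable {Γ : Type*} [NormedAddCommGroup Γ] [NormedSpace ℝ Γ]
  {R : ℝ → Γ → Γ} {U₀ : Γ} {Δ : ℝ} {g₀ : Γ} {Es Eu : Submodule ℝ Γ}
  {S : ℝ → Set Γ} {ε : ℝ} {B : Set Γ} {q : ℝ → Γ → ℝ}

/-! ### Orbits near the cycle and iterates of the return map -/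

namespace HypCycle

theorem cycle_nonempty (H : HypCycle R U₀ Δ g₀ Es Eu) : (cycle R U₀).Nonempty :=
  ⟨U₀, H.mem_cycle_base⟩

theorem mem_thickening_iff (H : HypCycle R U₀ Δ g₀ Es Eu) {δ : ℝ} {U : Γ} :
    U ∈ Metric.thickening δ (cycle R U₀) ↔ Metric.infDist U (cycle R U₀) < δ :=
  Metric.mem_thickening_iff_infDist_lt H.cycle_nonempty

theorem eventually_near_orbit (H : HypCycle R U₀ Δ g₀ Es Eu) {δ : ℝ} (hδ : 0 < δ) (a b : ℝ) :
    ∀ᶠ V in 𝓝 U₀, ∀ t ∈ Icc a b, R t V ∈ Metric.thickening δ (cycle R U₀) := by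
  refine isCompact_Icc.eventually_forall_of_forall_eventually
    (P := fun V t => R t V ∈ Metric.thickening δ (cycle R U₀)) fun t _ => ?_
  have h1 : ContinuousAt (fun z : Γ × ℝ => R z.2 z.1) (U₀, t) :=
    ContinuousAt.comp (g := fun z : ℝ × Γ => R z.1 z.2) (f := fun z : Γ × ℝ => (z.2, z.1))
      (H.continuousAt t H.mem_cycle_base) (by fun_prop)
  exact h1 (Metric.isOpen_thickening.mem_nhds
    (Metric.self_subset_thickening hδ _ (H.mem_cycle t)))

/-- Every forward orbit that converges to the cycle visits each neighbourhood of `U₀` at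
arbitrarily late times. -/
theorem exists_visit (H : HypCycle R U₀ Δ g₀ Es Eu) {U : Γ} (hU : U ∈ stableSet R (cycle R U₀))
    {W : Set Γ} (hW : W ∈ 𝓝 U₀) (t₀ : ℝ) : ∃ t, t₀ ≤ t ∧ R t U ∈ W := by
  -- A point close to the cycle at phase `σ` reaches `U₀` approximately after the remaining time `Δ
  -- - σ`; compactness makes the required closeness independent of the phase.
  have hev : ∀ᶠ z in 𝓝 (0 : ℝ), ∀ σ ∈ Icc 0 Δ, ∀ V, dist V (R σ U₀) ≤ z → R (Δ - σ) V ∈ W := by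
    refine isCompact_Icc.eventually_forall_of_forall_eventually
      (P := fun z σ => ∀ V, dist V (R σ U₀) ≤ z → R (Δ - σ) V ∈ W) fun σ _ => ?_
    have h1 : ContinuousAt (fun z : ℝ × Γ => R z.1 z.2) (Δ - σ, R σ U₀) :=
      H.continuousAt _ (H.mem_cycle σ)
    have h2 : R (Δ - σ) (R σ U₀) = U₀ := by rw [← H.flow.add, sub_add_cancel, H.lc.periodic]
    have h3 : (fun z : ℝ × Γ => R z.1 z.2) ⁻¹' W ∈ 𝓝 (Δ - σ, R σ U₀) := by
      refine h1 ?_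
      simpa only [h2] using hW
    obtain ⟨ρ, hρ, hball⟩ := Metric.mem_nhds_iff.1 h3
    have h4 : ∀ᶠ w : ℝ × ℝ in 𝓝 (0, σ), w.1 + dist (R w.2 U₀) (R σ U₀) < ρ := by
      have : ContinuousAt (fun w : ℝ × ℝ => w.1 + dist (R w.2 U₀) (R σ U₀)) (0, σ) :=
        continuousAt_fst.add ((H.continuous_orbit.comp continuous_snd).dist
          continuous_const).continuousAt
      exact this.eventually (gt_mem_nhds (by simpa using hρ))
    have h5 : ∀ᶠ w : ℝ × ℝ in 𝓝 (0, σ), dist w.2 σ < ρ := by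
      have : ContinuousAt (fun w : ℝ × ℝ => dist w.2 σ) (0, σ) := by fun_prop
      exact this.eventually (gt_mem_nhds (by simpa using hρ))
    filter_upwards [h4, h5] with w i1 i2 V hV
    refine @hball (Δ - w.2, V) ?_
    rw [← ball_prod_same]
    refine ⟨?_, ?_⟩
    · rw [Metric.mem_ball, Real.dist_eq]
      rw [Real.dist_eq] at i2
      rwa [sub_sub_sub_cancel_left, abs_sub_comm]
    · exact (dist_triangle _ _ _).trans_lt (by linarith)
  obtain ⟨ρ, hρ, hball⟩ := Metric.eventually_nhds_iff_ball.1 hev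
  have h1 : ∀ᶠ t in atTop, Metric.infDist (R t U) (cycle R U₀) < ρ / 2 :=
    hU.eventually (gt_mem_nhds (by positivity))
  obtain ⟨t, ht, htt⟩ := (h1.and (eventually_ge_atTop t₀)).exists
  obtain ⟨y, hy, hd⟩ := (Metric.infDist_lt_iff H.cycle_nonempty).1 ht
  have him := (H.lc.periodic_orbit H.flow).image_Icc H.lc.pos 0
  have hy' : y ∈ (fun t => R t U₀) '' Icc 0 (0 + Δ) := by rw [him]; exact hy
  obtain ⟨σ, hσ, rfl⟩ := hy'
  rw [zero_add] at hσ
  refine ⟨Δ - σ + t, by linarith [hσ.2], ?_⟩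
  rw [H.flow.add]
  exact hball (ρ / 2) (by rw [Metric.mem_ball, Real.dist_eq, sub_zero, abs_of_pos] <;> linarith)
    σ hσ _ hd.le

theorem stableSet_flow (H : HypCycle R U₀ Δ g₀ Es Eu) {U : Γ} (t : ℝ)
    (hU : U ∈ stableSet R (cycle R U₀)) : R t U ∈ stableSet R (cycle R U₀) := by
  have h1 : Tendsto (fun s : ℝ => s + t) atTop atTop := tendsto_atTop_add_const_right _ _ tendsto_id
  refine (Tendsto.comp hU h1).congr fun s => ?_
  simp only [Function.comp_apply, H.flow.add]

/-- One tube works for all times: a long orbit segment in the tube is cut into equal steps of length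
at most `Δ`, and regularity is composed step by step. Only the points reached after each step have
to be in the tube. -/
theorem exists_c11_tube (H : HypCycle R U₀ Δ g₀ Es Eu) : ∃ δ, 0 < δ ∧ ∀ x t,
    (∀ τ ∈ uIcc 0 t, R τ x ∈ Metric.thickening δ (cycle R U₀)) →
      C11At (fun z : ℝ × Γ => R z.1 z.2) (t, x) := by
  have h1 : ∀ᶠ x in 𝓝ˢ (cycle R U₀), ∀ t ∈ Icc (-Δ) Δ,
      C11At (fun z : ℝ × Γ => R z.1 z.2) (t, x) := by
    refine eventually_nhdsSet_iff_forall.2 fun x hx => ?_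
    refine isCompact_Icc.eventually_forall_of_forall_eventually
      (P := fun x t => C11At (fun z : ℝ × Γ => R z.1 z.2) (t, x)) fun t _ => ?_
    have : ContinuousAt (fun z : Γ × ℝ => (z.2, z.1)) (x, t) := by fun_prop
    exact this.eventually (H.c11 t x hx).eventually
  obtain ⟨O, hO, hCO, hOh⟩ := eventually_nhdsSet_iff_exists.1 h1
  obtain ⟨δ, hδ, hδO⟩ := H.isCompact_cycle.exists_thickening_subset_open hO hCO
  refine ⟨δ, hδ, fun x t hx => ?_⟩
  obtain ⟨m, hm⟩ := exists_nat_gt (|t| / Δ)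
  have hm0 : (0 : ℝ) < m := lt_of_le_of_lt (by have := H.lc.pos; positivity) hm
  have hmt : t / m ∈ Icc (-Δ) Δ := by
    rw [div_lt_iff₀ H.lc.pos] at hm
    rw [mem_Icc, ← abs_le, abs_div, abs_of_pos hm0, div_le_iff₀ hm0]
    linarith
  set h := t / m with hh
  have key : ∀ j : ℕ, ∀ x, (∀ i ≤ j, R (i * h) x ∈ Metric.thickening δ (cycle R U₀)) →
      C11At (fun z : ℝ × Γ => R z.1 z.2) (j * h, x) := by
    intro j
    induction j with
    | zero =>
      intro x hx
      have := hx 0 le_rfl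
      rw [Nat.cast_zero, zero_mul, H.flow.zero] at this
      rw [Nat.cast_zero, zero_mul]
      exact hOh x (hδO this) 0 ⟨by linarith [H.lc.pos], H.lc.pos.le⟩
    | succ j ih =>
      intro x hx
      have hx0 := hx 0 (by omega)
      rw [Nat.cast_zero, zero_mul, H.flow.zero] at hx0
      have h2 := ih (R h x) fun i hi => by
        have := hx (i + 1) (by omega)
        rw [← H.flow.add]
        convert this using 2
        push_cast; ring
      have h3 : C11At (R h) x := c11At_flow (hOh x (hδO hx0) h hmt)
      have h4 : C11At (fun z : ℝ × Γ => R (z.1 - h) (R h z.2)) ((j + 1 : ℕ) * h, x) := by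
        refine C11At.comp' (g := fun z : ℝ × Γ => R z.1 z.2)
          (f := fun z : ℝ × Γ => (z.1 - h, R h z.2)) h2
          ((C11At.fst.sub (C11At.const _ _)).prodMk (C11At.comp (g := R h) h3 C11At.snd)) ?_
        push_cast
        rw [add_one_mul, add_sub_cancel_right]
      refine h4.congr (Eventually.of_forall fun z => ?_)
      simp only [← H.flow.add, sub_add_cancel]
  have hmh : (m : ℝ) * h = t := by rw [hh]; field_simp
  rw [← hmh]
  refine key m x fun i hi => hx _ ?_
  have hi' : (i : ℝ) ≤ m := by exact_mod_cast hi
  have e : (i : ℝ) * h = (i / m) * t := by rw [hh]; field_simp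
  have h5 : (i : ℝ) / m ≤ 1 := (div_le_one hm0).2 hi'
  have h6 : 0 ≤ (i : ℝ) / m := by positivity
  rw [e]
  rcases le_total 0 t with ht | ht
  · rw [uIcc_of_le ht]; exact ⟨by positivity, by nlinarith⟩
  · rw [uIcc_of_ge ht]; exact ⟨by nlinarith, mul_nonpos_of_nonneg_of_nonpos h6 ht⟩

theorem isDiffeoAt_flow (H : HypCycle R U₀ Δ g₀ Es Eu) {t : ℝ} {x : Γ}
    (h1 : C11At (fun z : ℝ × Γ => R z.1 z.2) (t, x))
    (h2 : C11At (fun z : ℝ × Γ => R z.1 z.2) (-t, R t x)) : IsDiffeoAt (R t) x :=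
  ⟨c11At_flow h1, R (-t), c11At_flow h2, Eventually.of_forall fun y => H.flow.neg_apply t y,
    Eventually.of_forall fun y => H.flow.apply_neg t y⟩

/-- Near an orbit segment in a thin tube, the local stable set is invariant under the flow. -/
theorem localStableSet_germ (H : HypCycle R U₀ Δ g₀ Es Eu) {δ₀ δ : ℝ} (hδ : δ ≤ δ₀)
    (htube : ∀ x t, (∀ τ ∈ uIcc 0 t, R τ x ∈ Metric.thickening δ₀ (cycle R U₀)) →
      C11At (fun z : ℝ × Γ => R z.1 z.2) (t, x)) {x : Γ} {t : ℝ}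
    (hx : ∀ τ ∈ uIcc 0 t, R τ x ∈ Metric.thickening δ (cycle R U₀)) :
    IsDiffeoAt (R t) x ∧ ∀ᶠ y in 𝓝 x,
      y ∈ localStableSet R (cycle R U₀) (Metric.thickening δ (cycle R U₀)) ↔
      R t y ∈ localStableSet R (cycle R U₀) (Metric.thickening δ (cycle R U₀)) := by
  have hx' : ∀ τ ∈ uIcc 0 t, R τ x ∈ Metric.thickening δ₀ (cycle R U₀) := fun τ hτ =>
    Metric.thickening_mono hδ _ (hx τ hτ)
  have hc : ∀ τ ∈ uIcc 0 t, C11At (fun z : ℝ × Γ => R z.1 z.2) (τ, x) := fun τ hτ =>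
    htube x τ fun σ hσ => hx' σ (uIcc_subset_uIcc left_mem_uIcc hτ hσ)
  refine ⟨H.isDiffeoAt_flow (htube x t hx') (htube _ _ fun τ hτ => ?_), ?_⟩
  · rw [← H.flow.add]
    refine hx' _ ?_
    rcases le_total 0 t with ht | ht
    · rw [uIcc_of_ge (by linarith)] at hτ
      rw [uIcc_of_le ht]
      exact ⟨by linarith [hτ.1], by linarith [hτ.2]⟩
    · rw [uIcc_of_le (by linarith)] at hτ
      rw [uIcc_of_ge ht]
      exact ⟨by linarith [hτ.1], by linarith [hτ.2]⟩
  · have hev : ∀ᶠ y in 𝓝 x, ∀ τ ∈ uIcc 0 t, R τ y ∈ Metric.thickening δ (cycle R U₀) := by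
      refine isCompact_uIcc.eventually_forall_of_forall_eventually
        (P := fun y τ => R τ y ∈ Metric.thickening δ (cycle R U₀)) fun τ hτ => ?_
      have h1 : ContinuousAt (fun z : Γ × ℝ => R z.2 z.1) (x, τ) :=
        ContinuousAt.comp (g := fun z : ℝ × Γ => R z.1 z.2) (f := fun z : Γ × ℝ => (z.2, z.1))
          (hc τ hτ).continuousAt (by fun_prop)
      exact h1 (Metric.isOpen_thickening.mem_nhds (hx τ hτ))
    filter_upwards [hev] with y hy
    constructor
    · rintro ⟨h1, h2⟩
      refine ⟨H.stableSet_flow t h1, fun s hs => ?_⟩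
      rw [← H.flow.add]
      rcases le_total 0 (s + t) with h | h
      · exact h2 _ h
      · exact hy _ (by rw [uIcc_of_ge (by linarith)]; exact ⟨by linarith, h⟩)
    · rintro ⟨h1, h2⟩
      refine ⟨?_, fun s hs => ?_⟩
      · have := H.stableSet_flow (-t) h1
        rwa [H.flow.neg_apply] at this
      · rcases le_total t s with h | h
        · have := h2 (s - t) (by linarith)
          rwa [← H.flow.add, sub_add_cancel] at this
        · exact hy _ (by rw [uIcc_of_le (hs.trans h)]; exact ⟨hs, h⟩)

end HypCycle

/-- Gaps of at least `a` send the visit times to infinity, and gaps of at most `b` leave no later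
time `T` farther than `b` after a visit. This transfers control at the return times to the whole
orbit. -/
theorem exists_index {t : ℕ → ℝ} {a b : ℝ} (ha : 0 < a)
    (ht : ∀ n, t n + a ≤ t (n + 1) ∧ t (n + 1) ≤ t n + b) {n₀ : ℕ} {T : ℝ} (hT : t n₀ ≤ T) :
    ∃ n, n₀ ≤ n ∧ t n ≤ T ∧ T ≤ t n + b := by
  have hlin : ∀ n : ℕ, t 0 + n * a ≤ t n := by
    intro n
    induction n with
    | zero => simp
    | succ n ih => push_cast; linarith [(ht n).1]
  have hex : ∃ m, n₀ ≤ m ∧ T < t (m + 1) := by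
    obtain ⟨k, hk⟩ := exists_nat_gt ((T - t 0) / a)
    rw [div_lt_iff₀ ha] at hk
    refine ⟨max n₀ k, le_max_left _ _, ?_⟩
    have h1 := hlin (max n₀ k + 1)
    have h2 : (k : ℝ) ≤ max (n₀ : ℝ) k := le_max_right _ _
    have h3 := mul_le_mul_of_nonneg_right h2 ha.le
    push_cast at h1
    linarith
  classical
  have hm := Nat.find_spec hex
  refine ⟨Nat.find hex, hm.1, ?_, hm.2.le.trans (ht _).2⟩
  rcases hm.1.eq_or_lt with h | h
  · rwa [← h]
  · have := Nat.find_min hex (m := Nat.find hex - 1) (by omega)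
    push Not at this
    have := this (by omega)
    rwa [show Nat.find hex - 1 + 1 = Nat.find hex by omega] at this

namespace TransitSys

variable (Tr : TransitSys R U₀ Δ g₀ Es Eu S ε B q) (H : HypCycle R U₀ Δ g₀ Es Eu)

include Tr H

theorem returnMap_mem {V : Γ} (hV : R Δ V ∈ B) : returnMap R Δ q V ∈ S 0 := by
  have := Tr.sec 0 H.zero_mem _ hV
  exact this

theorem returnMap_eq {V : Γ} (hV : R Δ V ∈ B) :
    ∃ t, Δ / 2 ≤ t ∧ t ≤ 2 * Δ ∧ returnMap R Δ q V = R t V := by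
  have h1 := abs_lt.1 (Tr.lt 0 H.zero_mem _ hV)
  have h2 := Tr.eps_le
  have h3 := H.lc.pos
  refine ⟨q 0 (R Δ V) + Δ, by linarith, by linarith, ?_⟩
  rw [returnMap, slide, zero_add, H.flow.add]

theorem exists_times {z : Γ} (hz : ∀ n, R Δ ((returnMap R Δ q)^[n] z) ∈ B) :
    ∃ t : ℕ → ℝ, t 0 = 0 ∧ (∀ n, (returnMap R Δ q)^[n] z = R (t n) z) ∧
      ∀ n, t n + Δ / 2 ≤ t (n + 1) ∧ t (n + 1) ≤ t n + 2 * Δ := by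
  choose a ha1 ha2 ha3 using fun n => Tr.returnMap_eq H (hz n)
  refine ⟨fun n => ∑ k ∈ Finset.range n, a k, by simp, fun n => ?_, fun n => ?_⟩
  · induction n with
    | zero => simp [H.flow.zero]
    | succ n ih =>
      have ih' : (returnMap R Δ q)^[n] z = R (∑ k ∈ Finset.range n, a k) z := ih
      change _ = R (∑ k ∈ Finset.range (n + 1), a k) z
      rw [Function.iterate_succ_apply', ha3, Finset.sum_range_succ, add_comm, H.flow.add, ← ih']
  · simp only [Finset.sum_range_succ]
    exact ⟨by linarith [ha1 n], by linarith [ha2 n]⟩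

theorem eventually_mem : ∀ᶠ V in 𝓝 U₀, R Δ V ∈ B := by
  have h1 := (H.hasFDerivAt Δ H.mem_cycle_base).continuousAt
  refine h1 ?_
  rw [H.lc.periodic]
  exact Tr.isOpen.mem_nhds Tr.mem

/-- Points whose iterates under the return map converge to `U₀` while staying close to it belong to
the local stable set of the cycle. -/
theorem exists_nhds_subset_localStableSet {δ : ℝ} (hδ : 0 < δ) : ∃ W ∈ 𝓝 U₀, ∀ z,
    z ∈ mapStableSet (returnMap R Δ q) univ W U₀ →
      z ∈ localStableSet R (cycle R U₀) (Metric.thickening δ (cycle R U₀)) := by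
  -- Since `2 * Δ` bounds the return times, control over `[0, 2 * Δ]` from each iterate covers the
  -- orbit between visits.
  refine ⟨_, (Tr.eventually_mem H).and (H.eventually_near_orbit hδ 0 (2 * Δ)), ?_⟩
  rintro z ⟨-, h1, h2⟩
  obtain ⟨t, ht0, htz, hts⟩ := Tr.exists_times H fun n => (h1 n).1
  have hΔ := H.lc.pos
  have key : ∀ η : ℝ, ∀ n₀ : ℕ, (∀ n ≥ n₀, ∀ s ∈ Icc 0 (2 * Δ),
      R s ((returnMap R Δ q)^[n] z) ∈ Metric.thickening η (cycle R U₀)) →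
      ∀ T, t n₀ ≤ T → R T z ∈ Metric.thickening η (cycle R U₀) := by
    intro η n₀ hn T hT
    obtain ⟨n, hnn, i1, i2⟩ := exists_index (by positivity) hts hT
    have := hn n hnn (T - t n) ⟨by linarith, by linarith⟩
    rwa [htz, ← H.flow.add, sub_add_cancel] at this
  refine ⟨?_, fun T hT => key δ 0 (fun n _ s hs => (h1 n).2 s hs) T (by rwa [ht0])⟩
  change Tendsto _ _ _
  rw [Metric.tendsto_atTop]
  intro η hη
  obtain ⟨n₀, hn₀⟩ := eventually_atTop.1
    (h2.eventually (H.eventually_near_orbit hη 0 (2 * Δ)))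
  refine ⟨t n₀, fun T hT => ?_⟩
  have := H.mem_thickening_iff.1 (key η n₀ hn₀ T hT)
  rwa [Real.dist_eq, sub_zero, abs_of_nonneg Metric.infDist_nonneg]

/-- Points of the section close to `U₀` that are close to the cycle are close to `U₀`. -/
theorem exists_section_near : ∃ ρ, 0 < ρ ∧ ∀ W ∈ 𝓝 U₀, ∃ δ, 0 < δ ∧ ∀ U ∈ S 0,
    U ∈ Metric.ball U₀ ρ → U ∈ Metric.thickening δ (cycle R U₀) → U ∈ W := by
  have hΔ := H.lc.pos
  have hε := Tr.eps_pos
  have hεΔ := Tr.eps_le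
  have hKc : IsCompact ((fun t => R t U₀) '' Icc ε (Δ - ε)) :=
    isCompact_Icc.image H.continuous_orbit
  have hUK : U₀ ∉ (fun t => R t U₀) '' Icc ε (Δ - ε) := by
    rintro ⟨t, ht, h⟩
    exact H.lc.fundamental t (by linarith [ht.1]) (by linarith [ht.2]) h
  obtain ⟨ρ₁, hρ₁, hball⟩ := Metric.mem_nhds_iff.1 (hKc.isClosed.isOpen_compl.mem_nhds hUK)
  -- Phases within `ε` of `0` or `Δ` are settled by uniqueness of the transit time. The phases in
  -- between form a compact arc that avoids `U₀`, because `Δ` is the fundamental period, and so it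
  -- avoids a ball.
  have honly : ∀ y ∈ cycle R U₀, y ∈ Metric.closedBall U₀ (ρ₁ / 2) → y ∈ S 0 → y = U₀ := by
    intro y hy hyb hyS
    have him := (H.lc.periodic_orbit H.flow).image_Icc hΔ 0
    have hy' : y ∈ (fun t => R t U₀) '' Icc 0 (0 + Δ) := by rw [him]; exact hy
    obtain ⟨σ, hσ, rfl⟩ := hy'
    simp only at hyS hyb ⊢
    rw [zero_add] at hσ
    have huniq : ∀ a, |a| < 2 * ε → R a U₀ ∈ S 0 → a = 0 := by
      intro a ha h
      have := Tr.uniq 0 H.zero_mem U₀ Tr.mem a ha (by rwa [zero_add])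
      rw [this, Tr.base 0 H.zero_mem]
    rcases lt_or_ge σ ε with h | h
    · rw [huniq σ (by rw [abs_of_nonneg hσ.1]; linarith) hyS, H.flow.zero]
    · rcases le_or_gt σ (Δ - ε) with h' | h'
      · exfalso
        exact hball (Metric.closedBall_subset_ball (by linarith) hyb) ⟨σ, ⟨h, h'⟩, rfl⟩
      · have e : R (σ - Δ) U₀ = R σ U₀ := by
          have := H.lc.periodic_orbit H.flow (σ - Δ)
          simp only [sub_add_cancel] at this
          exact this.symm
        have := huniq (σ - Δ) (by rw [abs_lt]; constructor <;> linarith [hσ.2]) (by rwa [e])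
        rw [← e, this, H.flow.zero]
  refine ⟨ρ₁ / 2, by positivity, fun W hW => ?_⟩
  obtain ⟨η, hη, hηW⟩ := Metric.mem_nhds_iff.1 hW
  have hK' : IsCompact (cycle R U₀ \ Metric.ball U₀ (η / 2)) :=
    H.isCompact_cycle.diff Metric.isOpen_ball
  have hcl : IsClosed (S 0 ∩ Metric.closedBall U₀ (ρ₁ / 2)) :=
    Tr.isClosed.inter Metric.isClosed_closedBall
  -- A compact piece of the cycle and a closed piece of the section that are disjoint have disjoint
  -- thickenings; this replaces local compactness, which is unavailable here.
  have hdisj : Disjoint (cycle R U₀ \ Metric.ball U₀ (η / 2))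
      (S 0 ∩ Metric.closedBall U₀ (ρ₁ / 2)) := by
    rw [Set.disjoint_left]
    rintro y ⟨hy, hyb⟩ ⟨hyS, hyc⟩
    rw [honly y hy hyc hyS] at hyb
    exact hyb (Metric.mem_ball_self (by positivity))
  obtain ⟨δ, hδ, hd⟩ := hdisj.exists_thickenings hK' hcl
  refine ⟨min δ (η / 2), by positivity, fun U hUS hUb hUt => hηW ?_⟩
  obtain ⟨y, hy, hyd⟩ := Metric.mem_thickening_iff.1 hUt
  by_cases hyb : y ∈ Metric.ball U₀ (η / 2)
  · have h1 := hyd.trans_le (min_le_right _ _)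
    rw [Metric.mem_ball] at hyb ⊢
    linarith [dist_triangle U y U₀]
  · exfalso
    refine Set.disjoint_left.1 hd (Metric.mem_thickening_iff.2
      ⟨y, ⟨hy, hyb⟩, hyd.trans_le (min_le_left _ _)⟩)
      (Metric.self_subset_thickening hδ _ ⟨hUS, Metric.ball_subset_closedBall hUb⟩)

/-- Forward orbits that converge to the cycle and stay close to it have convergent iterates under
the return map. -/
theorem exists_localStableSet_subset {W : Set Γ} (hW : W ∈ 𝓝 U₀) : ∃ δ, 0 < δ ∧ ∃ W' ∈ 𝓝 U₀,
    ∀ z ∈ W', z ∈ localStableSet R (cycle R U₀) (Metric.thickening δ (cycle R U₀)) →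
      z ∈ mapStableSet (returnMap R Δ q) univ W U₀ := by
  obtain ⟨ρ, hρ, hnear⟩ := Tr.exists_section_near H
  have hP : ∀ᶠ V in 𝓝 U₀, returnMap R Δ q V ∈ Metric.ball U₀ ρ := by
    refine (Tr.c11At_returnMap H).continuousAt ?_
    rw [Tr.returnMap_base H]
    exact Metric.ball_mem_nhds _ hρ
  have hA := ((Tr.eventually_mem H).and hP).and hW
  obtain ⟨δ, hδ, hδA⟩ := hnear _ hA
  refine ⟨δ, hδ, _, hA, ?_⟩
  rintro z hz ⟨hzs, hzt⟩
  have hΔ := H.lc.pos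
  -- The induction closes because each new iterate is in the section and the prescribed ball, and as
  -- a point of the forward orbit it is close to the cycle. By `hnear` these facts put it back into
  -- the good neighbourhood.
  have hind : ∀ n, (∃ t, 0 ≤ t ∧ (returnMap R Δ q)^[n] z = R t z) ∧
      ((R Δ ((returnMap R Δ q)^[n] z) ∈ B ∧
      returnMap R Δ q ((returnMap R Δ q)^[n] z) ∈ Metric.ball U₀ ρ) ∧
      (returnMap R Δ q)^[n] z ∈ W) := by
    intro n
    induction n with
    | zero => exact ⟨⟨0, le_rfl, by simp [H.flow.zero]⟩, hz⟩
    | succ n ih =>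
      obtain ⟨⟨t, ht, e⟩, ⟨h1, h2⟩, h3⟩ := ih
      obtain ⟨t', ht', -, e'⟩ := Tr.returnMap_eq H h1
      have e2 : (returnMap R Δ q)^[n + 1] z = R (t' + t) z := by
        rw [Function.iterate_succ_apply', e', e, ← H.flow.add]
      refine ⟨⟨t' + t, by linarith, e2⟩, ?_⟩
      refine hδA _ ?_ ?_ ?_
      · rw [Function.iterate_succ_apply']; exact Tr.returnMap_mem H h1
      · rw [Function.iterate_succ_apply']; exact h2
      · rw [e2]; exact hzt _ (by linarith)
  refine ⟨mem_univ _, fun n => (hind n).2.2, ?_⟩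
  obtain ⟨t, ht0, htz, hts⟩ := Tr.exists_times H fun n => (hind n).2.1.1
  have htop : Tendsto t atTop atTop := by
    have hlin : ∀ n : ℕ, (n : ℝ) * (Δ / 2) ≤ t n := by
      intro n
      induction n with
      | zero => simp [ht0]
      | succ n ih => push_cast; linarith [(hts n).1]
    exact tendsto_atTop_mono hlin
      (tendsto_natCast_atTop_atTop.atTop_mul_const (by positivity))
  intro W₂ hW₂
  obtain ⟨δ₂, hδ₂, hδW⟩ := hnear W₂ hW₂
  change ∀ᶠ n in atTop, (returnMap R Δ q)^[n] z ∈ W₂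
  have h1 : ∀ᶠ n in atTop, R (t n) z ∈ Metric.thickening δ₂ (cycle R U₀) := by
    have := (Tendsto.comp hzs htop).eventually (gt_mem_nhds hδ₂)
    filter_upwards [this] with n hn
    exact H.mem_thickening_iff.2 hn
  filter_upwards [h1, eventually_ge_atTop 1] with n hn hn1
  -- The initial point need not lie in the section; its iterates do from index `1` on.
  obtain ⟨m, rfl⟩ : ∃ m, n = m + 1 := ⟨n - 1, by omega⟩
  refine hδW _ ?_ ?_ ?_
  · rw [Function.iterate_succ_apply']; exact Tr.returnMap_mem H (hind m).2.1.1
  · rw [Function.iterate_succ_apply']; exact (hind m).2.1.2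
  · rw [htz]; exact hn

theorem base_mem_mapStableSet {W : Set Γ} (hW : U₀ ∈ W) :
    U₀ ∈ mapStableSet (returnMap R Δ q) univ W U₀ := by
  have h1 : ∀ n, (returnMap R Δ q)^[n] U₀ = U₀ := fun n =>
    Function.iterate_fixed (Tr.returnMap_base H) n
  refine ⟨mem_univ _, fun n => by rwa [h1], ?_⟩
  simp only [h1]
  exact tendsto_const_nhds

end TransitSys

omit [NormedSpace ℝ Γ] in
theorem mapStableSet_mono {P : Γ → Γ} {A W W' : Set Γ} {x : Γ} (h : W ⊆ W') :
    mapStableSet P A W x ⊆ mapStableSet P A W' x :=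
  fun _ hU => ⟨hU.1, fun n => h (hU.2.1 n), hU.2.2⟩

/-- The local stable set of a hyperbolic cycle is a `C^{1,1}` submanifold. -/
theorem HypCycle.exists_stableManifold [CompleteSpace Γ] (H : HypCycle R U₀ Δ g₀ Es Eu)
    (Tr : TransitSys R U₀ Δ g₀ Es Eu S ε B q)
    {Size : Submodule ℝ Γ → Prop} (hcc : (Es ⊔ Submodule.span ℝ {g₀}).ClosedComplemented)
    (hsize : Size (Es ⊔ Submodule.span ℝ {g₀})) :
    ∃ δ₀, 0 < δ₀ ∧ ∀ δ, 0 < δ → δ ≤ δ₀ → IsC11Submanifold Size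
      (localStableSet R (cycle R U₀) (Metric.thickening δ (cycle R U₀))) ∧
      ∀ s : ℝ, tangentSet (localStableSet R (cycle R U₀) (Metric.thickening δ (cycle R U₀)))
        (R s U₀) = ((Es ⊔ Submodule.span ℝ {g₀}).map (flowTangent R s U₀ : Γ →ₗ[ℝ] Γ) : Set Γ) := by
  obtain ⟨V, χ, A, r₀, hχ⟩ := Tr.exists_stableChart H
  obtain ⟨δ₁, hδ₁, htube⟩ := H.exists_c11_tube
  obtain ⟨δ₂, hδ₂, W', hW', hS1⟩ := Tr.exists_localStableSet_subset H
    ((hχ.isOpen r₀).mem_nhds (hχ.mem r₀ hχ.r_pos))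
  refine ⟨min δ₁ δ₂, lt_min hδ₁ hδ₂, fun δ hδ hδδ => ?_⟩
  have hδ1 : δ ≤ δ₁ := hδδ.trans (min_le_left _ _)
  have hδ2 : δ ≤ δ₂ := hδδ.trans (min_le_right _ _)
  set Wδ := localStableSet R (cycle R U₀) (Metric.thickening δ (cycle R U₀)) with hWδ
  obtain ⟨W₂, hW₂, hS2⟩ := Tr.exists_nhds_subset_localStableSet H hδ
  obtain ⟨r₁, hr₁, hVr₁⟩ := hχ.basis _ (inter_mem hW' hW₂)
  set r := min r₀ r₁ with hr
  have hr0 : 0 < r := lt_min hχ.r_pos hr₁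
  have hrr : r ≤ r₀ := min_le_left _ _
  have hVr : V r ⊆ W' ∩ W₂ := (hχ.mono _ _ (min_le_right _ _)).trans hVr₁
  set M := mapStableSet (returnMap R Δ q) univ (V r) U₀ with hM
  -- The chart does not depend on the radius. Membership in `Wδ` gives the stable set for the large
  -- `V r₀`, hence the equation `χ y ∈ E`; on `A r` the same equation characterizes the small set
  -- `M`.
  have hgerm : ∀ z ∈ M, ∀ᶠ y in 𝓝 z, y ∈ Wδ ↔ y ∈ M := by
    intro z hz
    have hzA : z ∈ A r := ((hχ.stable r hr0 hrr z).1 hz).1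
    filter_upwards [(hχ.isOpen_A r hr0 hrr).mem_nhds hzA, (hχ.isOpen r).mem_nhds (hz.2.1 0)]
      with y hyA hyV
    constructor
    · intro hy
      have h1 := hS1 y (hVr hyV).1 ⟨hy.1, fun t ht => Metric.thickening_mono hδ2 _ (hy.2 t ht)⟩
      exact (hχ.stable r hr0 hrr y).2 ⟨hyA, ((hχ.stable r₀ hχ.r_pos le_rfl y).1 h1).2⟩
    · intro hy
      exact hS2 y (mapStableSet_mono (hVr.trans inter_subset_right) hy)
  have hchart : ∀ z ∈ M, IsDiffeoAt χ z ∧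
      ∀ᶠ y in 𝓝 z, y ∈ M ↔ χ y ∈ Es ⊔ Submodule.span ℝ {g₀} := by
    intro z hz
    have hzA : z ∈ A r := ((hχ.stable r hr0 hrr z).1 hz).1
    refine ⟨hχ.diffeo r hr0 hrr z hzA, ?_⟩
    filter_upwards [(hχ.isOpen_A r hr0 hrr).mem_nhds hzA] with y hyA
    rw [hM, hχ.stable r hr0 hrr]
    exact and_iff_right hyA
  have hsub : ∀ z ∈ M, IsSubmanifoldAt Size Wδ z := by
    intro z hz
    obtain ⟨h1, h2⟩ := hchart z hz
    refine ⟨_, hcc, hsize, χ, h1, ?_⟩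
    filter_upwards [hgerm z hz, h2] with y i1 i2
    rw [i1, i2]
  have hUM : U₀ ∈ M := Tr.base_mem_mapStableSet H (hχ.mem r hr0)
  have hclosed : IsClosed ((Es ⊔ Submodule.span ℝ {g₀} : Submodule ℝ Γ) : Set Γ) := hcc.isClosed
  have htan0 : tangentSet Wδ U₀ = ((Es ⊔ Submodule.span ℝ {g₀} : Submodule ℝ Γ) : Set Γ) := by
    obtain ⟨h1, h2⟩ := hchart U₀ hUM
    rw [tangentSet_congr (hgerm U₀ hUM), tangentSet_chart hclosed h1 h2 (h2.self_of_nhds.1 hUM)]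
    ext v
    simp only [mem_ofPred_eq, hχ.chart_deriv]
    rfl
  constructor
  · refine isC11Submanifold_of_at fun x hx => ?_
    -- An arbitrary point of `Wδ` eventually stays within the smaller distance `δ₃` and visits `W₃`,
    -- so some `R t x` is in `M`. The orbit segment up to `t` remains in the tube, and the structure
    -- is pulled back along `R t`.
    obtain ⟨δ₃, hδ₃, W₃, hW₃, hS3⟩ := Tr.exists_localStableSet_subset H
      ((hχ.isOpen r).mem_nhds (hχ.mem r hr0))
    have h1 : ∀ᶠ t in atTop, R t x ∈ Metric.thickening δ₃ (cycle R U₀) := by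
      filter_upwards [hx.1.eventually (gt_mem_nhds hδ₃)] with t ht
      exact H.mem_thickening_iff.2 ht
    obtain ⟨t₀, ht₀⟩ := eventually_atTop.1 h1
    obtain ⟨t, ht, htW⟩ := H.exists_visit hx.1 hW₃ (max t₀ 0)
    have ht0 : t₀ ≤ t := (le_max_left _ _).trans ht
    have ht1 : 0 ≤ t := (le_max_right _ _).trans ht
    have hm : R t x ∈ M := hS3 _ htW ⟨H.stableSet_flow t hx.1, fun s hs => by
      rw [← H.flow.add]; exact ht₀ _ (by linarith)⟩
    obtain ⟨h2, h3⟩ := H.localStableSet_germ hδ1 htube (x := x) (t := t) fun τ hτ => by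
      rw [uIcc_of_le ht1] at hτ; exact hx.2 τ hτ.1
    exact (hsub _ hm).preimage h2 h3
  · intro s
    have hs0 : R (-s) (R s U₀) = U₀ := H.flow.neg_apply s U₀
    obtain ⟨h2, h3⟩ := H.localStableSet_germ hδ1 htube (x := R s U₀) (t := -s) fun τ _ =>
      Metric.self_subset_thickening hδ _ (H.flow.mem_cycle (H.mem_cycle s) τ)
    rw [tangentSet_preimage h2 h3, hs0, htan0]
    ext v
    simp only [mem_ofPred_eq]
    constructor
    · intro hv
      exact ⟨_, hv, H.flowTangent_apply_neg s v⟩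
    · rintro ⟨w, hw, rfl⟩
      exact (H.flowTangent_neg_apply s w).symm ▸ hw

end Dynamics

end RG

namespace RG

section Sections

variable {Γ : Type*} [NormedAddCommGroup Γ] [NormedSpace ℝ Γ]
  {R : ℝ → Γ → Γ} {U₀ : Γ} {Δ : ℝ} {g₀ : Γ} {Es Eu : Submodule ℝ Γ}
  {S : ℝ → Set Γ} {ε : ℝ} {B : Set Γ} {q : ℝ → Γ → ℝ}

/-! ### Stable manifolds in the sections -/

namespace HypCycle

theorem eventually_flow_small (H : HypCycle R U₀ Δ g₀ Es Eu) {W : Set Γ} (hW : W ∈ 𝓝 U₀) :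
    ∃ η, 0 < η ∧ ∀ᶠ z in 𝓝 U₀, ∀ a, |a| < η → R a z ∈ W := by
  have h1 := H.continuousAt 0 H.mem_cycle_base
  have h2 : (fun z : ℝ × Γ => R z.1 z.2) ⁻¹' W ∈ 𝓝 ((0 : ℝ), U₀) := by
    refine h1 ?_
    simpa only [H.flow.zero] using hW
  obtain ⟨ρ, hρ, hball⟩ := Metric.mem_nhds_iff.1 h2
  refine ⟨ρ, hρ, ?_⟩
  filter_upwards [Metric.ball_mem_nhds U₀ hρ] with z hz a ha
  refine @hball (a, z) ?_
  rw [← ball_prod_same]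
  exact ⟨by rwa [mem_ball_zero_iff, Real.norm_eq_abs], hz⟩

theorem continuousAt_flow (H : HypCycle R U₀ Δ g₀ Es Eu) (s : ℝ) {x : Γ} (hx : x ∈ cycle R U₀) :
    ContinuousAt (R s) x := (c11At_flow (H.c11 s x hx)).continuousAt

theorem eventually_c11At (H : HypCycle R U₀ Δ g₀ Es Eu) (a b : ℝ) :
    ∀ᶠ z in 𝓝 U₀, ∀ t ∈ Icc a b, C11At (fun z : ℝ × Γ => R z.1 z.2) (t, z) := by
  refine isCompact_Icc.eventually_forall_of_forall_eventually
    (P := fun z t => C11At (fun z : ℝ × Γ => R z.1 z.2) (t, z)) fun t _ => ?_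
  have : ContinuousAt (fun z : Γ × ℝ => (z.2, z.1)) (U₀, t) := by fun_prop
  exact this.eventually (H.c11 t _ H.mem_cycle_base).eventually

theorem eventually_c11At_neg (H : HypCycle R U₀ Δ g₀ Es Eu) (a b : ℝ) :
    ∀ᶠ z in 𝓝 U₀, ∀ t ∈ Icc a b, C11At (fun z : ℝ × Γ => R z.1 z.2) (-t, R t z) := by
  refine isCompact_Icc.eventually_forall_of_forall_eventually
    (P := fun z t => C11At (fun z : ℝ × Γ => R z.1 z.2) (-t, R t z)) fun t _ => ?_
  have h1 : ContinuousAt (fun z : Γ × ℝ => R z.2 z.1) (U₀, t) :=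
    ContinuousAt.comp (g := fun z : ℝ × Γ => R z.1 z.2) (f := fun z : Γ × ℝ => (z.2, z.1))
      (H.continuousAt t H.mem_cycle_base) (by fun_prop)
  have h2 : ContinuousAt (fun z : Γ × ℝ => (-z.2, R z.2 z.1)) (U₀, t) :=
    continuousAt_snd.neg.prodMk h1
  exact h2.eventually (H.c11 (-t) _ (H.mem_cycle t)).eventually

end HypCycle

namespace TransitSys

variable (Tr : TransitSys R U₀ Δ g₀ Es Eu S ε B q) (H : HypCycle R U₀ Δ g₀ Es Eu)

include Tr H

/-- Moving along the orbit by `a` shortens the transit time by `a`, by uniqueness in the window of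
width `2 * ε`. Consequently the maps `slide R q s` are constant on short orbit pieces, which drives
all identities between the sections below. -/
theorem time_flow {s : ℝ} (hs : s ∈ Icc (-Δ) Δ) {V : Γ} {a : ℝ} (hV : V ∈ B) (hV' : R a V ∈ B)
    (ha : |a| < ε) : q s (R a V) = q s V - a := by
  refine (Tr.uniq s hs _ hV' _ ?_ ?_).symm
  · exact (abs_sub _ _).trans_lt (by linarith [Tr.lt s hs V hV])
  · rw [← H.flow.add, show s + (q s V - a) + a = s + q s V by ring]
    exact Tr.sec s hs V hV

theorem slide_flow {s : ℝ} (hs : s ∈ Icc (-Δ) Δ) {V : Γ} {a : ℝ} (hV : V ∈ B) (hV' : R a V ∈ B)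
    (ha : |a| < ε) : slide R q s (R a V) = slide R q s V := by
  rw [slide, slide, Tr.time_flow H hs hV hV' ha, ← H.flow.add]
  congr 1
  ring

theorem slide_of_mem {s : ℝ} (hs : s ∈ Icc (-Δ) Δ) {V : Γ} (hV : V ∈ B) (hV' : R s V ∈ S s) :
    slide R q s V = R s V := by
  have := Tr.uniq s hs V hV 0 (by rw [abs_zero]; linarith [Tr.eps_pos]) (by rwa [add_zero])
  rw [slide, ← this, add_zero]

theorem slide_zero_of_mem {V : Γ} (hV : V ∈ B) (hV' : V ∈ S 0) : slide R q 0 V = V := by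
  rw [Tr.slide_of_mem H H.zero_mem hV (by rwa [H.flow.zero]), H.flow.zero]

theorem slide_slide {s : ℝ} (hs : s ∈ Icc (-Δ) Δ) {V : Γ} (hV : V ∈ B) (hV' : slide R q 0 V ∈ B) :
    slide R q s (slide R q 0 V) = slide R q s V := by
  rw [slide, zero_add] at hV'
  nth_rw 2 [slide]
  rw [zero_add, Tr.slide_flow H hs hV hV' (Tr.lt 0 H.zero_mem V hV)]

theorem neg_flow_slide (s : ℝ) (V : Γ) : R (-s) (slide R q s V) = R (q s V) V := by
  rw [slide, ← H.flow.add, neg_add_cancel_left]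

theorem eventually_flow_time {W : Set Γ} (hW : W ∈ 𝓝 U₀) :
    ∀ᶠ z in 𝓝 U₀, ∀ s ∈ Icc (-Δ) Δ, R (q s z) z ∈ W := by
  obtain ⟨η, hη, h⟩ := H.eventually_flow_small hW
  filter_upwards [h, Tr.small η hη] with z h1 h2 s hs using h1 _ (h2 s hs)

theorem continuousAt_slide_base {s : ℝ} (hs : s ∈ Icc (-Δ) Δ) : ContinuousAt (slide R q s) U₀ :=
  (Tr.c11At_slide_base H hs).continuousAt

theorem tendsto_slide_zero : Tendsto (slide R q 0) (𝓝 U₀) (𝓝 U₀) := by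
  have := (Tr.continuousAt_slide_base H H.zero_mem).tendsto
  rwa [Tr.slide_base H.zero_mem, H.flow.zero] at this

theorem tendsto_returnMap : Tendsto (returnMap R Δ q) (𝓝 U₀) (𝓝 U₀) := by
  have := (Tr.c11At_returnMap H).continuousAt.tendsto
  rwa [Tr.returnMap_base H] at this

end TransitSys

/-- A neighbourhood of `U₀` where all the maps between the sections are defined. -/
structure GoodNhd (R : ℝ → Γ → Γ) (U₀ : Γ) (Δ : ℝ) (B : Set Γ) (q : ℝ → Γ → ℝ) (G : Set Γ) :
    Prop where
  isOpen : IsOpen G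
  mem : U₀ ∈ G
  mem_dom : ∀ z ∈ G, z ∈ B
  period : ∀ z ∈ G, R Δ z ∈ B
  slide_zero : ∀ z ∈ G, slide R q 0 z ∈ B
  period_slide : ∀ z ∈ G, R Δ (slide R q 0 z) ∈ B
  return_mem : ∀ z ∈ G, returnMap R Δ q z ∈ B
  period_flow : ∀ z ∈ G, ∀ s ∈ Icc (-Δ) Δ, R Δ (R (q s z) z) ∈ B
  flow_mem : ∀ z ∈ G, ∀ s ∈ Icc (-Δ) Δ, R (q s z) z ∈ B
  flow_return : ∀ z ∈ G, ∀ s ∈ Icc (-Δ) Δ, R (q s (returnMap R Δ q z)) (returnMap R Δ q z) ∈ B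
  flow_slide : ∀ z ∈ G, ∀ s ∈ Icc (-Δ) Δ, R (q s (slide R q 0 z)) z ∈ B
  flow_slide_neg : ∀ z ∈ G, ∀ s ∈ Icc (-Δ) Δ, R (-q s (slide R q 0 z)) z ∈ B
  c11_neg : ∀ z ∈ G, ∀ s ∈ Icc (-Δ) Δ, C11At (fun z : ℝ × Γ => R z.1 z.2) (-s, R s z)
  c11 : ∀ z ∈ G, ∀ t ∈ Icc (-(2 * Δ)) (2 * Δ), C11At (fun z : ℝ × Γ => R z.1 z.2) (t, z)

theorem TransitSys.exists_goodNhd (Tr : TransitSys R U₀ Δ g₀ Es Eu S ε B q)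
    (H : HypCycle R U₀ Δ g₀ Es Eu) {D : Set Γ} (hD : D ∈ 𝓝 U₀) :
    ∃ G, GoodNhd R U₀ Δ B q G ∧ G ⊆ D := by
  have hB : B ∈ 𝓝 U₀ := Tr.isOpen.mem_nhds Tr.mem
  have hp := Tr.eventually_mem H
  have h0 := Tr.tendsto_slide_zero H
  have hP := Tr.tendsto_returnMap H
  obtain ⟨η, hη, hflow⟩ := H.eventually_flow_small hB
  obtain ⟨G, hG, hGo, hUG⟩ := eventually_nhds_iff.1
    ((((((((((((Tr.eventually_flow_time H hp).and (Tr.eventually_flow_time H hB)).and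
      (hP.eventually (Tr.eventually_flow_time H hB))).and hflow).and
      (h0.eventually (Tr.small η hη))).and (H.eventually_c11At (-(2 * Δ)) (2 * Δ))).and
      (H.eventually_c11At_neg (-Δ) Δ)).and hp).and (h0.eventually hp)).and
      (h0.eventually hB)).and (hP.eventually hB)).and
      (show ∀ᶠ z in 𝓝 U₀, z ∈ D ∧ z ∈ B from inter_mem hD hB))
  refine ⟨G, ⟨hGo, hUG, ?_, ?_, ?_, ?_, ?_, ?_, ?_, ?_, ?_, ?_, ?_, ?_⟩, ?_⟩ <;> intro z hz <;>
    obtain ⟨⟨⟨⟨⟨⟨⟨⟨⟨⟨⟨h1, h2⟩, h3⟩, h4⟩, h5⟩, h6⟩, h7⟩, h8⟩, h9⟩, h10⟩, h11⟩, h12, h13⟩ := hG z hz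
  · exact h13
  · exact h8
  · exact h10
  · exact h9
  · exact h11
  · exact h1
  · exact h2
  · exact h3
  · exact fun s hs => h4 _ (h5 s hs)
  · exact fun s hs => h4 _ (by rw [abs_neg]; exact h5 s hs)
  · exact h7
  · exact h6
  · exact h12

namespace TransitSys

variable (Tr : TransitSys R U₀ Δ g₀ Es Eu S ε B q) (H : HypCycle R U₀ Δ g₀ Es Eu)
  {G : Set Γ} (hG : GoodNhd R U₀ Δ B q G)

include Tr H hG

/-- Both sides are reached from `z` along one orbit and end in the section `S s`, so they agree.
This is the conjugacy between the return maps of different sections. -/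
theorem sectionMap_slide {s : ℝ} (hs : s ∈ Icc (-Δ) Δ) {z : Γ} (hz : z ∈ G) :
    slide R q s (R (Δ - s) (slide R q s z)) = slide R q s (returnMap R Δ q z) := by
  have h1 : R (Δ - s) (slide R q s z) = R (q s z) (R Δ z) := by
    rw [slide, ← H.flow.add, ← H.flow.add]; congr 1; ring
  have h2 : R (q s z) (R Δ z) ∈ B := by
    have := hG.period_flow z hz s hs
    rwa [← H.flow.add, add_comm, H.flow.add] at this
  rw [h1, Tr.slide_flow H hs (hG.period z hz) h2 (Tr.lt s hs z (hG.mem_dom z hz))]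
  exact (Tr.slide_slide H hs (hG.period z hz) (hG.return_mem z hz)).symm

/-- First sliding into the section changes only the starting point on the same short orbit piece;
all iterates from the first on are unaffected. -/
theorem returnMap_slide {z : Γ} (hz : z ∈ G) :
    returnMap R Δ q (slide R q 0 z) = returnMap R Δ q z := by
  have h1 : R Δ (slide R q 0 z) = R (q 0 z) (R Δ z) := by
    rw [slide, ← H.flow.add, ← H.flow.add]; congr 1; ring
  have h2 := hG.period_slide z hz
  rw [returnMap, h1]
  rw [h1] at h2
  exact Tr.slide_flow H H.zero_mem (hG.period z hz) h2
    (Tr.lt 0 H.zero_mem z (hG.mem_dom z hz))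

theorem slide_zero_neg_flow_slide {s : ℝ} (hs : s ∈ Icc (-Δ) Δ) {z : Γ} (hz : z ∈ B)
    (hz' : R (q s z) z ∈ B) (hzS : z ∈ S 0) : slide R q 0 (R (-s) (slide R q s z)) = z := by
  rw [Tr.neg_flow_slide H, Tr.slide_flow H H.zero_mem hz hz' (Tr.lt s hs z hz),
    Tr.slide_zero_of_mem H hz hzS]

theorem slide_slide_zero_neg_flow {s : ℝ} (hs : s ∈ Icc (-Δ) Δ) {y : Γ} (hy : R (-s) y ∈ G)
    (hyS : y ∈ S s) : slide R q s (slide R q 0 (R (-s) y)) = y := by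
  have h1 := H.flow.apply_neg s y
  rw [Tr.slide_slide H hs (hG.mem_dom _ hy) (hG.slide_zero _ hy),
    Tr.slide_of_mem H hs (hG.mem_dom _ hy) (by rwa [h1]), h1]

theorem c11At_slide_zero {z : Γ} (hz : z ∈ G) : C11At (slide R q 0) z := by
  refine c11At_slide (Tr.c11 0 H.zero_mem z (hG.mem_dom z hz)) (hG.c11 z hz _ ?_)
  have h1 := abs_lt.1 (Tr.lt 0 H.zero_mem z (hG.mem_dom z hz))
  have h2 := Tr.eps_le
  have h3 := H.lc.pos
  exact ⟨by linarith, by linarith⟩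

theorem continuousAt_neg_flow {s : ℝ} (hs : s ∈ Icc (-Δ) Δ) {y : Γ} (hy : R (-s) y ∈ G) :
    ContinuousAt (R (-s)) y := by
  have := (c11At_flow (hG.c11_neg _ hy s hs)).continuousAt
  rwa [H.flow.apply_neg] at this

/-- The points of the section `S 0` whose iterates stay in `W` are carried by `slide R q s` to
the local stable set of the return map to `S s`. -/
theorem image_slide_eq {W : Set Γ} (hW : ∀ z ∈ W, z ∈ G ∧ ∀ s ∈ Icc (-Δ) Δ, R (q s z) z ∈ G)
    {s : ℝ} (hs : s ∈ Icc (-Δ) Δ) :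
    slide R q s '' (mapStableSet (returnMap R Δ q) univ W U₀ ∩ S 0) =
      mapStableSet (fun U => slide R q s (R (Δ - s) U)) (S s)
        {y | R (-s) y ∈ G ∧ slide R q 0 (R (-s) y) ∈ W} (R s U₀) := by
  set P := returnMap R Δ q with hP
  set Ps : Γ → Γ := fun U => slide R q s (R (Δ - s) U) with hPs
  ext y
  constructor
  · rintro ⟨z, ⟨⟨-, hzW, hzt⟩, hzS⟩, rfl⟩
    have hS : ∀ n, P^[n] z ∈ S 0 := by
      intro n
      cases n with
      | zero => exact hzS
      | succ n =>
        rw [Function.iterate_succ_apply']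
        exact Tr.returnMap_mem H (hG.period _ (hW _ (hzW n)).1)
    have hit : ∀ n, Ps^[n] (slide R q s z) = slide R q s (P^[n] z) := by
      intro n
      induction n with
      | zero => rfl
      | succ n ih =>
        rw [Function.iterate_succ_apply', Function.iterate_succ_apply', ih]
        exact Tr.sectionMap_slide H hG hs (hW _ (hzW n)).1
    refine ⟨Tr.sec s hs z (hG.mem_dom z (hW z (hzW 0)).1), fun n => ?_, ?_⟩
    · rw [hit]
      have hn := hW _ (hzW n)
      refine ⟨?_, ?_⟩
      · rw [Tr.neg_flow_slide H]; exact hn.2 s hs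
      · rw [Tr.slide_zero_neg_flow_slide H hG hs (hG.mem_dom _ hn.1) (hG.flow_mem _ hn.1 s hs)
          (hS n)]
        exact hzW n
    · simp only [hit]
      have := (Tr.continuousAt_slide_base H hs).tendsto.comp hzt
      rwa [Tr.slide_base hs] at this
  · rintro ⟨hyS, hyV, hyt⟩
    have hS : ∀ n, Ps^[n] y ∈ S s := by
      intro n
      cases n with
      | zero => exact hyS
      | succ n =>
        rw [Function.iterate_succ_apply']
        refine Tr.sec s hs _ ?_
        rw [sub_eq_add_neg, H.flow.add]
        exact hG.period _ (hyV n).1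
    -- The orbit in `S s` is pulled back to `S 0` term by term; the conjugacy shows that the pulled
    -- back sequence is an orbit of the return map.
    set x : ℕ → Γ := fun n => slide R q 0 (R (-s) (Ps^[n] y)) with hx
    have hxW : ∀ n, x n ∈ W := fun n => (hyV n).2
    have hxS : ∀ n, x n ∈ S 0 := fun n => by
      have := Tr.sec 0 H.zero_mem _ (hG.mem_dom _ (hyV n).1)
      exact this
    have hxy : ∀ n, slide R q s (x n) = Ps^[n] y := fun n =>
      Tr.slide_slide_zero_neg_flow H hG hs (hyV n).1 (hS n)
    have hxP : ∀ n, P (x n) = x (n + 1) := by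
      intro n
      have hn := (hW _ (hxW n)).1
      have h1 := Tr.sectionMap_slide H hG hs hn
      rw [hxy] at h1
      have h2 : Ps^[n + 1] y = slide R q s (P (x n)) := by
        rw [Function.iterate_succ_apply']; exact h1
      simp only [hx, h2]
      exact (Tr.slide_zero_neg_flow_slide H hG hs (hG.return_mem _ hn) (hG.flow_return _ hn s hs)
        (Tr.returnMap_mem H (hG.period _ hn))).symm
    have hit : ∀ n, P^[n] (x 0) = x n := by
      intro n
      induction n with
      | zero => rfl
      | succ n ih => rw [Function.iterate_succ_apply', ih, hxP]
    refine ⟨x 0, ⟨⟨mem_univ _, fun n => ?_, ?_⟩, hxS 0⟩, hxy 0⟩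
    · rw [hit]; exact hxW n
    · simp only [hit]
      have h1 := (H.continuousAt_flow (-s) (H.mem_cycle s)).tendsto
      rw [H.flow.neg_apply] at h1
      exact ((Tr.tendsto_slide_zero H).comp h1).comp hyt

theorem isOpen_preimage_slide {W : Set Γ} (hWo : IsOpen W) {s : ℝ} (hs : s ∈ Icc (-Δ) Δ) :
    IsOpen {y | R (-s) y ∈ G ∧ slide R q 0 (R (-s) y) ∈ W} := by
  refine isOpen_iff_mem_nhds.2 fun y hy => ?_
  have h1 := Tr.continuousAt_neg_flow H hG hs hy.1
  have h2 : ContinuousAt (fun y => slide R q 0 (R (-s) y)) y :=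
    ContinuousAt.comp (g := slide R q 0) (Tr.c11At_slide_zero H hG hy.1).continuousAt h1
  exact inter_mem (h1 (hG.isOpen.mem_nhds hy.1)) (h2 (hWo.mem_nhds hy.2))

omit hG in
/-- The transit times to the different sections have the same derivative. -/
theorem fderiv_time_eq {s : ℝ} (hs : s ∈ Icc (-Δ) Δ) (v : Γ) :
    fderiv ℝ (q s) U₀ v = fderiv ℝ (q 0) U₀ v := by
  obtain ⟨z, rfl⟩ := H.bij.2 v
  simp only [map_add, map_smul, Tr.deriv_s s hs _ z.1.1.2, Tr.deriv_u s hs _ z.2.2,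
    Tr.deriv_c s hs, Tr.deriv_s 0 H.zero_mem _ z.1.1.2, Tr.deriv_u 0 H.zero_mem _ z.2.2,
    Tr.deriv_c 0 H.zero_mem]

/-- The inverse of `slide R q s` on the section `S 0`, extended to a local diffeomorphism. -/
theorem isDiffeoAt_unslide {s : ℝ} (hs : s ∈ Icc (-Δ) Δ) {x : Γ} (hx : x ∈ G) (hxS : x ∈ S 0)
    (hw : R (q s x) x ∈ G) :
    IsDiffeoAt (fun y => R (-q s (slide R q 0 (R (-s) y))) (R (-s) y)) (slide R q s x) ∧
    R (-q s (slide R q 0 (R (-s) (slide R q s x)))) (R (-s) (slide R q s x)) = x := by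
  have hΔ := H.lc.pos
  have hεΔ := Tr.eps_le
  have hslope : ∀ z ∈ G, |q s (slide R q 0 z)| < ε := fun z hz =>
    Tr.lt s hs _ (hG.slide_zero z hz)
  have e1 : R (-s) (slide R q s x) = R (q s x) x := Tr.neg_flow_slide H s x
  have e2 : slide R q 0 (R (q s x) x) = x := by
    rw [← e1]
    exact Tr.slide_zero_neg_flow_slide H hG hs (hG.mem_dom x hx) (hG.mem_dom _ hw) hxS
  have e3 : R (-q s (slide R q 0 (R (-s) (slide R q s x)))) (R (-s) (slide R q s x)) = x := by
    rw [e1, e2, H.flow.neg_apply]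
  have hcn : ContinuousAt (R (-s)) (slide R q s x) :=
    Tr.continuousAt_neg_flow H hG hs (by rwa [e1])
  have hc11n : C11At (R (-s)) (slide R q s x) := by
    have := c11At_flow (hG.c11_neg _ hw s hs)
    rwa [← H.flow.add] at this
  -- The map `slide R q s` itself collapses orbit pieces, so it is not invertible on an open set.
  -- Replacing its time by the transit time of `slide R q 0` fixes this: that time is constant along
  -- short orbit pieces, which are then merely translated, and translating back gives an explicit
  -- inverse.
  refine ⟨⟨?_, fun x' => R (s + q s (slide R q 0 x')) x', ?_, ?_, ?_⟩, e3⟩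
  · have h1 : C11At (fun z => R (-q s (slide R q 0 z)) z) (R (q s x) x) := by
      refine C11At.comp (g := fun z : ℝ × Γ => R z.1 z.2)
        (f := fun z => (-q s (slide R q 0 z), z)) (hG.c11 _ hw _ ?_)
        ((C11At.neg (C11At.comp (g := q s) (f := slide R q 0)
          (Tr.c11 s hs _ (hG.slide_zero _ hw)) (Tr.c11At_slide_zero H hG hw))).prodMk (C11At.id _))
      have := abs_lt.1 (hslope _ hw)
      exact ⟨by linarith, by linarith⟩
    exact C11At.comp' (g := fun z => R (-q s (slide R q 0 z)) z) (f := R (-s)) h1 hc11n e1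
  · change C11At _ (R (-q s (slide R q 0 (R (-s) (slide R q s x)))) (R (-s) (slide R q s x)))
    rw [e3]
    refine C11At.comp (g := fun z : ℝ × Γ => R z.1 z.2)
      (f := fun z => (s + q s (slide R q 0 z), z)) (hG.c11 _ hx _ ?_)
      (((C11At.const _ _).add (C11At.comp (g := q s) (f := slide R q 0)
        (Tr.c11 s hs _ (hG.slide_zero _ hx)) (Tr.c11At_slide_zero H hG hx))).prodMk (C11At.id _))
    have := abs_lt.1 (hslope _ hx)
    exact ⟨by linarith [hs.1], by linarith [hs.2]⟩
  · have h1 : ∀ᶠ y in 𝓝 (slide R q s x), R (-s) y ∈ G :=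
      hcn (hG.isOpen.mem_nhds (by rwa [e1]))
    filter_upwards [h1] with y hy
    have h2 : slide R q 0 (R (-q s (slide R q 0 (R (-s) y))) (R (-s) y)) =
        slide R q 0 (R (-s) y) :=
      Tr.slide_flow H H.zero_mem (hG.mem_dom _ hy) (hG.flow_slide_neg _ hy s hs)
        (by rw [abs_neg]; exact hslope _ hy)
    rw [h2, ← H.flow.add, ← H.flow.add, add_neg_cancel_right, add_neg_cancel, H.flow.zero]
  · change ∀ᶠ z in 𝓝 (R (-q s (slide R q 0 (R (-s) (slide R q s x)))) (R (-s) (slide R q s x))), _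
    rw [e3]
    filter_upwards [hG.isOpen.mem_nhds hx] with x' hx'
    have h1 : R (-s) (R (s + q s (slide R q 0 x')) x') = R (q s (slide R q 0 x')) x' := by
      rw [← H.flow.add, neg_add_cancel_left]
    have h2 : slide R q 0 (R (q s (slide R q 0 x')) x') = slide R q 0 x' :=
      Tr.slide_flow H H.zero_mem (hG.mem_dom _ hx') (hG.flow_slide _ hx' s hs) (hslope _ hx')
    rw [h1, h2, H.flow.neg_apply]

/-- Presents the image under a non-injective map as the preimage under a local diffeomorphism, so
that charts and tangent spaces can be transported. -/
theorem mem_image_slide_iff {M : Set Γ} (hMG : M ⊆ G) (hMS : M ⊆ S 0)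
    {s : ℝ} (hs : s ∈ Icc (-Δ) Δ) {y : Γ} (hy : R (-s) y ∈ G) :
    y ∈ slide R q s '' M ↔ R (-q s (slide R q 0 (R (-s) y))) (R (-s) y) ∈ M := by
  constructor
  · rintro ⟨x, hx, rfl⟩
    rw [Tr.neg_flow_slide H] at hy
    rwa [(Tr.isDiffeoAt_unslide H hG hs (hMG hx) (hMS hx) hy).2]
  · intro hM
    refine ⟨_, hM, ?_⟩
    set z := R (-s) y with hz
    set x := R (-q s (slide R q 0 z)) z with hx
    have h1 : slide R q 0 x = slide R q 0 z :=
      Tr.slide_flow H H.zero_mem (hG.mem_dom _ hy) (hG.flow_slide_neg _ hy s hs)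
        (by rw [abs_neg]; exact Tr.lt s hs _ (hG.slide_zero _ hy))
    rw [Tr.slide_zero_of_mem H (hG.mem_dom _ (hMG hM)) (hMS hM)] at h1
    have h2 : R (q s (slide R q 0 z)) x = z := H.flow.apply_neg _ _
    rw [slide, H.flow.add, show q s x = q s (slide R q 0 z) from congrArg _ h1, h2, hz,
      H.flow.apply_neg]

/-- The time correction has zero derivative at `U₀`: `slide R q 0` projects to `Es ⊔ Eu` along `g₀`,
and the derivative of `q s` vanishes there. Only the linearized backward flow remains. -/
theorem fderiv_unslide {s : ℝ} (hs : s ∈ Icc (-Δ) Δ) (v : Γ) :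
    fderiv ℝ (fun y => R (-q s (slide R q 0 (R (-s) y))) (R (-s) y)) (R s U₀) v =
      flowTangent R (-s) (R s U₀) v := by
  have e0 : slide R q 0 U₀ = U₀ := by rw [Tr.slide_base H.zero_mem, H.flow.zero]
  have h1 : HasFDerivAt (fun z => q s (slide R q 0 z))
      ((fderiv ℝ (q s) U₀).comp (fderiv ℝ (slide R q 0) U₀)) U₀ := by
    have h2 : HasFDerivAt (q s) (fderiv ℝ (q s) U₀) (slide R q 0 U₀) := by
      rw [e0]; exact (Tr.c11 s hs U₀ Tr.mem).hasFDerivAt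
    exact h2.comp U₀ (Tr.c11At_slide_base H H.zero_mem).hasFDerivAt
  have h0 : (fderiv ℝ (q s) U₀).comp (fderiv ℝ (slide R q 0) U₀) = 0 := by
    ext w
    rw [ContinuousLinearMap.comp_apply, Tr.fderiv_slide_base H H.zero_mem, H.flowTangent_zero,
      map_add, map_smul, Tr.deriv_c s hs, Tr.fderiv_time_eq H hs w]
    simp
  rw [h0] at h1
  have h3 : HasFDerivAt (fun z => (-q s (slide R q 0 z), z))
      ((-0 : Γ →L[ℝ] ℝ).prod (ContinuousLinearMap.id ℝ Γ)) U₀ := h1.neg.prodMk (hasFDerivAt_id U₀)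
  have h4 : HasFDerivAt (fun z : ℝ × Γ => R z.1 z.2)
      (fderiv ℝ (fun z : ℝ × Γ => R z.1 z.2) (0, U₀)) (-q s (slide R q 0 U₀), U₀) := by
    rw [e0, Tr.base s hs, neg_zero]; exact (H.c11 0 _ H.mem_cycle_base).hasFDerivAt
  have h5 := HasFDerivAt.comp (g := fun z : ℝ × Γ => R z.1 z.2)
    (f := fun z => (-q s (slide R q 0 z), z)) U₀ h4 h3
  have e1 := H.flow.neg_apply s U₀
  have h6 := H.hasFDerivAt (-s) (H.mem_cycle s)
  rw [← e1] at h5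
  have h7 := h5.comp (R s U₀) h6
  refine (DFunLike.congr_fun h7.fderiv v).trans ?_
  have h8 := H.fderiv_flow_base 0 0 (flowTangent R (-s) (R s U₀) v)
  rw [H.flowTangent_zero, zero_smul, zero_add] at h8
  rw [e1, ← h8]
  simp

end TransitSys

/-- The stable manifolds of the return maps to the sections: they correspond to each other under
the maps `slide R q s`, and the flow sweeps out the stable set of the cycle from any of them. -/
theorem HypCycle.exists_sectionManifolds [CompleteSpace Γ] (H : HypCycle R U₀ Δ g₀ Es Eu)
    (Tr : TransitSys R U₀ Δ g₀ Es Eu S ε B q) {D : Set Γ} (hD : D ∈ 𝓝 U₀)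
    {Size : Submodule ℝ Γ → Prop} (hcc : Es.ClosedComplemented) (hsize : Size Es) :
    ∃ Ws : ℝ → Set Γ, (∀ s ∈ Icc (-Δ) Δ,
      (∃ V : Set Γ, IsOpen V ∧ R s U₀ ∈ V ∧ (∀ y ∈ V, R (-s) y ∈ D) ∧
        Ws s = mapStableSet (fun U => slide R q s (R (Δ - s) U)) (S s) V (R s U₀)) ∧
      IsC11Submanifold Size (Ws s) ∧
      tangentSet (Ws s) (R s U₀) = (Es.map (flowTangent R s U₀ : Γ →ₗ[ℝ] Γ) : Set Γ) ∧
      Ws s = slide R q s '' Ws 0) ∧ Ws 0 ⊆ D ∧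
      stableSet R (cycle R U₀) = ⋃ s : ℝ, R s '' Ws 0 := by
  obtain ⟨V, χ, A, r₀, hχ⟩ := Tr.exists_stableChart H
  obtain ⟨G, hG, hGD⟩ := Tr.exists_goodNhd H hD
  have hGn : G ∈ 𝓝 U₀ := hG.isOpen.mem_nhds hG.mem
  obtain ⟨W₂, hW₂, hS2⟩ := Tr.exists_nhds_subset_localStableSet H one_pos
  obtain ⟨r₁, hr₁, hVr₁⟩ := hχ.basis
    ((G ∩ {z | ∀ s ∈ Icc (-Δ) Δ, R (q s z) z ∈ G}) ∩ W₂)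
    (inter_mem (inter_mem hGn (Tr.eventually_flow_time H hGn)) hW₂)
  set r := min r₀ r₁ with hr
  have hr0 : 0 < r := lt_min hχ.r_pos hr₁
  have hrr : r ≤ r₀ := min_le_left _ _
  have hVr := (hχ.mono _ _ (min_le_right r₀ r₁)).trans hVr₁
  have hVG : ∀ z ∈ V r, z ∈ G ∧ ∀ s ∈ Icc (-Δ) Δ, R (q s z) z ∈ G := fun z hz => (hVr hz).1
  set M := mapStableSet (returnMap R Δ q) univ (V r) U₀ with hM
  set M₀ := M ∩ S 0 with hM₀
  have hMV : ∀ z ∈ M, z ∈ V r := fun z hz => hz.2.1 0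
  have hM₀G : M₀ ⊆ G := fun z hz => (hVG z (hMV z hz.1)).1
  have hM₀S : M₀ ⊆ S 0 := inter_subset_right
  have hU₀S : U₀ ∈ S 0 := by rw [Tr.mem_zero, sub_self]; exact (Es ⊔ Eu).zero_mem
  have hUM₀ : U₀ ∈ M₀ := ⟨Tr.base_mem_mapStableSet H (hχ.mem r hr0), hU₀S⟩
  have hzero : slide R q 0 '' M₀ = M₀ := by
    have : EqOn (slide R q 0) id M₀ := fun z hz =>
      Tr.slide_zero_of_mem H (hG.mem_dom z (hM₀G hz)) (hM₀S hz)
    rw [this.image_eq, image_id]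
  have hchart : ∀ z ∈ M₀, IsDiffeoAt χ z ∧ ∀ᶠ y in 𝓝 z, y ∈ M₀ ↔ χ y ∈ Es := by
    intro z hz
    have hzA : z ∈ A r := ((hχ.stable r hr0 hrr z).1 hz.1).1
    refine ⟨hχ.diffeo r hr0 hrr z hzA, ?_⟩
    filter_upwards [(hχ.isOpen_A r hr0 hrr).mem_nhds hzA] with y hyA
    rw [hM₀, mem_inter_iff, hM, hχ.stable r hr0 hrr, ← hχ.inter]
    exact and_congr_left' (and_iff_right hyA)
  have hslide : ∀ s ∈ Icc (-Δ) Δ, ∀ x ∈ M₀, R (q s x) x ∈ G := fun s hs x hx =>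
    (hVG x (hMV x hx.1)).2 s hs
  have hgerm : ∀ s ∈ Icc (-Δ) Δ, ∀ x ∈ M₀, ∀ᶠ y in 𝓝 (slide R q s x),
      y ∈ slide R q s '' M₀ ↔ R (-q s (slide R q 0 (R (-s) y))) (R (-s) y) ∈ M₀ := by
    intro s hs x hx
    have h1 : R (-s) (slide R q s x) ∈ G := by
      rw [Tr.neg_flow_slide H]; exact hslide s hs x hx
    filter_upwards [Tr.continuousAt_neg_flow H hG hs h1 (hG.isOpen.mem_nhds h1)] with y hy
    exact Tr.mem_image_slide_iff H hG hM₀G hM₀S hs hy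
  refine ⟨fun s => slide R q s '' M₀, fun s hs => ⟨?_, ?_, ?_, ?_⟩, ?_, ?_⟩
  · refine ⟨_, Tr.isOpen_preimage_slide H hG (hχ.isOpen r) hs, ?_, fun y hy => hGD hy.1,
      Tr.image_slide_eq H hG hVG hs⟩
    rw [mem_ofPred_eq, H.flow.neg_apply, Tr.slide_base H.zero_mem, H.flow.zero]
    exact ⟨hG.mem, hχ.mem r hr0⟩
  · refine isC11Submanifold_of_at ?_
    rintro _ ⟨x, hx, rfl⟩
    obtain ⟨h1, h2⟩ := Tr.isDiffeoAt_unslide H hG hs (hM₀G hx) hx.2 (hslide s hs x hx)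
    refine IsSubmanifoldAt.preimage ?_ h1 (hgerm s hs x hx)
    rw [h2]
    exact ⟨Es, hcc, hsize, χ, hchart x hx⟩
  · have hgU := hgerm s hs U₀ hUM₀
    obtain ⟨h1, h2⟩ := Tr.isDiffeoAt_unslide H hG hs hG.mem hU₀S (hslide s hs _ hUM₀)
    have h3 := tangentSet_preimage h1 hgU
    rw [Tr.slide_base hs] at h3 h2
    obtain ⟨h4, h5⟩ := hchart U₀ hUM₀
    rw [h3, h2, tangentSet_chart hcc.isClosed h4 h5 (h5.self_of_nhds.1 hUM₀)]
    ext v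
    simp only [mem_ofPred_eq, hχ.chart_deriv, Tr.fderiv_unslide H hG hs]
    constructor
    · intro hv
      exact ⟨_, hv, H.flowTangent_apply_neg s v⟩
    · rintro ⟨w, hw, rfl⟩
      exact (H.flowTangent_neg_apply s w).symm ▸ hw
  · simp only [hzero]
  · simp only [hzero]
    exact hM₀G.trans hGD
  · simp only [hzero]
    ext U
    simp only [mem_iUnion]
    constructor
    · intro hU
      obtain ⟨δ₃, hδ₃, W₃, hW₃, hS3⟩ := Tr.exists_localStableSet_subset H
        ((hχ.isOpen r).mem_nhds (hχ.mem r hr0))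
      have h1 : ∀ᶠ t in atTop, R t U ∈ Metric.thickening δ₃ (cycle R U₀) := by
        filter_upwards [hU.eventually (gt_mem_nhds hδ₃)] with t ht
        exact H.mem_thickening_iff.2 ht
      obtain ⟨t₀, ht₀⟩ := eventually_atTop.1 h1
      -- The slid point is not an iterate of `R t U`, so its own membership in `V r` has to be
      -- requested separately; later iterates coincide.
      have hV0 : ∀ᶠ z in 𝓝 U₀, slide R q 0 z ∈ V r :=
        (Tr.tendsto_slide_zero H).eventually ((hχ.isOpen r).mem_nhds (hχ.mem r hr0))
      obtain ⟨t, ht, htW, htV⟩ := H.exists_visit hU (inter_mem hW₃ hV0) t₀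
      have hm : R t U ∈ M := hS3 _ htW ⟨H.stableSet_flow t hU, fun s hs => by
        rw [← H.flow.add]; exact ht₀ _ (by linarith)⟩
      have hmG := (hVG _ (hMV _ hm)).1
      have hit : ∀ n, (returnMap R Δ q)^[n + 1] (slide R q 0 (R t U)) =
          (returnMap R Δ q)^[n + 1] (R t U) := fun n => by
        rw [Function.iterate_succ_apply, Function.iterate_succ_apply,
          Tr.returnMap_slide H hG hmG]
      refine ⟨-(q 0 (R t U) + t), slide R q 0 (R t U), ⟨⟨mem_univ _, fun n => ?_, ?_⟩, ?_⟩, ?_⟩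
      · cases n with
        | zero => exact htV
        | succ n => rw [hit]; exact hm.2.1 _
      · refine (tendsto_add_atTop_iff_nat 1).1 ?_
        simp only [hit]
        exact (tendsto_add_atTop_iff_nat 1).2 hm.2.2
      · exact Tr.sec 0 H.zero_mem _ (hG.mem_dom _ hmG)
      · rw [slide, zero_add, ← H.flow.add, ← H.flow.add]
        convert H.flow.zero U using 2
        ring
    · rintro ⟨s, z, hz, rfl⟩
      exact H.stableSet_flow s (hS2 z (mapStableSet_mono (hVr.trans inter_subset_right) hz.1)).1

end Sections

end RG

namespace RG

section Reversal

variable {Γ : Type*} [NormedAddCommGroup Γ] [NormedSpace ℝ Γ]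
  {R : ℝ → Γ → Γ} {U₀ : Γ} {Δ : ℝ} {g₀ : Γ} {Es Eu : Submodule ℝ Γ}
  {S : ℝ → Set Γ} {ε : ℝ} {B : Set Γ} {q : ℝ → Γ → ℝ}

/-! ### Time reversal -/

theorem cycle_reverse (R : ℝ → Γ → Γ) (U₀ : Γ) : cycle (fun s => R (-s)) U₀ = cycle R U₀ :=
  neg_surjective.range_comp fun s => R s U₀

theorem stableSet_reverse (R : ℝ → Γ → Γ) (C : Set Γ) :
    stableSet (fun s => R (-s)) C = unstableSet R C := by
  ext U
  constructor
  · intro h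
    refine (Tendsto.comp h tendsto_neg_atBot_atTop).congr fun t => ?_
    simp only [Function.comp_apply, neg_neg]
  · intro h
    exact Tendsto.comp (g := fun t => Metric.infDist (R t U) C) h tendsto_neg_atTop_atBot

theorem localStableSet_reverse (R : ℝ → Γ → Γ) (C V : Set Γ) :
    localStableSet (fun s => R (-s)) C V = localUnstableSet R C V := by
  ext U
  rw [localStableSet, localUnstableSet, mem_ofPred_eq, mem_ofPred_eq, stableSet_reverse]
  refine and_congr_right fun _ => ⟨fun h t ht => ?_, fun h t ht => h _ (by linarith)⟩
  have := h (-t) (by linarith)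
  rwa [neg_neg] at this

theorem flowTangent_reverse (R : ℝ → Γ → Γ) (s : ℝ) (U : Γ) :
    flowTangent (fun s => R (-s)) s U = flowTangent R (-s) U := rfl

/-- The tangent map over `-Δ` at `U₀` inverts the one over `Δ`, so contraction and expansion trade
places with the same rate; the generator changes sign. -/
theorem HypCycle.reverse (H : HypCycle R U₀ Δ g₀ Es Eu) :
    HypCycle (fun s => R (-s)) U₀ Δ (-g₀) Eu Es := by
  have hinv : ∀ v, flowTangent (fun s => R (-s)) Δ U₀ (flowTangent R Δ U₀ v) = v := by
    intro v
    have := H.flowTangent_neg_apply Δ v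
    rwa [H.lc.periodic] at this
  have hinv' : ∀ v, flowTangent R Δ U₀ (flowTangent (fun s => R (-s)) Δ U₀ v) = v := by
    intro v
    have := H.flowTangent_apply_neg Δ v
    rwa [H.lc.periodic] at this
  have hneg : R (-Δ) U₀ = U₀ := by
    have := H.flow.neg_apply Δ U₀
    rwa [H.lc.periodic] at this
  -- Contraction alone does not give this. Split the preimage of `F` under the invertible tangent
  -- map: each summand is invariant, so uniqueness of the splitting of `F` leaves only the
  -- `Es`-component.
  have surj_s : ∀ F ∈ Es, ∃ F' ∈ Es, flowTangent R Δ U₀ F' = F := by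
    intro F hF
    obtain ⟨z, hz⟩ := H.bij.2 (flowTangent (fun s => R (-s)) Δ U₀ F)
    have h1 := congrArg (flowTangent R Δ U₀) hz
    simp only [map_add, map_smul, H.flowTangent_period, hinv'] at h1
    have h2 := H.bij.1 (a₁ := ((⟨_, H.map_s _ z.1.1.2⟩, z.1.2), ⟨_, H.map_u _ z.2.2⟩))
      (a₂ := ((⟨F, hF⟩, 0), 0)) (by simpa using h1)
    exact ⟨z.1.1, z.1.1.2, congrArg (fun w : (Es × ℝ) × Eu => (w.1.1 : Γ)) h2⟩
  obtain ⟨c, hc, hcs, hcu⟩ := H.rate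
  refine ⟨⟨fun U => ?_, fun s t U => ?_⟩, ⟨H.lc.pos, hneg, fun t ht ht' h => ?_⟩, ?_, ?_,
    H.closed_u, H.closed_s, ⟨fun z w h => ?_, fun v => ?_⟩, fun F hF => ?_, fun F hF => ?_,
    fun F hF => ?_, c, hc, fun F hF => ?_, fun F hF => ?_⟩
  · simp only [neg_zero, H.flow.zero]
  · rw [neg_add, H.flow.add]
  · refine H.lc.fundamental t ht ht' ?_
    have h1 := H.flow.apply_neg t U₀
    rwa [h] at h1
  · intro s x hx
    rw [cycle_reverse] at hx
    exact C11At.comp (g := fun z : ℝ × Γ => R z.1 z.2) (f := fun z : ℝ × Γ => (-z.1, z.2))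
      (H.c11 (-s) x hx) ((C11At.neg C11At.fst).prodMk C11At.snd)
  · have h1 : HasDerivAt (fun t => R t U₀) g₀ (-0) := by rw [neg_zero]; exact H.gen
    have h2 := h1.scomp (0 : ℝ) (hasDerivAt_neg (0 : ℝ))
    rwa [neg_one_smul] at h2
  · have h1 : (z.2 : Γ) + (-z.1.2) • g₀ + z.1.1 = w.2 + (-w.1.2) • g₀ + w.1.1 := by
      simp only [smul_neg, ← neg_smul] at h
      rw [add_comm, ← add_assoc, add_right_comm, h, add_comm, add_right_comm, add_comm]
      abel
    have h2 := H.bij.1 (a₁ := ((z.2, -z.1.2), z.1.1)) (a₂ := ((w.2, -w.1.2), w.1.1)) h1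
    simp only [Prod.mk.injEq, neg_inj] at h2
    exact Prod.ext (Prod.ext h2.2 h2.1.2) h2.1.1
  · obtain ⟨z, rfl⟩ := H.bij.2 v
    refine ⟨((z.2, -z.1.2), z.1.1), ?_⟩
    simp only [smul_neg, neg_smul, neg_neg]
    abel
  · obtain ⟨F', hF', rfl⟩ := H.surj_u F hF
    rwa [hinv]
  · obtain ⟨F', hF', rfl⟩ := surj_s F hF
    rwa [hinv]
  · exact ⟨_, H.map_s F hF, hinv F⟩
  · have := H.surj_u F hF
    obtain ⟨F', hF', rfl⟩ := this
    rw [hinv]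
    exact hcu F' hF'
  · obtain ⟨F', hF', rfl⟩ := surj_s F hF
    rw [hinv]
    exact hcs F' hF'

/-- The sections are the same with index `-s`, and times change sign. The neighbourhood `B` and the
window `ε` are kept, so both halves refer to the same transit maps. -/
theorem TransitSys.reverse (Tr : TransitSys R U₀ Δ g₀ Es Eu S ε B q) :
    TransitSys (fun s => R (-s)) U₀ Δ (-g₀) Eu Es (fun s => S (-s)) ε B
      (fun s V => -q (-s) V) := by
  have hJ : ∀ s ∈ Icc (-Δ) Δ, -s ∈ Icc (-Δ) Δ := fun s hs =>
    ⟨by linarith [hs.2], by linarith [hs.1]⟩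
  refine ⟨Tr.eps_pos, Tr.eps_le, Tr.isOpen, Tr.mem, fun s hs V hV => ?_, fun s hs V hV => ?_,
    fun s hs V hV a ha h => ?_, fun s hs V hV => (Tr.c11 _ (hJ s hs) V hV).neg, fun η hη => ?_,
    fun s hs => ?_, fun s hs v hv => ?_, fun s hs v hv => ?_, fun s hs => ?_, ?_, fun U => ?_⟩
  · rw [abs_neg]; exact Tr.lt _ (hJ s hs) V hV
  · simp only [neg_add, neg_neg]
    exact Tr.sec _ (hJ s hs) V hV
  · rw [← Tr.uniq _ (hJ s hs) V hV (-a) (by rwa [abs_neg]) (by rwa [neg_add] at h), neg_neg]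
  · filter_upwards [Tr.small η hη] with V hV s hs
    rw [abs_neg]
    exact hV _ (hJ s hs)
  · rw [Tr.base _ (hJ s hs), neg_zero]
  · rw [fderiv_fun_neg, neg_apply, Tr.deriv_u _ (hJ s hs) v hv, neg_zero]
  · rw [fderiv_fun_neg, neg_apply, Tr.deriv_s _ (hJ s hs) v hv, neg_zero]
  · rw [fderiv_fun_neg, neg_apply, map_neg, neg_neg, Tr.deriv_c _ (hJ s hs)]
  · rw [neg_zero]; exact Tr.isClosed
  · rw [neg_zero, Tr.mem_zero, sup_comm]

/-- The unstable set of a map is the stable set of an inverse map. -/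
theorem mapUnstableSet_eq {P P' : Γ → Γ} {A V : Set Γ} {x : Γ}
    (hA : ∀ y ∈ A ∩ V, P' y ∈ A) (h : ∀ y ∈ A ∩ V, P (P' y) = y) (h' : ∀ y ∈ A ∩ V, P' (P y) = y) :
    mapUnstableSet P A V x = mapStableSet P' A V x := by
  ext U
  constructor
  · rintro ⟨u, rfl, hu, hPu, hux⟩
    have hit : ∀ n, P'^[n] (u 0) = u n := by
      intro n
      induction n with
      | zero => rfl
      | succ n ih => rw [Function.iterate_succ_apply', ih, ← hPu n, h' _ (hu (n + 1))]
    refine ⟨(hu 0).1, fun n => ?_, ?_⟩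
    · rw [hit]; exact (hu n).2
    · simp only [hit]; exact hux
  · rintro ⟨hUA, hUV, hUx⟩
    have hmem : ∀ n, P'^[n] U ∈ A ∩ V := by
      intro n
      induction n with
      | zero => exact ⟨hUA, hUV 0⟩
      | succ n ih =>
        refine ⟨?_, hUV (n + 1)⟩
        rw [Function.iterate_succ_apply']
        exact hA _ ih
    refine ⟨fun n => P'^[n] U, rfl, hmem, fun n => ?_, hUx⟩
    change P (P'^[n + 1] U) = P'^[n] U
    rw [Function.iterate_succ_apply', h _ (hmem n)]

/-- The maps `U ↦ slide R q s (R (±Δ - s) U)` of the section `S s` are inverse to each other. -/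
theorem TransitSys.sectionMap_inverse (Tr : TransitSys R U₀ Δ g₀ Es Eu S ε B q)
    (H : HypCycle R U₀ Δ g₀ Es Eu) {s τ : ℝ} (hs : s ∈ Icc (-Δ) Δ) {y : Γ} (hyS : y ∈ S s)
    (h0 : R (-s) y ∈ B) (h1 : R τ (R (-s) y) ∈ B)
    (h2 : R (q s (R τ (R (-s) y))) (R (-s) y) ∈ B) :
    slide R q s (R (-τ - s) (slide R q s (R (τ - s) y))) = y := by
  have e1 : R (τ - s) y = R τ (R (-s) y) := by rw [← H.flow.add, sub_eq_add_neg]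
  have e2 : R (-τ - s) (slide R q s (R τ (R (-s) y))) =
      R (q s (R τ (R (-s) y))) (R (-s) y) := by
    rw [slide, ← H.flow.add, ← H.flow.add]
    congr 1
    ring
  have e3 := H.flow.apply_neg s y
  rw [e1, e2, Tr.slide_flow H hs h0 h2 (Tr.lt s hs _ h1), Tr.slide_of_mem H hs h0 (by rwa [e3]), e3]

end Reversal

section Hypotheses

variable {Γ : Type*} [NormedAddCommGroup Γ] [NormedSpace ℝ Γ]

/-! ### Consequences of the hypotheses on the cycle -/

/-- A contracted subspace that has an algebraic complement of the form `Eu ⊔ span {g}` with `Eu`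
expanded and `g` fixed is closed. -/
theorem isClosed_of_contracted {T : Γ →L[ℝ] Γ} {g : Γ} {Es Eu : Submodule ℝ Γ} {c : ℝ}
    (hc0 : 0 < c) (hc1 : c < 1) (hg : T g = g) (hs : ∀ F ∈ Es, T F ∈ Es) (hu : ∀ F ∈ Eu, T F ∈ Eu)
    (hrs : ∀ F ∈ Es, ‖T F‖ ≤ c * ‖F‖) (hru : ∀ F ∈ Eu, ‖F‖ ≤ c * ‖T F‖)
    (htop : (Eu ⊔ Submodule.span ℝ {g}) ⊔ Es = ⊤) : IsClosed (Es : Set Γ) := by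
  -- Invariance and contraction are closed conditions, so every vector of the closure has iterates
  -- tending to `0`.
  have hK : ∀ F ∈ Es.topologicalClosure, T F ∈ Es.topologicalClosure ∧ ‖T F‖ ≤ c * ‖F‖ := by
    intro F hF
    constructor
    · exact map_mem_closure T.continuous hF fun F hF => hs F hF
    · have hcl : IsClosed {F : Γ | ‖T F‖ ≤ c * ‖F‖} :=
        isClosed_le (by fun_prop) (by fun_prop)
      exact closure_minimal (fun F hF => hrs F hF) hcl hF
  have hpow : ∀ F ∈ Es.topologicalClosure, Tendsto (fun n : ℕ => (T^[n]) F) atTop (𝓝 0) := by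
    intro F hF
    have h1 : ∀ n : ℕ, (T^[n]) F ∈ Es.topologicalClosure ∧ ‖(T^[n]) F‖ ≤ c ^ n * ‖F‖ := by
      intro n
      induction n with
      | zero => exact ⟨hF, by simp⟩
      | succ n ih =>
        rw [Function.iterate_succ_apply']
        refine ⟨(hK _ ih.1).1, (hK _ ih.1).2.trans ?_⟩
        rw [pow_succ', mul_assoc]
        exact mul_le_mul_of_nonneg_left ih.2 hc0.le
    refine squeeze_zero_norm (fun n => (h1 n).2) ?_
    have := (tendsto_pow_atTop_nhds_zero_of_lt_one hc0.le hc1).mul_const ‖F‖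
    rwa [zero_mul] at this
  refine isClosed_of_closure_subset fun v hv => ?_
  obtain ⟨u, hu', w, hw, rfl⟩ := Submodule.mem_sup.1 (htop ▸ Submodule.mem_top (x := v))
  obtain ⟨b, hb, d, hd, rfl⟩ := Submodule.mem_sup.1 hu'
  obtain ⟨t, rfl⟩ := Submodule.mem_span_singleton.1 hd
  -- The component of `v` off `Es` lies in the closure too, so its iterates tend to `0`. As `g` is
  -- fixed, the iterates of `b` stay bounded, which expansion permits only for `b = 0`; the fixed
  -- vector `t • g` must then vanish as well.
  have hbK : b + t • g ∈ Es.topologicalClosure := by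
    have := Es.topologicalClosure.sub_mem hv (Es.le_topologicalClosure hw)
    rwa [add_sub_cancel_right] at this
  have h1 := hpow _ hbK
  have h2 : ∀ n : ℕ, (T^[n]) b ∈ Eu ∧ (T^[n]) (b + t • g) = (T^[n]) b + t • g ∧
      ‖b‖ ≤ c ^ n * ‖(T^[n]) b‖ := by
    intro n
    induction n with
    | zero => exact ⟨hb, rfl, by simp⟩
    | succ n ih =>
      rw [Function.iterate_succ_apply', Function.iterate_succ_apply', ih.2.1, map_add, map_smul, hg]
      refine ⟨hu _ ih.1, rfl, ih.2.2.trans ?_⟩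
      rw [pow_succ, mul_assoc]
      exact mul_le_mul_of_nonneg_left (hru _ ih.1) (pow_nonneg hc0.le n)
  have h3 : Tendsto (fun n : ℕ => c ^ n * ‖(T^[n]) b‖) atTop (𝓝 0) := by
    have h4 : Tendsto (fun n : ℕ => c ^ n * ‖(T^[n]) (b + t • g) - t • g‖) atTop
        (𝓝 (0 * ‖(0 : Γ) - t • g‖)) :=
      (tendsto_pow_atTop_nhds_zero_of_lt_one hc0.le hc1).mul (h1.sub_const _).norm
    rw [zero_mul] at h4
    refine h4.congr fun n => ?_
    rw [(h2 n).2.1, add_sub_cancel_right]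
  have hb0 : b = 0 := norm_le_zero_iff.1 (ge_of_tendsto' h3 fun n => (h2 n).2.2)
  have hg0 : t • g = 0 := by
    have h4 : ∀ n : ℕ, (T^[n]) (b + t • g) = t • g := fun n => by
      have h5 : (T^[n]) (0 : Γ) = 0 := Function.iterate_fixed (map_zero T) n
      rw [(h2 n).2.1, hb0, h5, zero_add]
    exact (tendsto_nhds_unique (h1.congr h4) tendsto_const_nhds).symm
  rw [hb0, hg0, add_zero, zero_add]
  exact hw

theorem AssumptionL1.isCompl_u {R : ℝ → Γ → Γ} {U₀ : Γ} {Δ : ℝ} {N : ℕ} {Eu Es : Submodule ℝ Γ}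
    (h : AssumptionL1 R U₀ Δ N Eu Es) : IsCompl (Es ⊔ Ec R U₀) Eu := by
  constructor
  · have := h.disjoint_u_c.disjoint_sup_right_of_disjoint_sup_left h.isCompl.disjoint
    rw [sup_comm]
    exact this.symm
  · rw [codisjoint_iff, ← h.isCompl.sup_eq_top]
    ac_rfl

/-- Finite codimension alone would not close `Es`; the contraction does. Finite dimension of `Eu`
turns expansion, hence injectivity, into surjectivity. -/
theorem AssumptionL1.hypCycle [CompleteSpace Γ] {R : ℝ → Γ → Γ} (hR : IsFlow R) {U₀ : Γ} {Δ : ℝ}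
    (hlc : IsLimitCycle R U₀ Δ) {N : ℕ} {Eu Es : Submodule ℝ Γ}
    (h : AssumptionL1 R U₀ Δ N Eu Es) (hL2 : AssumptionL2 R U₀) :
    HypCycle R U₀ Δ (generator R U₀) Es Eu := by
  obtain ⟨κ, hκ, hru, hrs⟩ := h.rate
  have : FiniteDimensional ℝ Eu := h.dim_u.1
  have hΔ := hlc.pos
  set c := Real.exp (-κ * Δ) with hc
  have hc1 : c < 1 := Real.exp_lt_one_iff.2 (by nlinarith)
  have hru' : ∀ F ∈ Eu, ‖F‖ ≤ c * ‖flowTangent R Δ U₀ F‖ := by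
    intro F hF
    have h1 := mul_le_mul_of_nonneg_left (hru F hF) (Real.exp_nonneg (-κ * Δ))
    rwa [← mul_assoc, ← Real.exp_add, neg_mul, neg_add_cancel, Real.exp_zero, one_mul,
      ← neg_mul] at h1
  have hcl : IsClosed (Es : Set Γ) := isClosed_of_contracted (Real.exp_pos _) hc1 h.map_generator
    h.map_s h.map_u hrs hru' h.isCompl.sup_eq_top
  refine ⟨hR, hlc, fun s x hx => hL2.c11At hR hlc s hx, hL2.hasDerivAt hR, hcl,
    Submodule.closed_of_finiteDimensional Eu, ⟨?_, fun v => ?_⟩, h.map_s, h.map_u, ?_,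
    c, hc1, hrs, hru'⟩
  · have hker : ∀ z : (Es × ℝ) × Eu, HypCycle.sumMap (generator R U₀) Es Eu z = 0 → z = 0 := by
      rintro ⟨⟨⟨a, ha⟩, t⟩, ⟨b, hb⟩⟩ hz
      rw [HypCycle.sumMap_apply] at hz
      simp only at hz
      have h1 : a + t • generator R U₀ ∈ Es ⊔ Ec R U₀ :=
        Submodule.add_mem_sup ha (Submodule.smul_mem _ _ (Submodule.mem_span_singleton_self _))
      have hb0 : b = 0 := by
        refine Submodule.disjoint_def.1 h.isCompl_u.disjoint b ?_ hb
        rw [eq_neg_of_add_eq_zero_right hz]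
        exact Submodule.neg_mem _ h1
      rw [hb0, add_zero] at hz
      have ha0 : a = 0 := by
        refine Submodule.disjoint_def.1 h.isCompl.disjoint a ?_ ha
        rw [eq_neg_of_add_eq_zero_left hz]
        exact Submodule.neg_mem _ (Submodule.mem_sup_right
          (Submodule.smul_mem _ _ (Submodule.mem_span_singleton_self _)))
      rw [ha0, zero_add] at hz
      have ht0 := (smul_eq_zero.1 hz).resolve_right h.generator_ne_zero
      subst hb0 ha0 ht0
      rfl
    exact (injective_iff_map_eq_zero (HypCycle.sumMap (generator R U₀) Es Eu)).2 hker
  · obtain ⟨w, hw, b, hb, rfl⟩ := Submodule.mem_sup.1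
      (h.isCompl_u.sup_eq_top ▸ Submodule.mem_top (x := v))
    obtain ⟨a, ha, d, hd, rfl⟩ := Submodule.mem_sup.1 hw
    obtain ⟨t, rfl⟩ := Submodule.mem_span_singleton.1 hd
    exact ⟨((⟨a, ha⟩, t), ⟨b, hb⟩), rfl⟩
  · let Tu : Eu →ₗ[ℝ] Eu := (flowTangent R Δ U₀ : Γ →ₗ[ℝ] Γ).restrict h.map_u
    have hinj : Function.Injective Tu := by
      refine (injective_iff_map_eq_zero Tu).2 fun b hb => ?_
      have h1 := hru' b b.2
      have h2 : flowTangent R Δ U₀ (b : Γ) = 0 := congrArg Subtype.val hb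
      rw [h2, norm_zero, mul_zero] at h1
      exact Subtype.ext (norm_le_zero_iff.1 h1)
    intro F hF
    obtain ⟨b, hb⟩ := LinearMap.injective_iff_surjective.1 hinj ⟨F, hF⟩
    exact ⟨b, b.2, congrArg Subtype.val hb⟩

theorem AssumptionL1.hasCodim_sc {R : ℝ → Γ → Γ} {U₀ : Γ} {Δ : ℝ} {N : ℕ}
    {Eu Es : Submodule ℝ Γ} (h : AssumptionL1 R U₀ Δ N Eu Es) : HasCodim N (Es ⊔ Ec R U₀) := by
  have e := Submodule.quotientEquivOfIsCompl _ _ h.isCompl_u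
  have := h.dim_u.1
  exact ⟨Module.Finite.equiv e.symm, by rw [e.finrank_eq, h.dim_u.2]⟩

theorem AssumptionL1.hasDim_uc {R : ℝ → Γ → Γ} {U₀ : Γ} {Δ : ℝ} {N : ℕ}
    {Eu Es : Submodule ℝ Γ} (h : AssumptionL1 R U₀ Δ N Eu Es) :
    HasDim (N + 1) (Eu ⊔ Ec R U₀) := by
  have h1 : FiniteDimensional ℝ Eu := h.dim_u.1
  have h2 : FiniteDimensional ℝ (Ec R U₀) := by unfold Ec; infer_instance
  refine ⟨inferInstance, ?_⟩
  have h3 := Submodule.finrank_sup_add_finrank_inf_eq Eu (Ec R U₀)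
  have h4 : Module.finrank ℝ (Ec R U₀) = 1 := finrank_span_singleton h.generator_ne_zero
  rw [h.disjoint_u_c.eq_bot, finrank_bot, h.dim_u.2, h4] at h3
  simpa using h3

end Hypotheses

section PoincareMaps

variable {Γ : Type*} [NormedAddCommGroup Γ] [NormedSpace ℝ Γ] [CompleteSpace Γ]
  {R : ℝ → Γ → Γ} {U₀ : Γ} {Δ : ℝ} {g₀ : Γ} {Es Eu : Submodule ℝ Γ}
  {S : ℝ → Set Γ} {ε : ℝ} {B : Set Γ} {q : ℝ → Γ → ℝ}

/-! ### Poincaré maps -/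

/-- The stable and unstable manifolds of the Poincaré maps on the sections. -/
theorem HypCycle.exists_poincareMaps (H : HypCycle R U₀ Δ g₀ Es Eu)
    (Tr : TransitSys R U₀ Δ g₀ Es Eu S ε B q) {Size Size' : Submodule ℝ Γ → Prop}
    (hcs : Es.ClosedComplemented) (hs : Size Es) (hcu : Eu.ClosedComplemented) (hu : Size' Eu) :
    ∃ (p q : ℝ → Γ → ℝ) (O O' Ws Wu : ℝ → Set Γ),
      (∀ s ∈ Icc (-Δ) Δ,
        IsTransitTime R (S s) (R s U₀) Δ (O s) (p s) ∧
        IsTransitTime R (S s) U₀ s (O' s) (q s) ∧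
        IsStableManifold (transit R (p s)) (S s) (O s) (R s U₀)
          Size (Es.map (flowTangent R s U₀ : Γ →ₗ[ℝ] Γ)) (Ws s) ∧
        IsUnstableManifold (transit R (p s)) (S s) (O s) (R s U₀)
          Size' (Eu.map (flowTangent R s U₀ : Γ →ₗ[ℝ] Γ)) (Wu s) ∧
        Ws 0 ⊆ O' s ∧ Wu 0 ⊆ O' s ∧
        Ws s = transit R (q s) '' Ws 0 ∧
        Wu s = transit R (q s) '' Wu 0) ∧
      stableSet R (cycle R U₀) = ⋃ s : ℝ, R s '' Ws 0 ∧
      unstableSet R (cycle R U₀) = ⋃ s : ℝ, R s '' Wu 0 := by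
  have hB : B ∈ 𝓝 U₀ := Tr.isOpen.mem_nhds Tr.mem
  have htend : ∀ τ, R τ U₀ = U₀ → Tendsto (R τ) (𝓝 U₀) (𝓝 U₀) := fun τ hτ => by
    have := (H.continuousAt_flow τ H.mem_cycle_base).tendsto
    rwa [hτ] at this
  have hneg : R (-Δ) U₀ = U₀ := by
    have := H.flow.neg_apply Δ U₀
    rwa [H.lc.periodic] at this
  obtain ⟨η, hη, hflow⟩ := H.eventually_flow_small hB
  have hback : ∀ τ, R τ U₀ = U₀ → ∀ᶠ z in 𝓝 U₀, R τ z ∈ B ∧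
      ∀ s ∈ Icc (-Δ) Δ, R (q s (R τ z)) z ∈ B := by
    intro τ hτ
    filter_upwards [(htend τ hτ).eventually hB, hflow, (htend τ hτ).eventually (Tr.small η hη)]
      with z h1 h2 h3
    exact ⟨h1, fun s hs => h2 _ (h3 s hs)⟩
  -- The return over `Δ` and over `-Δ` are both controlled, since the unstable side uses the
  -- backward section map as an inverse of the Poincaré map.
  obtain ⟨D, hD, hDo, hUD⟩ := eventually_nhds_iff.1
    ((((show ∀ᶠ z in 𝓝 U₀, z ∈ B from hB).and (hback Δ H.lc.periodic)).and (hback (-Δ) hneg)).and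
      ((H.eventually_c11At_neg (-Δ) Δ).and (H.c11 Δ U₀ H.mem_cycle_base |>.eventually |>
        fun h => (by fun_prop : ContinuousAt (fun z : Γ => (Δ, z)) U₀).eventually h)))
  have hDn : D ∈ 𝓝 U₀ := hDo.mem_nhds hUD
  have hDB : D ⊆ B := fun z hz => (hD z hz).1.1.1
  obtain ⟨Ws, hWs, hWsD, hWss⟩ := H.exists_sectionManifolds Tr hDn hcs hs
  obtain ⟨Wu, hWu, hWuD, hWuu⟩ := H.reverse.exists_sectionManifolds Tr.reverse hDn hcu hu
  have hJ : ∀ s ∈ Icc (-Δ) Δ, -s ∈ Icc (-Δ) Δ := fun s hs =>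
    ⟨by linarith [hs.2], by linarith [hs.1]⟩
  -- A point near `R s U₀` is carried near `U₀` by `R (Δ - s)`, and from there the transit map to `S
  -- s` applies. One family `q` thus provides both the Poincaré and the transit maps.
  have hp : ∀ s, transit R (fun U => Δ + q s (R (Δ - s) U)) =
      fun U => slide R q s (R (Δ - s) U) := fun s => funext fun U => by
    rw [transit, slide, ← H.flow.add]
    congr 1
    ring
  have hc : ∀ s ∈ Icc (-Δ) Δ, ∀ y, R (-s) y ∈ D → C11At (R (-s)) y := fun s hs y hy => by
    have := c11At_flow ((hD _ hy).2.1 s hs)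
    rwa [H.flow.apply_neg] at this
  have hsplit : ∀ s τ U, R (τ - s) U = R τ (R (-s) U) := fun s τ U => by
    rw [← H.flow.add, sub_eq_add_neg]
  have hrev : ∀ s, slide (fun s => R (-s)) (fun s V => -q (-s) V) (-s) = slide R q s := fun s =>
    funext fun V => by simp only [slide, neg_add, neg_neg]
  refine ⟨fun s U => Δ + q s (R (Δ - s) U), fun s U => s + q s U, fun s => {y | R (-s) y ∈ D},
    fun _ => B, Ws, fun s => Wu (-s), fun s hs => ⟨?_, ?_, ?_, ?_, ?_, ?_, ?_, ?_⟩, hWss, ?_⟩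
  · have hO : IsOpen {y | R (-s) y ∈ D} := isOpen_iff_mem_nhds.2 fun y hy =>
      (hc s hs y hy).continuousAt (hDo.mem_nhds hy)
    refine ⟨hO, ?_, (c11On_iff hO).2 fun y hy => ?_, ?_, fun y hy => ?_⟩
    · rw [mem_ofPred_eq, H.flow.neg_apply]; exact hUD
    · refine (C11At.const _ _).add ?_
      simp only [hsplit]
      exact C11At.comp (g := q s) (f := fun U => R Δ (R (-s) U))
        (Tr.c11 s hs _ (hD _ hy).1.1.2.1)
        (C11At.comp (g := R Δ) (f := R (-s)) (c11At_flow (hD _ hy).2.2) (hc s hs y hy))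
    · change Δ + q s (R (Δ - s) (R s U₀)) = Δ
      rw [hsplit, H.flow.neg_apply, H.lc.periodic, Tr.base s hs, add_zero]
    · have h1 := congrFun (hp s) y
      rw [transit] at h1
      rw [h1]
      refine Tr.sec s hs _ ?_
      rw [hsplit]
      exact (hD _ hy).1.1.2.1
  · refine ⟨Tr.isOpen, Tr.mem, (c11On_iff Tr.isOpen).2 fun y hy =>
      (C11At.const _ _).add (Tr.c11 s hs y hy), ?_, fun y hy => Tr.sec s hs y hy⟩
    change s + q s U₀ = s
    rw [Tr.base s hs, add_zero]
  · obtain ⟨⟨V, hV, hxV, hVD, hWV⟩, h2, h3, -⟩ := hWs s hs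
    exact ⟨⟨V, hV, hxV, hVD, by rw [hp]; exact hWV⟩, h2, h3⟩
  · obtain ⟨⟨V, hV, hxV, hVD, hWV⟩, h2, h3, -⟩ := hWu (-s) (hJ s hs)
    simp only [neg_neg] at hxV hVD hWV h3
    rw [flowTangent_reverse, neg_neg] at h3
    refine ⟨⟨V, hV, hxV, hVD, ?_⟩, h2, h3⟩
    change Wu (-s) = mapUnstableSet (transit R fun U => Δ + q s (R (Δ - s) U)) (S s) V (R s U₀)
    rw [hWV, hp, hrev]
    have e1 : ∀ U, R (-(Δ - -s)) U = R (-Δ - s) U := fun U => by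
      rw [show -(Δ - -s) = -Δ - s by ring]
    simp only [e1]
    -- The backward section map inverts the Poincaré map on the section near `R s U₀`, so stability
    -- for the reversed flow becomes the existence of a convergent backward orbit.
    refine (mapUnstableSet_eq (fun y hy => ?_) (fun y hy => ?_) (fun y hy => ?_)).symm
    · refine Tr.sec s hs _ ?_
      rw [hsplit]
      exact (hD _ (hVD y hy.2)).1.2.1
    · have h4 := hD _ (hVD y hy.2)
      have := Tr.sectionMap_inverse H hs hy.1 h4.1.1.1 h4.1.2.1 (h4.1.2.2 s hs)
      rwa [neg_neg] at this
    · have h4 := hD _ (hVD y hy.2)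
      exact Tr.sectionMap_inverse H hs hy.1 h4.1.1.1 h4.1.1.2.1 (h4.1.1.2.2 s hs)
  · exact hWsD.trans hDB
  · simp only [neg_zero]; exact hWuD.trans hDB
  · exact (hWs s hs).2.2.2
  · have h1 := (hWu (-s) (hJ s hs)).2.2.2
    rw [hrev] at h1
    simp only [neg_zero]
    exact h1
  · rw [cycle_reverse, stableSet_reverse] at hWuu
    simp only [neg_zero]
    rw [hWuu]
    exact neg_surjective.iUnion_comp fun s => R s '' Wu 0

end PoincareMaps

end RG

/-! ### Assembly: the forward and the time-reversed results together. -/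

theorem mainTheorem7 {Γ : Type*} [NormedAddCommGroup Γ] [NormedSpace ℝ Γ] [CompleteSpace Γ]
    (R : ℝ → Γ → Γ) (hR : IsFlow R) (U₀ : Γ) (Δ : ℝ) (hlc : IsLimitCycle R U₀ Δ)
    (N : ℕ) (Eu Es : Submodule ℝ Γ)
    (hL1 : AssumptionL1 R U₀ Δ N Eu Es) (hL2 : AssumptionL2 R U₀) :
    -- the stable and the unstable manifold of the cycle in a tubular neighbourhood
    (∃ δ : ℝ, 0 < δ ∧
      (IsC11Submanifold (HasCodim N)
          (localStableSet R (cycle R U₀) (Metric.thickening δ (cycle R U₀))) ∧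
        ∀ s : ℝ, tangentSet (localStableSet R (cycle R U₀) (Metric.thickening δ (cycle R U₀)))
            (R s U₀) = ((Es ⊔ Ec R U₀).map (flowTangent R s U₀ : Γ →ₗ[ℝ] Γ) : Set Γ)) ∧
      (IsC11Submanifold (HasDim (N + 1))
          (localUnstableSet R (cycle R U₀) (Metric.thickening δ (cycle R U₀))) ∧
        ∀ s : ℝ, tangentSet (localUnstableSet R (cycle R U₀) (Metric.thickening δ (cycle R U₀)))
            (R s U₀) = ((Eu ⊔ Ec R U₀).map (flowTangent R s U₀ : Γ →ₗ[ℝ] Γ) : Set Γ))) ∧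
    -- the Poincaré maps `transit R (p s)` on the sections, with domains `O s`, the maps
    -- `transit R (q s)` from the section at `U₀` to the others, with domains `O' s`, and
    -- the stable and unstable manifolds `Ws s`, `Wu s` of the Poincaré maps
    ∃ (p q : ℝ → Γ → ℝ) (O O' Ws Wu : ℝ → Set Γ),
      (∀ s ∈ Icc (-Δ) Δ,
        IsTransitTime R (poincareSection R U₀ Eu Es s) (R s U₀) Δ (O s) (p s) ∧
        IsTransitTime R (poincareSection R U₀ Eu Es s) U₀ s (O' s) (q s) ∧
        IsStableManifold (transit R (p s)) (poincareSection R U₀ Eu Es s) (O s) (R s U₀)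
          (HasCodim (N + 1)) (Es.map (flowTangent R s U₀ : Γ →ₗ[ℝ] Γ)) (Ws s) ∧
        IsUnstableManifold (transit R (p s)) (poincareSection R U₀ Eu Es s) (O s) (R s U₀)
          (HasDim N) (Eu.map (flowTangent R s U₀ : Γ →ₗ[ℝ] Γ)) (Wu s) ∧
        Ws 0 ⊆ O' s ∧ Wu 0 ⊆ O' s ∧
        Ws s = transit R (q s) '' Ws 0 ∧
        Wu s = transit R (q s) '' Wu 0) ∧
      -- sweeping along the flow
      stableSet R (cycle R U₀) = ⋃ s : ℝ, R s '' Ws 0 ∧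
      unstableSet R (cycle R U₀) = ⋃ s : ℝ, R s '' Wu 0 := by
  have H := hL1.hypCycle hR hlc hL2
  obtain ⟨ε, B, q, Tr⟩ := H.exists_transitSys
  have hfu : FiniteDimensional ℝ Eu := hL1.dim_u.1
  have hfs : FiniteDimensional ℝ (Γ ⧸ Es) := hL1.codim_s.1
  have hfc : FiniteDimensional ℝ (Γ ⧸ (Es ⊔ Ec R U₀)) := hL1.hasCodim_sc.1
  have hfuc : FiniteDimensional ℝ ↥(Eu ⊔ Ec R U₀) := hL1.hasDim_uc.1
  have hcs : Es.ClosedComplemented := .of_finiteDimensional_quotient H.closed_s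
  have hcsc : (Es ⊔ Ec R U₀).ClosedComplemented := .of_finiteDimensional_quotient
    (Submodule.isClosed_mono_of_finiteDimensional_quotient H.closed_s le_sup_left)
  have hcu : Eu.ClosedComplemented := .of_finiteDimensional Eu
  have hcuc : (Eu ⊔ Ec R U₀).ClosedComplemented := .of_finiteDimensional _
  refine ⟨?_, H.exists_poincareMaps Tr hcs hL1.codim_s hcu hL1.dim_u⟩
  have hspan : Submodule.span ℝ {-generator R U₀} = Ec R U₀ := by
    rw [Ec, ← Set.neg_singleton, Submodule.span_neg]
  obtain ⟨δ₁, hδ₁, h₁⟩ := H.exists_stableManifold Tr (Size := HasCodim N) hcsc hL1.hasCodim_sc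
  obtain ⟨δ₂, hδ₂, h₂⟩ := H.reverse.exists_stableManifold Tr.reverse (Size := HasDim (N + 1))
    (by rw [hspan]; exact hcuc) (by rw [hspan]; exact hL1.hasDim_uc)
  -- Both manifold statements hold for all sufficiently small tubes, so one radius serves the two
  -- time directions.
  refine ⟨min δ₁ δ₂, lt_min hδ₁ hδ₂, h₁ _ (lt_min hδ₁ hδ₂) (min_le_left _ _), ?_⟩
  obtain ⟨h₃, h₄⟩ := h₂ _ (lt_min hδ₁ hδ₂) (min_le_right _ _)
  rw [cycle_reverse, localStableSet_reverse, hspan] at *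
  refine ⟨h₃, fun s => ?_⟩
  -- The point `R s U₀` is reached by the reversed flow at time `-s`.
  have := h₄ (-s)
  rwa [flowTangent_reverse, neg_neg] at this
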